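/- **Setting.** A rooted forest $\mathcal F$ is a nonempty finite graph with vertex set $V(\mathcal F)$, without cycles, with a root chosen in each connected component. Its vertices are partially ordered by $\alpha\le\beta$ iff $\alpha$ lies on the path from a root to $\beta$; a non-root $\alpha$ has a parent $\hat\alpha$, its neighbour nearer to the root; leaves are the maxima. A leafy rooted forest $\mathcal F^*=(\mathcal F,\ell)$ is a rooted forest with a set $\ell$ of marked leaves, and $\mathcal F^+$ is the rooted forest obtained from $\mathcal F$ by adding a new maximum $\alpha^+$ with parent $\alpha$ above each $\alpha\in\ell$. Let $F^+$ be the underlying forest of $\mathcal F^+$. *Hypersurface.* Fix $\delta>0$; a continuous $b:\mathbb R\to\mathbb R$, smooth away from $0$, with $|b|<\delta/4$, $b(t)=0$ unless $0<t<\delta/4$, and $\lim_{t\to0^+}b'(t)=-\infty$; and a $C^1$ submersion $f:\mathbb R^2\to\mathbb R$ with $\{f=0\}=\{x_1=0,x_2\ge0\}\cup\{x_1>0,x_2=b(x_1)\}$, with $f=x_2$ on $\{x_1>2\delta,|x_2|<\delta\}$, $f=x_1$ on $\{|x_1|<\delta,x_2>2\delta\}$, and such that $f(x_1,x_2)<\delta$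 implies $x_1<\delta$ or $x_2<\delta$. On $\mathbb R^{\mathcal F^+}$ (real functions on $V(\mathcal F^+)$) put $h_\rho=x_\rho$ for a root $\rho$ and $h_\alpha=f(h_{\hat\alpha},x_\alpha)$ otherwise. Let $\mathsf P_\alpha=\{h_\alpha=0\}$ for a root and $\mathsf P_\alpha=\{h_\alpha=0,\ h_{\hat\alpha}\ge0,\ x_\alpha=b(h_{\hat\alpha})\}$ otherwise (the closure of $\{h_\alpha=0,h_{\hat\alpha}>0\}$). The smoothed arboreal hypersurface of $\mathcal F^*$ is $\mathsf H_{\mathcal F^*}=\bigcup_{\alpha\in V(\mathcal F^+)\setminus\ell}\mathsf P_\alpha\subset\mathbb R^{\mathcal F^+}$. *Coray bundle.* For a closed $H\subset M=\mathbb R^n$ with dense ($C^1$) smooth locus $H^{sm}$, the coline bundle is the closure $L_H$ in $P^*M=(T^*M\setminus M)/\mathbb R^\times$ of the conormal lines along $H^{sm}$, and the coray bundle is the closure $R_H$ in $S^*M=(T^*M\setminus M)/\mathbb R_{>0}$ of the conormal rays along $H^{sm}$; $H$ is in good position if $L_H$ is finite over $H$. A coorientation is a continuous section $\sigma$ of $R_H\to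 L_H$; its positive coray bundle is $\sigma(L_H)\subset S^*M$. A coorientation of $\mathsf H_{\mathcal F^*}$ is natural if, for all $\alpha\in V(\mathcal F^+)$, at the points of $\{h_\alpha=0\}$ it sends the line of $dh_\alpha$, whenever it lies in the coline bundle, to the ray of $dh_\alpha$. *Arboreal singularity.* For a tree $T$, let $\mathfrak P_T$ be the poset of correspondences $\mathfrak p=(R\twoheadleftarrow S\hookrightarrow T)$, $S$ a subtree and $R$ a quotient tree of $S$ with subtrees as fibers, where $\mathfrak p'\le\mathfrak p$ iff $\mathfrak p=\mathfrak q\circ\mathfrak p'$ for some correspondence $\mathfrak q$; its minimum is the identity $\mathfrak p_0$. The arboreal singularity $\mathsf L_T$ is the cone over the order complex of $\mathfrak P_T\setminus\{\mathfrak p_0\}$; its open cell indexed by $\mathfrak p\ne\mathfrak p_0$ consists of the points, other than the cone point, over points of the order complex whose supporting chain has maximum $\mathfrak p$. For a forest $F=\coprod_iT_i$ put $\mathsf L_F=\coprod_i\mathsf L_{T_i}\times\mathbb R^{V(F)\setminus V(T_i)}$, with open cells the products of open cells with the Euclidean factors; they are indexed by the correspondences $R\twoheadleftarrow S\hookrightarrow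 F$. **Proposition.** Let $\mathcal F^*=(\mathcal F,\ell)$ be a leafy rooted forest. The hypersurface $\mathsf H_{\mathcal F^*}\subset\mathbb R^{\mathcal F^+}$ is in good position and has a unique natural coorientation. Let $\Lambda_{\mathcal F^*}\subset S^*\mathbb R^{\mathcal F^+}$ be its positive coray bundle. Deleting from $\mathsf L_{F^+}$ the open cells indexed by $$\mathfrak p_\alpha=(\{pt\}\twoheadleftarrow\{\alpha\}\hookrightarrow F^+),\qquad \mathfrak p_{\alpha^+,\alpha}=(\{pt\}\twoheadleftarrow\{\alpha^+,\alpha\}\hookrightarrow F^+),\qquad \alpha\in\ell,$$ leaves a closed subspace of $\mathsf L_{F^+}$, and $\Lambda_{\mathcal F^*}$ is homeomorphic to this closed subspace. -/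

import Mathlib

open Set Filter Topology
open scoped ContDiff

noncomputable section

/-! ## Rooted forests -/

/-- A rooted forest with vertex set `V`: an acyclic graph with a distinguished root vertex in
each connected component. -/
structure RootedForest (V : Type*) where
  graph : SimpleGraph V
  acyclic : graph.IsAcyclic
  roots : Set V
  root_existsUnique : ∀ v, ∃! r, r ∈ roots ∧ graph.Reachable r v

namespace RootedForest

variable {V : Type*} (F : RootedForest V)

/-- The root of the component of `v`. -/
def rootOf (v : V) : V := (F.root_existsUnique v).choose

theorem rootOf_mem (v : V) : F.rootOf v ∈ F.roots :=
  (F.root_existsUnique v).choose_spec.1.1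

theorem rootOf_reachable (v : V) : F.graph.Reachable (F.rootOf v) v :=
  (F.root_existsUnique v).choose_spec.1.2

theorem eq_rootOf {r v : V} (hr : r ∈ F.roots) (h : F.graph.Reachable r v) : r = F.rootOf v :=
  (F.root_existsUnique v).choose_spec.2 r ⟨hr, h⟩

/-- The distance of `v` to the root of its component. -/
def height (v : V) : ℕ := F.graph.dist (F.rootOf v) v

/-- The partial order on the vertices: `u ≤ v` when `u` lies on the minimal path from the root
of the component of `v` to `v`. -/
def le (u v : V) : Prop :=
  F.graph.Reachable u v ∧ F.height u + F.graph.dist u v = F.height v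

/-- A leaf vertex is a maximum of the partial order. -/
def IsLeaf (v : V) : Prop := ∀ w, F.le v w → w = v

/-- `u` is the parent of `v`: the neighbour of `v` that is nearer to the root. -/
def IsParent (u v : V) : Prop := F.graph.Adj u v ∧ F.height v = F.height u + 1

theorem exists_isParent {v : V} (hv : v ∉ F.roots) : ∃ u, F.IsParent u v := by
  have hmem := F.rootOf_mem v
  obtain ⟨p, hp⟩ := (F.rootOf_reachable v).symm.exists_walk_length_eq_dist
  have hne : v ≠ F.rootOf v := fun h => hv (h ▸ hmem)
  unfold IsParent height
  have hroots : ∀ u, F.graph.Reachable u (F.rootOf v) → F.rootOf v = F.rootOf u :=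
    fun u hu => F.eq_rootOf hmem hu.symm
  generalize F.rootOf v = r at *
  cases p with
  | nil => exact absurd rfl hne
  | @cons _ u _ hadj q =>
    have hroot : r = F.rootOf u := hroots u q.reachable
    refine ⟨u, hadj.symm, ?_⟩
    have h1 : F.graph.dist u r ≤ q.length := F.graph.dist_le q
    have h2 : F.graph.dist v r ≤ F.graph.dist u r + 1 := by
      obtain ⟨w, hw⟩ := q.reachable.exists_walk_length_eq_dist
      have := F.graph.dist_le (SimpleGraph.Walk.cons hadj w)
      rw [SimpleGraph.Walk.length_cons, hw] at this
      exact this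
    rw [SimpleGraph.Walk.length_cons] at hp
    rw [← hroot, F.graph.dist_comm (u := r) (v := v), F.graph.dist_comm (u := r) (v := u)]
    omega

/-- The parent of a vertex that is not a root. -/
def parent (v : V) (hv : v ∉ F.roots) : V := (F.exists_isParent hv).choose

theorem parent_spec (v : V) (hv : v ∉ F.roots) : F.IsParent (F.parent v hv) v :=
  (F.exists_isParent hv).choose_spec

end RootedForest

/-- A leafy rooted forest: a rooted forest with a set of marked leaf vertices. -/
structure LeafyRootedForest (V : Type*) extends RootedForest V where
  marked : Finset V
  marked_isLeaf : ∀ v ∈ marked, toRootedForest.IsLeaf v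

namespace LeafyRootedForest

variable {V : Type*} (F : LeafyRootedForest V)

/-- The vertices of the enlarged forest: the old vertices, `Sum.inl v`, and one new vertex
`Sum.inr a` for each marked leaf `a`. -/
abbrev PlusVertex : Type _ := V ⊕ {v // v ∈ F.marked}

/-- The adjacency relation of the enlarged forest. -/
def plusAdj : F.PlusVertex → F.PlusVertex → Prop
  | Sum.inl v, Sum.inl w => F.graph.Adj v w
  | Sum.inl v, Sum.inr a => v = a
  | Sum.inr a, Sum.inl v => v = a
  | Sum.inr _, Sum.inr _ => False

/-- The graph of the enlarged forest: `F` with an edge from each marked leaf to its new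
vertex. -/
def plusGraph : SimpleGraph F.PlusVertex where
  Adj := F.plusAdj
  symm := ⟨by
    rintro (v | a) (w | b) h
    · exact F.graph.adj_symm h
    · exact h
    · exact h
    · exact h⟩
  loopless := ⟨by
    rintro (v | a) h
    · exact F.graph.irrefl h
    · exact h⟩

/-- The map collapsing each new vertex to the marked leaf below it. -/
def plusCollapse : F.PlusVertex → V
  | Sum.inl v => v
  | Sum.inr a => a

theorem plus_reachable_collapse {x y : F.PlusVertex} (h : F.plusGraph.Reachable x y) :
    F.graph.Reachable (F.plusCollapse x) (F.plusCollapse y) := by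
  obtain ⟨p⟩ := h
  induction p with
  | nil => exact SimpleGraph.Reachable.refl _
  | @cons u v w hadj _ ih =>
    refine SimpleGraph.Reachable.trans ?_ ih
    rcases u with u | a <;> rcases v with v | c
    · exact SimpleGraph.Adj.reachable hadj
    · have h : u = c := hadj
      exact h ▸ SimpleGraph.Reachable.refl _
    · have h : v = a := hadj
      exact h ▸ SimpleGraph.Reachable.refl _
    · exact False.elim hadj

theorem plus_reachable_inl {v w : V} (h : F.graph.Reachable v w) :
    F.plusGraph.Reachable (Sum.inl v) (Sum.inl w) :=
  h.map (⟨Sum.inl, fun h => h⟩ : F.graph →g F.plusGraph)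

theorem plus_reachable_collapse_inl (x : F.PlusVertex) :
    F.plusGraph.Reachable (Sum.inl (F.plusCollapse x)) x := by
  rcases x with v | a
  · exact SimpleGraph.Reachable.refl _
  · exact SimpleGraph.Adj.reachable (show F.plusAdj (Sum.inl (a : V)) (Sum.inr a) from rfl)

theorem plus_acyclic : F.plusGraph.IsAcyclic := by
  have key : ∀ a : {v // v ∈ F.marked},
      ¬ (F.plusGraph.deleteEdges {s(Sum.inr a, Sum.inl (a : V))}).Reachable
        (Sum.inr a) (Sum.inl (a : V)) := by
    rintro a ⟨p⟩
    cases p with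
    | @cons _ u _ hadj _ =>
      rw [SimpleGraph.deleteEdges_adj] at hadj
      rcases u with u | c
      · have h : u = a := hadj.1
        subst h
        exact hadj.2 rfl
      · exact hadj.1
  rw [SimpleGraph.isAcyclic_iff_forall_adj_isBridge]
  rintro (v | a) (w | c) hadj
  · have hb := (SimpleGraph.isAcyclic_iff_forall_adj_isBridge.1 F.acyclic) (v := v) (w := w) hadj
    rw [SimpleGraph.isBridge_iff] at hb ⊢
    intro hr
    refine hb ?_
    have aux : ∀ {x y : F.PlusVertex},
        (F.plusGraph.deleteEdges {s(Sum.inl v, Sum.inl w)}).Reachable x y →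
        (F.graph.deleteEdges {s(v, w)}).Reachable (F.plusCollapse x) (F.plusCollapse y) := by
      rintro x y ⟨p⟩
      induction p with
      | nil => exact SimpleGraph.Reachable.refl _
      | @cons x y z hxy _ ih =>
        refine SimpleGraph.Reachable.trans ?_ ih
        rw [SimpleGraph.deleteEdges_adj] at hxy
        rcases x with x | a <;> rcases y with y | d
        · refine SimpleGraph.Adj.reachable ?_
          rw [SimpleGraph.deleteEdges_adj]
          refine ⟨hxy.1, fun h => hxy.2 ?_⟩
          have h' : s(x, y) = s(v, w) := h
          exact congrArg (Sym2.map Sum.inl) h'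
        · have h : x = d := hxy.1
          exact h ▸ SimpleGraph.Reachable.refl _
        · have h : y = a := hxy.1
          exact h ▸ SimpleGraph.Reachable.refl _
        · exact False.elim hxy.1
    exact aux hr
  · have h : v = c := hadj
    subst h
    rw [SimpleGraph.isBridge_iff, Sym2.eq_swap]
    exact fun h => key c h.symm
  · have h : w = a := hadj
    subst h
    rw [SimpleGraph.isBridge_iff]
    exact key a
  · exact False.elim hadj

/-- The rooted forest obtained by adding a new maximum above each marked leaf. -/
def plus : RootedForest F.PlusVertex where
  graph := F.plusGraph
  acyclic := F.plus_acyclic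
  roots := Sum.inl '' F.roots
  root_existsUnique := by
    intro x
    refine ⟨Sum.inl (F.rootOf (F.plusCollapse x)), ⟨⟨_, F.rootOf_mem _, rfl⟩, ?_⟩, ?_⟩
    · exact (F.plus_reachable_inl (F.rootOf_reachable _)).trans (F.plus_reachable_collapse_inl x)
    · rintro _ ⟨⟨r, hr, rfl⟩, hrx⟩
      exact congrArg Sum.inl (F.eq_rootOf hr (F.plus_reachable_collapse hrx))

end LeafyRootedForest

/-! ## Correspondences and arboreal singularities -/

/-- A correspondence `R ↞ S ↪ G`, up to isomorphism, where `S` is a subtree of the forest `G` and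
`R` is a quotient tree of `S`. It is given by the partition of `S` into the fibers of `S ↠ R`,
which are subtrees; `S` is the union of the fibers. (In a forest a vertex-induced subgraph is a
tree exactly when it is connected; connectedness includes being nonempty.) -/
@[ext]
structure TreeCorrespondence {W : Type*} (G : SimpleGraph W) where
  fibers : Set (Set W)
  fibers_connected : ∀ B ∈ fibers, (G.induce B).Connected
  fibers_disjoint : fibers.PairwiseDisjoint id
  subtree_connected : (G.induce (⋃₀ fibers)).Connected

namespace TreeCorrespondence

variable {W : Type*} {G : SimpleGraph W}

theorem fibers_nonempty (p : TreeCorrespondence G) {B : Set W} (hB : B ∈ p.fibers) :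
    B.Nonempty := Set.nonempty_coe_sort.1 (p.fibers_connected B hB).nonempty

/-- `p ≤ p'` when `p' = q ∘ p` for a correspondence `q = (R' ↞ Q ↪ R)`, where `R` and `R'` are
the quotient trees of `p` and `p'`. A vertex of `R` is a fiber of `p`, so `q` amounts to grouping
some of the fibers of `p` into the fibers of `p'`. -/
instance : PartialOrder (TreeCorrespondence G) where
  le p p' := ∀ B ∈ p'.fibers, ∃ A ⊆ p.fibers, ⋃₀ A = B
  le_refl p B hB := ⟨{B}, Set.singleton_subset_iff.2 hB, Set.sUnion_singleton B⟩
  le_trans p p' p'' h h' B hB := by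
    obtain ⟨A, hA, rfl⟩ := h' B hB
    refine ⟨{C | C ∈ p.fibers ∧ ∃ D ∈ A, C ⊆ D}, fun C hC => hC.1, ?_⟩
    apply Set.Subset.antisymm
    · rintro x ⟨C, ⟨_, D, hD, hCD⟩, hx⟩
      exact ⟨D, hD, hCD hx⟩
    · rintro x ⟨D, hD, hx⟩
      obtain ⟨E, hE, rfl⟩ := h D (hA hD)
      obtain ⟨C, hC, hxC⟩ := hx
      exact ⟨C, ⟨hE hC, _, hD, Set.subset_sUnion_of_mem hC⟩, hxC⟩
  le_antisymm := by
    have key : ∀ p p' : TreeCorrespondence G,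
        (∀ B ∈ p'.fibers, ∃ A ⊆ p.fibers, ⋃₀ A = B) →
        (∀ B ∈ p.fibers, ∃ A ⊆ p'.fibers, ⋃₀ A = B) → p'.fibers ⊆ p.fibers := by
      intro p p' h h' B hB
      obtain ⟨A, hA, hAB⟩ := h B hB
      obtain ⟨x, hx⟩ := p'.fibers_nonempty hB
      obtain ⟨C, hC, hxC⟩ : x ∈ ⋃₀ A := hAB ▸ hx
      obtain ⟨D, hD, hDC⟩ := h' C (hA hC)
      obtain ⟨E, hE, hxE⟩ : x ∈ ⋃₀ D := hDC ▸ hxC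
      have hEB : E = B := by
        by_contra hne
        exact Set.disjoint_left.1 (p'.fibers_disjoint (hD hE) hB hne) hxE hx
      have hCB : C ⊆ B := hAB ▸ Set.subset_sUnion_of_mem hC
      have hBC : B ⊆ C := by
        rw [← hDC, ← hEB]
        exact Set.subset_sUnion_of_mem hE
      rw [Set.Subset.antisymm hBC hCB]
      exact hA hC
    intro p p' h h'
    exact TreeCorrespondence.ext (Set.Subset.antisymm (key p' p h' h) (key p p' h h'))

/-- The identity correspondence: every fiber is a single vertex, and `S` is everything. -/
def IsIdentity (p : TreeCorrespondence G) : Prop := p.fibers = Set.range fun v : W => {v}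

/-- The correspondence `{pt} ↞ S ↪ G` that contracts the subtree `S` to a point. -/
def contract (S : Set W) (hS : (G.induce S).Connected) : TreeCorrespondence G where
  fibers := {S}
  fibers_connected := by
    rintro B rfl
    exact hS
  fibers_disjoint := Set.pairwiseDisjoint_singleton S id
  subtree_connected := by
    rw [Set.sUnion_singleton]
    exact hS

end TreeCorrespondence

/-- The arboreal singularity of a tree `T`: the cone over the order complex of the poset of
non-identity correspondences. The order complex is realized as usual by barycentric coordinates
(nonnegative, with total `1`, supported on a chain), and its cone by all nonnegative multiples
of these; the zero function is the cone point. -/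
def ArborealSingularity {W : Type*} (T : SimpleGraph W) : Type _ :=
  {w : TreeCorrespondence T → ℝ //
    (∀ p, 0 ≤ w p) ∧ (∀ p, p.IsIdentity → w p = 0) ∧ IsChain (· ≤ ·) {p | w p ≠ 0}}

instance {W : Type*} (T : SimpleGraph W) : TopologicalSpace (ArborealSingularity T) :=
  inferInstanceAs (TopologicalSpace {w : TreeCorrespondence T → ℝ //
    (∀ p, 0 ≤ w p) ∧ (∀ p, p.IsIdentity → w p = 0) ∧ IsChain (· ≤ ·) {p | w p ≠ 0}})

/-- The open cell of the arboreal singularity indexed by `p`. The identity indexes the cone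
point. For any other `p` it is the cone, without the cone point, over the open cell of the link
indexed by `p`, which is the set of points of the order complex whose support has largest
element `p`. -/
def ArborealSingularity.openCell {W : Type*} {T : SimpleGraph W} (p : TreeCorrespondence T) :
    Set (ArborealSingularity T) :=
  {w | (p.IsIdentity ∧ ∀ q, w.1 q = 0) ∨ (0 < w.1 p ∧ ∀ q, w.1 q ≠ 0 → q ≤ p)}

/-- The arboreal space of a forest: the disjoint union, over its trees, of the product of the
arboreal singularity of the tree with the Euclidean space on the remaining vertices. -/
abbrev ArborealSpace {W : Type*} (G : SimpleGraph W) : Type _ :=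
  Σ c : G.ConnectedComponent, ArborealSingularity c.toSimpleGraph × ({v // v ∉ c.supp} → ℝ)

/-- The open cell of the arboreal space of a forest indexed by `p`: the product of the open cell
of the arboreal singularity of the tree that contains the domain of `p` with the Euclidean
factor. -/
def ArborealSpace.openCell {W : Type*} {G : SimpleGraph W} (p : TreeCorrespondence G) :
    Set (ArborealSpace G) :=
  {z | ∃ q : TreeCorrespondence z.1.toSimpleGraph,
    (fun B => Subtype.val '' B) '' q.fibers = p.fibers ∧ z.2.1 ∈ ArborealSingularity.openCell q}

namespace LeafyRootedForest

variable {V : Type*} (F : LeafyRootedForest V)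

/-- The correspondence `{pt} ↞ {a} ↪ F⁺` of a marked leaf `a`. -/
def leafCorrespondence (a : {v // v ∈ F.marked}) : TreeCorrespondence F.plus.graph :=
  TreeCorrespondence.contract {Sum.inl (a : V)} (SimpleGraph.IsTree.of_subsingleton).1

/-- The correspondence `{pt} ↞ {a⁺, a} ↪ F⁺` of a marked leaf `a`, with new vertex `a⁺`. -/
def edgeCorrespondence (a : {v // v ∈ F.marked}) : TreeCorrespondence F.plus.graph :=
  TreeCorrespondence.contract {Sum.inr a, Sum.inl (a : V)}
    (SimpleGraph.induce_pair_connected_of_adj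
      (show F.plusAdj (Sum.inr a) (Sum.inl (a : V)) from rfl))

/-- The subspace of the arboreal space of `F⁺` obtained by deleting the open cells indexed by the
two correspondences of each marked leaf. -/
def deletedArborealSpace : Set (ArborealSpace F.plus.graph) :=
  (⋃ a, (ArborealSpace.openCell (F.leafCorrespondence a) ∪
    ArborealSpace.openCell (F.edgeCorrespondence a)))ᶜ

end LeafyRootedForest

/-! ## Coray bundles of hypersurfaces -/

section Coray

variable {E : Type*} [NormedAddCommGroup E] [NormedSpace ℝ E]

/-- The cosphere bundle `S^*E = (T^*E ∖ 0) / ℝ_{>0}`, identified with the unit cosphere bundle. -/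
abbrev CosphereBundle (E : Type*) [NormedAddCommGroup E] [NormedSpace ℝ E] : Type _ :=
  E × Metric.sphere (0 : E →L[ℝ] ℝ) 1

/-- Two unit covectors at the same point that span the same line. -/
def colineSetoid (E : Type*) [NormedAddCommGroup E] [NormedSpace ℝ E] :
    Setoid (CosphereBundle E) where
  r u v := u.1 = v.1 ∧ (u.2 = v.2 ∨ u.2 = -v.2)
  iseqv :=
    { refl := fun _ => ⟨rfl, Or.inl rfl⟩
      symm := by
        rintro u v ⟨h, h' | h'⟩
        · exact ⟨h.symm, Or.inl h'.symm⟩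
        · exact ⟨h.symm, Or.inr (by rw [h', neg_neg])⟩
      trans := by
        rintro u v w ⟨h, h' | h'⟩ ⟨k, k' | k'⟩
        · exact ⟨h.trans k, Or.inl (h'.trans k')⟩
        · exact ⟨h.trans k, Or.inr (h'.trans k')⟩
        · exact ⟨h.trans k, Or.inr (by rw [h', k'])⟩
        · exact ⟨h.trans k, Or.inl (by rw [h', k', neg_neg])⟩ }

/-- The projectivized cotangent bundle `P^*E = (T^*E ∖ 0) / ℝ^×`, with the quotient topology. -/
abbrev ProjCotangentBundle (E : Type*) [NormedAddCommGroup E] [NormedSpace ℝ E] : Type _ :=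
  Quotient (colineSetoid E)

/-- The two-fold cover `S^*E → P^*E`. -/
def toColine (u : CosphereBundle E) : ProjCotangentBundle E := Quotient.mk (colineSetoid E) u

/-- The base point of a coline. -/
def colineBase : ProjCotangentBundle E → E := Quotient.lift (fun u => u.1) fun _ _ h => h.1

/-- `ξ` is a unit conormal covector to `H` at the smooth point `x` of `H`: near `x`, the set `H` is
the zero locus of a continuously differentiable submersion `g`, and `ξ` is proportional to the
differential of `g` at `x`. -/
def IsConormalAt (H : Set E) (x : E) (ξ : Metric.sphere (0 : E →L[ℝ] ℝ) 1) : Prop :=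
  x ∈ H ∧ ∃ (U : Set E) (g : E → ℝ), IsOpen U ∧ x ∈ U ∧ ContDiffOn ℝ 1 g U ∧
    (∀ y ∈ U, fderiv ℝ g y ≠ 0) ∧ (∀ y ∈ U, y ∈ H ↔ g y = 0) ∧
    ∃ c : ℝ, (ξ : E →L[ℝ] ℝ) = c • fderiv ℝ g x

/-- The smooth locus of `H`: the points near which `H` is a smooth hypersurface. -/
def smoothLocus (H : Set E) : Set E := {x | ∃ ξ, IsConormalAt H x ξ}

/-- The coray bundle: the closure in `S^*E` of the unit conormals along the smooth locus. -/
def corayBundle (H : Set E) : Set (CosphereBundle E) := closure {u | IsConormalAt H u.1 u.2}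

/-- The coline bundle: the closure in `P^*E` of the conormal lines along the smooth locus. -/
def colineBundle (H : Set E) : Set (ProjCotangentBundle E) :=
  closure (toColine '' {u | IsConormalAt H u.1 u.2})

/-- The closed set `H` has a dense smooth locus and its coline bundle is finite over `H`. (For `E`
of finite dimension the fibers of `P^*E` are compact, so the coline bundle is proper over `H`, and
being finite over `H` means that it has finite fibers.) -/
def InGoodPosition (H : Set E) : Prop :=
  IsClosed H ∧ H ⊆ closure (smoothLocus H) ∧
    ∀ x, {l | l ∈ colineBundle H ∧ colineBase l = x}.Finite

/-- A coorientation: a continuous section of the two-fold cover from the coray bundle to the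
coline bundle. -/
def IsCoorientation (H : Set E) (σ : colineBundle H → corayBundle H) : Prop :=
  Continuous σ ∧ ∀ l, toColine (σ l : CosphereBundle E) = l

/-- The positive coray bundle of a hypersurface with a coorientation: the image of the coline
bundle under the coorientation. -/
def positiveCorayBundle {H : Set E} (σ : colineBundle H → corayBundle H) :
    Set (CosphereBundle E) := Set.range fun l => (σ l : CosphereBundle E)

end Coray

/-! ## Smoothed arboreal hypersurfaces -/

/-- The functions `b` and `f` from which the smoothed arboreal hypersurfaces are built. -/
structure IsSmoothingPair (δ : ℝ) (b : ℝ → ℝ) (f : ℝ × ℝ → ℝ) : Prop where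
  b_continuous : Continuous b
  b_smooth : ContDiffOn ℝ ∞ b {0}ᶜ
  b_abs_lt : ∀ t, |b t| < δ / 4
  b_eq_zero : ∀ t, ¬ (0 < t ∧ t < δ / 4) → b t = 0
  b_deriv : Tendsto (deriv b) (𝓝[>] 0) atBot
  f_contDiff : ContDiff ℝ 1 f
  f_submersion : ∀ x, fderiv ℝ f x ≠ 0
  f_zero : ∀ x₁ x₂, f (x₁, x₂) = 0 ↔ (x₁ = 0 ∧ 0 ≤ x₂) ∨ (0 < x₁ ∧ x₂ = b x₁)
  f_eq_snd : ∀ x₁ x₂, 2 * δ < x₁ → |x₂| < δ → f (x₁, x₂) = x₂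
  f_eq_fst : ∀ x₁ x₂, |x₁| < δ → 2 * δ < x₂ → f (x₁, x₂) = x₁
  f_lt : ∀ x₁ x₂, f (x₁, x₂) < δ → x₁ < δ ∨ x₂ < δ

namespace RootedForest

variable {V : Type*} (F : RootedForest V)

open Classical in
/-- The functions `h_α`: the coordinate `x_α` if `α` is a root, and `f (h_α̂, x_α)` if `α` has
parent `α̂`. -/
def h (f : ℝ × ℝ → ℝ) (α : V) (x : EuclideanSpace ℝ V) : ℝ :=
  if hα : α ∈ F.roots then x α else f (h f (F.parent α hα) x, x α)
termination_by F.height α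
decreasing_by
  have := (F.parent_spec α hα).2
  omega

/-- The closed piece of the hypersurface `{h_α = 0}` on which `h_α̂ ≥ 0` and `x_α = b (h_α̂)`, for
`α̂` the parent of `α`; all of `{h_α = 0}` if `α` is a root. It is the closure of
`{h_α = 0, h_α̂ > 0}`, because on `h_α̂ > 0` the equation `h_α = 0` says `x_α = b (h_α̂)`. -/
def smoothedPiece (b : ℝ → ℝ) (f : ℝ × ℝ → ℝ) (α : V) : Set (EuclideanSpace ℝ V) :=
  {x | F.h f α x = 0 ∧ ∀ hα : α ∉ F.roots,
    0 ≤ F.h f (F.parent α hα) x ∧ x α = b (F.h f (F.parent α hα) x)}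

/-- A coorientation of a subset `H` of the smoothed arboreal hypersurface `⋃_α {h_α = 0}` is the
natural one if it is induced by the coorientations of the hypersurfaces `{h_α = 0}` that point
towards the halfspaces `{h_α ≥ 0}`: it sends the line of the differential of `h_α`, at a point
of `{h_α = 0}`, to the ray of that differential. -/
def IsNaturalCoorientation [Fintype V] (f : ℝ × ℝ → ℝ) (H : Set (EuclideanSpace ℝ V))
    (σ : colineBundle H → corayBundle H) : Prop :=
  IsCoorientation H σ ∧
    ∀ (α : V) (x : EuclideanSpace ℝ V) (ξ : Metric.sphere (0 : EuclideanSpace ℝ V →L[ℝ] ℝ) 1)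
      (l : colineBundle H), F.h f α x = 0 →
      (∃ c : ℝ, 0 < c ∧ (ξ : EuclideanSpace ℝ V →L[ℝ] ℝ) = c • fderiv ℝ (F.h f α) x) →
      (l : ProjCotangentBundle (EuclideanSpace ℝ V)) = toColine (x, ξ) →
      (σ l : CosphereBundle (EuclideanSpace ℝ V)) = (x, ξ)

end RootedForest

namespace LeafyRootedForest

variable {V : Type*} (F : LeafyRootedForest V)

/-- The smoothed arboreal hypersurface of a leafy rooted forest: the union of the closed pieces
of all vertices of the enlarged forest except the marked leaves. -/
def smoothedHypersurface (b : ℝ → ℝ) (f : ℝ × ℝ → ℝ) : Set (EuclideanSpace ℝ F.PlusVertex) :=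
  ⋃ α ∈ {α : F.PlusVertex | ∀ v ∈ F.marked, α ≠ Sum.inl v}, F.plus.smoothedPiece b f α

end LeafyRootedForest

end

/-! ## Parents in a rooted forest -/

namespace RootedForest

variable {V : Type*} (F : RootedForest V)

/-! The hypersurface becomes polyhedral in the sheared coordinates `u_α = x_α - b (h_α̂)` (with `u_α
= x_α` at a root). There `f (s, t + b s)` is positive exactly when `s, t > 0` and nonnegative
exactly when `s, t ≥ 0`, so the piece of `α` is `{u_α = 0, u_β ≥ 0 for β ≤ α}`
(`mem_smoothedPiece_iff`).

Call `γ` a first zero of `x` if `u_γ = 0` and `u_β > 0` for all `β < γ`. Where `h` vanishes at a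
vertex and at its parent, `f` is evaluated on the vertical part of its zero set, and the two
differentials are positively proportional. Hence, where `h_α = 0`, the ray of `dh_α` is that of the
first zero below `α` (`exists_isFirstZero`). Since `dh_α` involves only the coordinates `≤ α`,
distinct first zeros at a point span distinct lines (`IsFirstZero.eq_of_conormal`). So the rays of
the `dh_α` along the pieces form a closed set without opposite pairs, and together with their
negatives they are the coray bundle (`mem_corayBundle_iff`). Good position and the natural
coorientation follow, and `Λ` is a set of pairs `(x, γ)` with `γ` a first zero of `x`.

On the combinatorial side, a correspondence on a rooted tree gives a cone of vectors: positive at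
vertices that share a fiber with their parent and at the vertices strictly below the domain, zero at
the lowest vertex of each fiber, negative at the children of the domain outside it, free elsewhere.
The relatively open cones whose domain has lowest vertex `γ` partition the vectors with first zero
`γ` (`exists_mem_cell`, `eq_of_mem_cell`). Sending barycentric weights to the combination of the
cone centers maps each open cell of the arboreal singularity bijectively onto the corresponding
cone. So the arboreal space is also a space of pairs (vector, first zero), and `arborealEmbedding`
is the resulting closed embedding into the cosphere bundle.

Omitting the piece of a marked leaf `a` loses only pairs with `γ = a` and `u ≠ 0` at `a⁺`, because
at `u = 0` the piece of `a⁺` carries the same ray. Three correspondences have lowest vertex `a`, and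
the two deleted ones are those with `u < 0` and `u > 0` at `a⁺` (`image_deletedArborealSpace`). -/

theorem rootOf_eq_of_reachable {u v : V} (h : F.graph.Reachable u v) :
    F.rootOf u = F.rootOf v :=
  F.eq_rootOf (F.rootOf_mem u) ((F.rootOf_reachable u).trans h)

theorem isParent_or_isParent_of_adj {u v : V} (h : F.graph.Adj u v) :
    F.IsParent u v ∨ F.IsParent v u := by
  have hr := F.rootOf_eq_of_reachable h.reachable
  have hd := F.acyclic.dist_eq_dist_add_one_of_adj_of_reachable (F.rootOf u) h
    (F.rootOf_reachable u)
  unfold IsParent height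
  rw [← hr]
  rcases hd with hd | hd
  · exact Or.inr ⟨h.symm, hd⟩
  · exact Or.inl ⟨h, hd⟩

/-- A shortest path from the root to a parent of `v`, extended to `v`, is a path with that parent as
penultimate vertex; in an acyclic graph the path from the root to `v` is unique. -/
theorem isParent_unique {u u' v : V} (h : F.IsParent u v) (h' : F.IsParent u' v) : u = u' := by
  have aux : ∀ {u : V}, F.IsParent u v →
      ∃ p : F.graph.Walk (F.rootOf v) v, p.IsPath ∧ p.penultimate = u := by
    intro u h
    have hr := F.rootOf_eq_of_reachable h.1.reachable
    have hre := F.rootOf_reachable u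
    have hh := h.2
    unfold height at hh
    rw [hr] at hre hh
    obtain ⟨p, -, hp⟩ := hre.exists_path_of_dist
    refine ⟨p.concat h.1, ?_, by simp⟩
    exact SimpleGraph.Walk.isPath_of_length_eq_dist _ (by
      rw [SimpleGraph.Walk.length_concat, hp, hh])
  obtain ⟨p, hp, rfl⟩ := aux h
  obtain ⟨q, hq, rfl⟩ := aux h'
  have := (F.acyclic.subsingleton_path _ _).elim ⟨p, hp⟩ ⟨q, hq⟩
  rw [show p = q from congrArg Subtype.val this]

theorem height_eq_zero_of_mem_roots {v : V} (hv : v ∈ F.roots) : F.height v = 0 := by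
  have : v = F.rootOf v := F.eq_rootOf hv (SimpleGraph.Reachable.refl v)
  unfold height
  rw [← this, SimpleGraph.dist_self]

theorem IsParent.notMem_roots {F : RootedForest V} {u v : V} (h : F.IsParent u v) :
    v ∉ F.roots := by
  intro hv
  have := F.height_eq_zero_of_mem_roots hv
  have := h.2
  omega

theorem IsParent.eq_parent {F : RootedForest V} {u v : V} (h : F.IsParent u v) :
    F.parent v h.notMem_roots = u :=
  F.isParent_unique (F.parent_spec v _) h

end RootedForest

/-! ## Rootings of a graph -/

/-- A rooting of a graph: each edge joins a parent to a child, and parents are unique. -/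
structure Rooting {W : Type*} (G : SimpleGraph W) where
  par : W → W → Prop
  ht : W → ℕ
  ht_lt : ∀ {u v}, par u v → ht u < ht v
  par_unique : ∀ {u u' v}, par u v → par u' v → u = u'
  adj_iff : ∀ {u v}, G.Adj u v ↔ par u v ∨ par v u

/-- The rooting of the graph of a rooted forest. -/
noncomputable def RootedForest.rooting {V : Type*} (F : RootedForest V) : Rooting F.graph where
  par := F.IsParent
  ht := F.height
  ht_lt h := by have := h.2; omega
  par_unique := F.isParent_unique
  adj_iff := ⟨F.isParent_or_isParent_of_adj, fun h => h.elim (fun h => h.1) fun h => h.1.symm⟩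

namespace Rooting

variable {W : Type*} {G : SimpleGraph W} (R : Rooting G)

/-- The order in which a vertex precedes its descendants. -/
def le : W → W → Prop := Relation.ReflTransGen R.par

/-- There is at most one vertex without parent. -/
def UniqueRoot : Prop := ∀ i j, (∀ k, ¬ R.par k i) → (∀ k, ¬ R.par k j) → i = j

variable {R}

theorem le_refl (a : W) : R.le a a := Relation.ReflTransGen.refl

theorem le_trans {a b c : W} (h : R.le a b) (h' : R.le b c) : R.le a c :=
  Relation.ReflTransGen.trans h h'

theorem par_le {a b : W} (h : R.par a b) : R.le a b := Relation.ReflTransGen.single h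

theorem par_ne {a b : W} (h : R.par a b) : a ≠ b := fun e => by
  have := R.ht_lt h
  rw [e] at this
  exact lt_irrefl _ this

theorem le_ht {a b : W} (h : R.le a b) : R.ht a ≤ R.ht b := by
  induction h with
  | refl => exact _root_.le_refl _
  | tail _ h ih => exact ih.trans (R.ht_lt h).le

theorem exists_par_of_le {a b : W} (h : R.le a b) (hne : a ≠ b) :
    ∃ c, R.le a c ∧ R.par c b := by
  rcases Relation.ReflTransGen.cases_tail h with h | h
  · exact absurd h.symm hne
  · exact h

theorem le_par_of_le {a b c : W} (h : R.le a b) (hne : a ≠ b) (hc : R.par c b) : R.le a c := by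
  obtain ⟨d, hd, hdb⟩ := exists_par_of_le h hne
  rwa [R.par_unique hc hdb]

theorem ht_lt_of_le {a b : W} (h : R.le a b) (hne : a ≠ b) : R.ht a < R.ht b := by
  obtain ⟨c, hc, hcb⟩ := exists_par_of_le h hne
  exact (le_ht hc).trans_lt (R.ht_lt hcb)

theorem le_antisymm {a b : W} (h : R.le a b) (h' : R.le b a) : a = b := by
  by_contra hne
  have := ht_lt_of_le h hne
  have := le_ht h'
  omega

/-- Read backwards, a subrelation of the parent relation is a partial function, so two of its orbits
that share `c` are nested. -/
theorem chain_total {r : W → W → Prop} (hr : ∀ {a b}, r a b → R.par a b) {a b c : W}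
    (ha : Relation.ReflTransGen r a c) (hb : Relation.ReflTransGen r b c) :
    Relation.ReflTransGen r a b ∨ Relation.ReflTransGen r b a := by
  have hu : Relator.RightUnique (Function.swap r) := fun x y z h h' =>
    R.par_unique (hr h) (hr h')
  rcases Relation.ReflTransGen.total_of_right_unique hu (Relation.reflTransGen_swap.2 ha)
    (Relation.reflTransGen_swap.2 hb) with h | h
  · exact Or.inr (Relation.reflTransGen_swap.1 h)
  · exact Or.inl (Relation.reflTransGen_swap.1 h)

theorem le_total {a b c : W} (ha : R.le a c) (hb : R.le b c) : R.le a b ∨ R.le b a :=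
  chain_total (r := R.par) (fun h => h) ha hb

variable (R) in
/-- `γ` is the lowest vertex of the connected set `S`. -/
structure IsBot (S : Set W) (γ : W) : Prop where
  mem : γ ∈ S
  par_mem : ∀ δ ∈ S, δ ≠ γ → ∃ π ∈ S, R.par π δ
  par_notMem : ∀ π, R.par π γ → π ∉ S

theorem IsBot.le {S : Set W} {γ : W} (h : R.IsBot S γ) {δ : W} (hδ : δ ∈ S) : R.le γ δ := by
  induction hn : R.ht δ using Nat.strong_induction_on generalizing δ with
  | _ n ih =>
    by_cases he : δ = γ
    · exact he ▸ le_refl δ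
    · obtain ⟨π, hπ, hp⟩ := h.par_mem δ hδ he
      exact le_trans (ih _ (hn ▸ R.ht_lt hp) hπ rfl) (par_le hp)

theorem IsBot.mem_of_le_of_le {S : Set W} {γ : W} (h : R.IsBot S γ) {ε δ : W}
    (h₁ : R.le γ ε) (h₂ : R.le ε δ) (hδ : δ ∈ S) : ε ∈ S := by
  induction hn : R.ht δ using Nat.strong_induction_on generalizing δ with
  | _ n ih =>
    by_cases he : ε = δ
    · exact he ▸ hδ
    · by_cases he' : δ = γ
      · exact le_antisymm h₁ (he' ▸ h₂) ▸ h.mem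
      · obtain ⟨π, hπ, hp⟩ := h.par_mem δ hδ he'
        exact ih _ (hn ▸ R.ht_lt hp) (le_par_of_le h₂ he hp) hπ rfl

theorem connected_of_par_mem {S : Set W} {γ : W} (hγ : γ ∈ S)
    (h : ∀ δ ∈ S, δ ≠ γ → ∃ π ∈ S, R.par π δ) : (G.induce S).Connected := by
  have key : ∀ n, ∀ δ (hδ : δ ∈ S), R.ht δ = n → (G.induce S).Reachable ⟨γ, hγ⟩ ⟨δ, hδ⟩ := by
    intro n
    induction n using Nat.strong_induction_on with
    | _ n ih =>
      intro δ hδ hn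
      by_cases he : δ = γ
      · subst he
        exact SimpleGraph.Reachable.refl _
      · obtain ⟨π, hπ, hp⟩ := h δ hδ he
        refine (ih _ (hn ▸ R.ht_lt hp) π hπ rfl).trans (SimpleGraph.Adj.reachable ?_)
        exact R.adj_iff.2 (Or.inl hp)
  have : Nonempty S := ⟨⟨γ, hγ⟩⟩
  exact ⟨fun x y => (key _ x.1 x.2 rfl).symm.trans (key _ y.1 y.2 rfl)⟩

/-- A vertex `γ` of least height in `S` works. Along a walk in `S` starting at `γ`, each visited
vertex is reached from `γ` by parent steps inside `S`: a step up appends to the chain, a step down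
removes its last link, and minimality of `γ` forbids going below it. -/
theorem exists_isBot {S : Set W} (h : (G.induce S).Connected) : ∃ γ, R.IsBot S γ := by
  classical
  obtain ⟨⟨x₀, hx₀⟩⟩ := h.nonempty
  have hex : ∃ n, ∃ γ ∈ S, R.ht γ = n := ⟨_, x₀, hx₀, rfl⟩
  obtain ⟨γ, hγ, hn⟩ := Nat.find_spec hex
  have hmin : ∀ δ ∈ S, R.ht γ ≤ R.ht δ := fun δ hδ => hn ▸ Nat.find_min' hex ⟨δ, hδ, rfl⟩
  let r : W → W → Prop := fun a b => a ∈ S ∧ R.par a b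
  have key : ∀ (x y : S) (_ : (G.induce S).Walk x y),
      Relation.ReflTransGen r γ x → Relation.ReflTransGen r γ y := by
    intro x y p
    induction p with
    | nil => exact fun h => h
    | @cons a b c hadj _ ih =>
      intro ha
      refine ih ?_
      rcases R.adj_iff.1 (show G.Adj a b from hadj) with hp | hp
      · exact ha.tail ⟨a.2, hp⟩
      · rcases Relation.ReflTransGen.cases_tail ha with ha | ⟨c, hc, -, hca⟩
        · have h₁ := R.ht_lt hp
          have h₂ := hmin b b.2
          rw [ha] at h₁
          omega
        · rwa [R.par_unique hp hca]
  refine ⟨γ, hγ, fun δ hδ hne => ?_, ?_⟩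
  · obtain ⟨p⟩ := h.preconnected ⟨γ, hγ⟩ ⟨δ, hδ⟩
    rcases Relation.ReflTransGen.cases_tail (key _ _ p Relation.ReflTransGen.refl) with
      ha | ⟨c, -, hc, hca⟩
    · exact absurd ha hne
    · exact ⟨c, hc, hca⟩
  · intro π hp hπ
    have := R.ht_lt hp
    have := hmin π hπ
    omega

end Rooting

/-! ## Cells of correspondences -/

namespace TreeCorrespondence

variable {W : Type*} {G : SimpleGraph W} (R : Rooting G) (p : TreeCorrespondence G)

/-- The subtree on which a correspondence is defined. -/
def domain : Set W := ⋃₀ p.fibers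

theorem exists_isBot_domain : ∃ γ, R.IsBot p.domain γ := Rooting.exists_isBot p.subtree_connected

/-- The lowest vertex of the domain. -/
noncomputable def bot : W := (p.exists_isBot_domain R).choose

theorem isBot_bot : R.IsBot p.domain (p.bot R) := (p.exists_isBot_domain R).choose_spec

/-- The coordinates that are positive on the cell of `p`. -/
def Pos (i : W) : Prop :=
  (∃ B ∈ p.fibers, i ∈ B ∧ ∃ π ∈ B, R.par π i) ∨ (i ∉ p.domain ∧ ∃ s ∈ p.domain, R.le i s)

/-- The coordinates that are negative on the cell of `p`. -/
def Neg (i : W) : Prop := i ∉ p.domain ∧ ∃ π ∈ p.domain, R.par π i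

/-- The polyhedral cone of a correspondence. -/
def closedCell : Set (W → ℝ) :=
  {u | ∀ i, (p.Pos R i → 0 ≤ u i) ∧ (p.Neg R i → u i ≤ 0) ∧ (i ∈ p.domain → ¬ p.Pos R i → u i = 0)}

/-- The relative interior of the polyhedral cone of a correspondence. -/
def cell : Set (W → ℝ) :=
  {u | ∀ i, (p.Pos R i → 0 < u i) ∧ (p.Neg R i → u i < 0) ∧ (i ∈ p.domain → ¬ p.Pos R i → u i = 0)}

open Classical in
/-- A vector in the relative interior of the polyhedral cone of a correspondence. -/
noncomputable def cellCenter (i : W) : ℝ := if p.Pos R i then 1 else if p.Neg R i then -1 else 0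

variable {R p}

/-! ### Sign conditions and cone operations -/

theorem mem_domain {B : Set W} (hB : B ∈ p.fibers) {i : W} (hi : i ∈ B) : i ∈ p.domain :=
  ⟨B, hB, hi⟩

theorem fiber_eq {B C : Set W} (hB : B ∈ p.fibers) (hC : C ∈ p.fibers) {i : W} (hiB : i ∈ B)
    (hiC : i ∈ C) : B = C := by
  by_contra hne
  exact Set.disjoint_left.1 (p.fibers_disjoint hB hC hne) hiB hiC

theorem Pos.exists_fiber {i : W} (h : p.Pos R i) (hi : i ∈ p.domain) :
    ∃ B ∈ p.fibers, i ∈ B ∧ ∃ π ∈ B, R.par π i :=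
  h.resolve_right fun h => h.1 hi

theorem Pos.par_mem {i : W} (h : p.Pos R i) {B : Set W} (hB : B ∈ p.fibers) (hi : i ∈ B)
    {j : W} (hj : R.par j i) : j ∈ B := by
  obtain ⟨C, hC, hiC, π, hπ, hp⟩ := h.exists_fiber (mem_domain hB hi)
  obtain rfl := fiber_eq hB hC hi hiC
  rwa [R.par_unique hj hp]

/-- Domains are convex for the order: a child of the domain that lies below another vertex of the
domain is itself in the domain. -/
theorem Neg.not_pos {i : W} (h : p.Neg R i) : ¬ p.Pos R i := by
  obtain ⟨hi, π, hπ, hp⟩ := h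
  rintro (⟨B, hB, hiB, -⟩ | ⟨-, s, hs, his⟩)
  · exact hi (mem_domain hB hiB)
  · have hb := p.isBot_bot R
    exact hi (hb.mem_of_le_of_le (Rooting.le_trans (hb.le hπ) (Rooting.par_le hp)) his hs)

theorem not_pos_bot : ¬ p.Pos R (p.bot R) := by
  have hb := p.isBot_bot R
  intro h
  obtain ⟨B, hB, -, π, hπ, hp⟩ := h.exists_fiber hb.mem
  exact hb.par_notMem π hp (mem_domain hB hπ)

theorem pos_of_le_bot {i : W} (h : R.le i (p.bot R)) (hne : i ≠ p.bot R) : p.Pos R i := by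
  have hb := p.isBot_bot R
  exact Or.inr ⟨fun hi => hne (Rooting.le_antisymm h (hb.le hi)), _, hb.mem, h⟩

theorem cellCenter_mem_cell : p.cellCenter R ∈ p.cell R := by
  intro i
  unfold cellCenter
  refine ⟨fun h => ?_, fun h => ?_, fun h h' => ?_⟩
  · simp [h]
  · simp [h, h.not_pos]
  · have : ¬ p.Neg R i := fun hn => hn.1 h
    simp [h', this]

theorem cell_subset_closedCell : p.cell R ⊆ p.closedCell R := fun _ hu i =>
  ⟨fun h => ((hu i).1 h).le, fun h => ((hu i).2.1 h).le, (hu i).2.2⟩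

theorem add_mem_closedCell {u v : W → ℝ} (hu : u ∈ p.closedCell R) (hv : v ∈ p.closedCell R) :
    u + v ∈ p.closedCell R := fun i =>
  ⟨fun h => add_nonneg ((hu i).1 h) ((hv i).1 h), fun h => add_nonpos ((hu i).2.1 h) ((hv i).2.1 h),
    fun h h' => by simp [(hu i).2.2 h h', (hv i).2.2 h h']⟩

theorem add_mem_cell {u v : W → ℝ} (hu : u ∈ p.cell R) (hv : v ∈ p.closedCell R) :
    u + v ∈ p.cell R := fun i =>
  ⟨fun h => add_pos_of_pos_of_nonneg ((hu i).1 h) ((hv i).1 h),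
    fun h => add_neg_of_neg_of_nonpos ((hu i).2.1 h) ((hv i).2.1 h),
    fun h h' => by simp [(hu i).2.2 h h', (hv i).2.2 h h']⟩

theorem zero_mem_closedCell : (0 : W → ℝ) ∈ p.closedCell R := fun _ =>
  ⟨fun _ => le_rfl, fun _ => le_rfl, fun _ _ => rfl⟩

theorem smul_mem_closedCell {u : W → ℝ} (hu : u ∈ p.closedCell R) {t : ℝ} (ht : 0 ≤ t) :
    t • u ∈ p.closedCell R := fun i =>
  ⟨fun h => mul_nonneg ht ((hu i).1 h), fun h => mul_nonpos_of_nonneg_of_nonpos ht ((hu i).2.1 h),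
    fun h h' => by simp [(hu i).2.2 h h']⟩

theorem smul_mem_cell {u : W → ℝ} (hu : u ∈ p.cell R) {t : ℝ} (ht : 0 < t) :
    t • u ∈ p.cell R := fun i =>
  ⟨fun h => mul_pos ht ((hu i).1 h), fun h => mul_neg_of_pos_of_neg ht ((hu i).2.1 h),
    fun h h' => by simp [(hu i).2.2 h h']⟩

/-- No vector of the cone opposes the center in any coordinate; this is what rules out cancellation
in `exists_le_abs_realize`. -/
theorem cellCenter_mul_nonneg {u : W → ℝ} (hu : u ∈ p.closedCell R) (i : W) :
    0 ≤ p.cellCenter R i * u i := by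
  unfold cellCenter
  split_ifs with h h'
  · simpa using (hu i).1 h
  · simpa using (hu i).2.1 h'
  · simp

theorem nonneg_of_mem_domain {u : W → ℝ} (hu : u ∈ p.closedCell R) {i : W} (hi : i ∈ p.domain) :
    0 ≤ u i := by
  by_cases h : p.Pos R i
  · exact (hu i).1 h
  · exact ((hu i).2.2 hi h).ge

theorem apply_bot {u : W → ℝ} (hu : u ∈ p.closedCell R) : u (p.bot R) = 0 :=
  (hu _).2.2 (p.isBot_bot R).mem not_pos_bot

theorem nonneg_of_le_bot {u : W → ℝ} (hu : u ∈ p.closedCell R) {i : W} (h : R.le i (p.bot R)) :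
    0 ≤ u i := by
  by_cases hne : i = p.bot R
  · exact hne ▸ (apply_bot hu).ge
  · exact (hu i).1 (pos_of_le_bot h hne)

theorem pos_apply_of_le_bot {u : W → ℝ} (hu : u ∈ p.cell R) {i : W} (h : R.le i (p.bot R))
    (hne : i ≠ p.bot R) : 0 < u i := (hu i).1 (pos_of_le_bot h hne)

/-! ### Monotonicity -/

theorem domain_subset {p' : TreeCorrespondence G} (h : p' ≤ p) : p.domain ⊆ p'.domain := by
  rintro i ⟨B, hB, hi⟩
  obtain ⟨A, hA, rfl⟩ := h B hB
  obtain ⟨C, hC, hiC⟩ := hi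
  exact ⟨C, hA hC, hiC⟩

theorem fiber_subset_of_le {p' : TreeCorrespondence G} (h : p' ≤ p) {B B' : Set W}
    (hB : B ∈ p.fibers) (hB' : B' ∈ p'.fibers) {i : W} (hi : i ∈ B) (hi' : i ∈ B') : B' ⊆ B := by
  obtain ⟨A, hA, rfl⟩ := h B hB
  obtain ⟨C, hC, hiC⟩ := hi
  rw [fiber_eq hB' (hA hC) hi' hiC]
  exact Set.subset_sUnion_of_mem hC

/-- Passing to a larger correspondence shrinks the domain and merges fibers, which only relaxes sign
conditions. In particular a child cut off from the new domain either was already cut off, or was the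
lowest vertex of its old fiber and so has coordinate zero. -/
theorem closedCell_subset {p' : TreeCorrespondence G} (h : p' ≤ p) :
    p'.closedCell R ⊆ p.closedCell R := by
  intro u hu i
  refine ⟨?_, ?_, ?_⟩
  · intro hi
    by_cases hid : i ∈ p'.domain
    · exact nonneg_of_mem_domain hu hid
    · refine (hu i).1 (Or.inr ⟨hid, ?_⟩)
      rcases hi with ⟨B, hB, hiB, -⟩ | ⟨-, s, hs, his⟩
      · exact absurd (domain_subset h (mem_domain hB hiB)) hid
      · exact ⟨s, domain_subset h hs, his⟩
  · rintro ⟨hi, π, hπ, hp⟩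
    by_cases hid : i ∈ p'.domain
    · refine ((hu i).2.2 hid fun hpos => hi ?_).le
      obtain ⟨B', hB', hiB', π', hπ', hp'⟩ := hpos.exists_fiber hid
      obtain ⟨B, hB, hπB⟩ := hπ
      rw [← R.par_unique hp hp'] at hπ'
      exact mem_domain hB (fiber_subset_of_le h hB hB' hπB hπ' hiB')
    · exact (hu i).2.1 ⟨hid, π, domain_subset h hπ, hp⟩
  · intro hi hpos
    refine (hu i).2.2 (domain_subset h hi) fun hpos' => hpos ?_
    obtain ⟨B', hB', hiB', π, hπ, hp⟩ := hpos'.exists_fiber (domain_subset h hi)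
    obtain ⟨B, hB, hiB⟩ := hi
    exact Or.inl ⟨B, hB, hiB, π, fiber_subset_of_le h hB hB' hiB hiB' hπ, hp⟩

theorem bot_le_bot {p' : TreeCorrespondence G} (h : p' ≤ p) : R.le (p'.bot R) (p.bot R) :=
  (p'.isBot_bot R).le (domain_subset h (p.isBot_bot R).mem)

/-! ### Uniqueness -/

/-- Climb from the common lowest vertex: a first step out of `q.domain` would land on a negative
coordinate, whereas coordinates on `p.domain` are nonnegative. -/
theorem domain_subset_of_mem_cell {q : TreeCorrespondence G} {u : W → ℝ} (hp : u ∈ p.closedCell R)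
    (hq : u ∈ q.cell R) (hb : p.bot R = q.bot R) : p.domain ⊆ q.domain := by
  intro i hi
  induction hn : R.ht i using Nat.strong_induction_on generalizing i with
  | _ n ih =>
    by_cases he : i = p.bot R
    · rw [he, hb]
      exact (q.isBot_bot R).mem
    · obtain ⟨π, hπ, hpar⟩ := (p.isBot_bot R).par_mem i hi he
      by_contra hiq
      have := (hq i).2.1 ⟨hiq, π, ih _ (hn ▸ R.ht_lt hpar) hπ rfl, hpar⟩
      have := nonneg_of_mem_domain hp hi
      linarith

/-- Within the common domain, a positive coordinate means exactly that the vertex lies in the fiber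
of its parent, so a fiber of `p` can be climbed inside one fiber of `q`. -/
theorem exists_fiber_superset {q : TreeCorrespondence G} {u : W → ℝ} (hp : u ∈ p.cell R)
    (hq : u ∈ q.cell R) (hd : p.domain = q.domain) {B : Set W} (hB : B ∈ p.fibers) :
    ∃ C ∈ q.fibers, B ⊆ C := by
  obtain ⟨m, hm⟩ := Rooting.exists_isBot (R := R) (p.fibers_connected B hB)
  obtain ⟨C, hC, hmC⟩ : m ∈ q.domain := hd ▸ mem_domain hB hm.mem
  refine ⟨C, hC, fun i hi => ?_⟩
  induction hn : R.ht i using Nat.strong_induction_on generalizing i with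
  | _ n ih =>
    by_cases he : i = m
    · exact he ▸ hmC
    · obtain ⟨π, hπ, hpar⟩ := hm.par_mem i hi he
      have hu : 0 < u i := (hp i).1 (Or.inl ⟨B, hB, hi, π, hπ, hpar⟩)
      have hiq : i ∈ q.domain := hd ▸ mem_domain hB hi
      have hpos : q.Pos R i := by
        by_contra hpos
        rw [(hq i).2.2 hiq hpos] at hu
        exact lt_irrefl _ hu
      obtain ⟨D, hD, hiD⟩ := hiq
      rwa [← fiber_eq hD hC (hpos.par_mem hD hiD hpar) (ih _ (hn ▸ R.ht_lt hpar) π hπ rfl)]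

theorem fibers_subset_of_mem_cell {q : TreeCorrespondence G} {u : W → ℝ} (hp : u ∈ p.cell R)
    (hq : u ∈ q.cell R) (hd : p.domain = q.domain) : p.fibers ⊆ q.fibers := by
  intro B hB
  obtain ⟨C, hC, hBC⟩ := exists_fiber_superset hp hq hd hB
  obtain ⟨D, hD, hCD⟩ := exists_fiber_superset hq hp hd.symm hC
  obtain ⟨i, hi⟩ := p.fibers_nonempty hB
  obtain rfl := fiber_eq hB hD hi (hCD (hBC hi))
  rwa [Set.Subset.antisymm hBC hCD]

theorem eq_of_mem_cell {q : TreeCorrespondence G} {u : W → ℝ} (hp : u ∈ p.cell R)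
    (hq : u ∈ q.cell R) (hb : p.bot R = q.bot R) : p = q := by
  have hd := Set.Subset.antisymm (domain_subset_of_mem_cell (cell_subset_closedCell hp) hq hb)
    (domain_subset_of_mem_cell (cell_subset_closedCell hq) hp hb.symm)
  exact TreeCorrespondence.ext (Set.Subset.antisymm (fibers_subset_of_mem_cell hp hq hd)
    (fibers_subset_of_mem_cell hq hp hd.symm))

/-- Both lowest vertices lie below that of `r`, hence are comparable. If they differed, the
coordinate at the lower one would be zero for one cell and positive for the other. -/
theorem eq_of_mem_cell_of_le {q r : TreeCorrespondence G} {u : W → ℝ} (hp : u ∈ p.cell R)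
    (hq : u ∈ q.cell R) (hpr : p ≤ r) (hqr : q ≤ r) : p = q := by
  refine eq_of_mem_cell hp hq ?_
  by_contra hne
  rcases Rooting.le_total (bot_le_bot (R := R) hpr) (bot_le_bot (R := R) hqr) with h | h
  · exact (pos_apply_of_le_bot hq h hne).ne' (apply_bot (cell_subset_closedCell hp))
  · exact (pos_apply_of_le_bot hp h (Ne.symm hne)).ne' (apply_bot (cell_subset_closedCell hq))

/-! ### Existence -/

/-- The correspondence is read off from the signs: the domain is what can be reached from `γ` by
climbing through nonnegative coordinates, and it is cut into fibers just below each zero coordinate.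
-/
theorem exists_mem_cell {u : W → ℝ} {γ : W} (hγ : u γ = 0)
    (hlt : ∀ β, R.le β γ → β ≠ γ → 0 < u β) :
    ∃ q : TreeCorrespondence G, u ∈ q.cell R ∧ q.bot R = γ ∧
      (∀ i, i ∈ q.domain ↔ Relation.ReflTransGen (fun a b => R.par a b ∧ 0 ≤ u b) γ i) ∧
      ∀ B ∈ q.fibers, ∃ m, B = {i | Relation.ReflTransGen (fun a b => R.par a b ∧ 0 < u b) m i} := by
  set r : W → W → Prop := fun a b => R.par a b ∧ 0 ≤ u b with hr
  set s : W → W → Prop := fun a b => R.par a b ∧ 0 < u b with hs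
  have hsr : ∀ {a b}, Relation.ReflTransGen s a b → Relation.ReflTransGen r a b :=
    fun h => Relation.ReflTransGen.mono (fun _ _ h => ⟨h.1, h.2.le⟩) _ _ h
  have hrle : ∀ {a b}, Relation.ReflTransGen r a b → R.le a b :=
    fun h => Relation.ReflTransGen.mono (fun _ _ h => h.1) _ _ h
  have hmem : ∀ i, Relation.ReflTransGen r γ i →
      ∃ m, Relation.ReflTransGen r γ m ∧ u m = 0 ∧ Relation.ReflTransGen s m i := by
    intro i hi
    induction hi with
    | refl => exact ⟨γ, .refl, hγ, .refl⟩
    | @tail j k hj hjk ih =>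
      rcases hjk.2.eq_or_lt with h0 | h0
      · exact ⟨k, hj.tail hjk, h0.symm, .refl⟩
      · obtain ⟨m, hm, hum, hmj⟩ := ih
        exact ⟨m, hm, hum, hmj.tail ⟨hjk.1, h0⟩⟩
  -- Two zeros carrying the same vertex are comparable, and a nontrivial strictly positive chain
  -- cannot end at a zero.
  have huniq : ∀ {m m' i}, u m = 0 → u m' = 0 → Relation.ReflTransGen s m i →
      Relation.ReflTransGen s m' i → m = m' := by
    have aux : ∀ {m m'}, u m' = 0 → Relation.ReflTransGen s m m' → m = m' := by
      intro m m' h0 h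
      rcases Relation.ReflTransGen.cases_tail h with h | ⟨c, -, -, hc⟩
      · exact h.symm
      · exact absurd h0 hc.ne'
    intro m m' i h0 h0' h h'
    rcases Rooting.chain_total (R := R) (r := s) (fun h => h.1) h h' with hm | hm
    · exact aux h0' hm
    · exact (aux h0 hm).symm
  have hcon : ∀ {t : W → W → Prop} (_ : ∀ {a b}, t a b → R.par a b) (m : W),
      (G.induce {i | Relation.ReflTransGen t m i}).Connected := by
    intro t ht m
    refine Rooting.connected_of_par_mem (R := R) (γ := m) .refl fun δ hδ hne => ?_
    rcases Relation.ReflTransGen.cases_tail hδ with h | ⟨c, hc, hcδ⟩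
    · exact absurd h hne
    · exact ⟨c, hc, ht hcδ⟩
  have hU : ⋃₀ {B | ∃ m, Relation.ReflTransGen r γ m ∧ u m = 0 ∧
      B = {i | Relation.ReflTransGen s m i}} = {i | Relation.ReflTransGen r γ i} := by
    ext i
    constructor
    · rintro ⟨_, ⟨m, hm, -, rfl⟩, hi⟩
      exact hm.trans (hsr hi)
    · intro hi
      obtain ⟨m, hm, hum, hmi⟩ := hmem i hi
      exact ⟨_, ⟨m, hm, hum, rfl⟩, hmi⟩
  let q : TreeCorrespondence G :=
    { fibers := {B | ∃ m, Relation.ReflTransGen r γ m ∧ u m = 0 ∧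
        B = {i | Relation.ReflTransGen s m i}}
      fibers_connected := by
        rintro _ ⟨m, -, -, rfl⟩
        exact hcon (fun h => h.1) m
      fibers_disjoint := by
        rintro _ ⟨m, -, h0, rfl⟩ _ ⟨m', -, h0', rfl⟩ hne
        refine Set.disjoint_left.2 fun i hi hi' => hne ?_
        rw [huniq h0 h0' hi hi']
      subtree_connected := by
        rw [hU]
        exact hcon (fun h => h.1) γ }
  have hd : ∀ i, i ∈ q.domain ↔ Relation.ReflTransGen r γ i := fun i => by
    have := Set.ext_iff.1 hU i
    exact this
  have hbot : q.bot R = γ := by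
    refine Rooting.le_antisymm ((q.isBot_bot R).le ((hd γ).2 .refl)) ?_
    exact hrle ((hd _).1 (q.isBot_bot R).mem)
  refine ⟨q, fun i => ⟨?_, ?_, ?_⟩, hbot, hd, ?_⟩
  · rintro (⟨_, ⟨m, hm, h0, rfl⟩, hi, π, hπ, hp⟩ | ⟨hi, k, hk, hik⟩)
    · rcases Relation.ReflTransGen.cases_tail hi with h | ⟨c, -, -, hc⟩
      · have h₁ := R.ht_lt hp
        have h₂ := Rooting.le_ht (hrle (hsr hπ))
        rw [h] at h₁
        omega
      · exact hc
    · have hk' := hrle ((hd k).1 hk)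
      -- A vertex below the domain but outside it is comparable with `γ`, and by convexity it cannot
      -- lie above `γ`.
      refine hlt i ?_ fun h => hi ((hd i).2 (h ▸ .refl))
      refine (Rooting.le_total hik hk').resolve_right fun h => hi ?_
      exact (q.isBot_bot R).mem_of_le_of_le (hbot.symm ▸ h) hik hk
  · rintro ⟨hi, π, hπ, hp⟩
    by_contra hu
    exact hi ((hd i).2 (((hd π).1 hπ).tail ⟨hp, not_lt.1 hu⟩))
  · intro hi hpos
    rcases Relation.ReflTransGen.cases_tail ((hd i).1 hi) with h | ⟨c, hc, hci⟩
    · exact h ▸ hγ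
    · by_contra hne
      have h0 : 0 < u i := lt_of_le_of_ne hci.2 (Ne.symm hne)
      obtain ⟨m, hm, hum, hmc⟩ := hmem c hc
      exact hpos (Or.inl ⟨_, ⟨m, hm, hum, rfl⟩, hmc.tail ⟨hci.1, h0⟩, c, hmc, hci.1⟩)
  · rintro _ ⟨m, -, -, rfl⟩
    exact ⟨m, rfl⟩

theorem mem_fiber_iff_of_par {u : W → ℝ} (hu : u ∈ p.closedCell R) {B : Set W}
    (hB : B ∈ p.fibers) {j k : W} (hjk : R.par j k) (h0 : 0 < u k) : j ∈ B ↔ k ∈ B := by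
  have key : k ∈ p.domain → p.Pos R k := fun hk => by
    by_contra hpos
    exact h0.ne' ((hu k).2.2 hk hpos)
  constructor
  · intro hj
    by_cases hk : k ∈ p.domain
    · obtain ⟨C, hC, hkC⟩ := hk
      rwa [fiber_eq hB hC hj ((key ⟨C, hC, hkC⟩).par_mem hC hkC hjk)]
    · exact absurd ((hu k).2.1 ⟨hk, j, mem_domain hB hj, hjk⟩) (not_le.2 h0)
  · intro hk
    exact (key (mem_domain hB hk)).par_mem hB hk hjk

theorem exists_first_zero {u : W → ℝ} {α : W} (hα : u α = 0) (hle : ∀ β, R.le β α → 0 ≤ u β) :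
    ∃ γ, R.le γ α ∧ u γ = 0 ∧ ∀ β, R.le β γ → β ≠ γ → 0 < u β := by
  induction hn : R.ht α using Nat.strong_induction_on generalizing α with
  | _ n ih =>
    by_cases h : ∃ β, R.le β α ∧ β ≠ α ∧ u β = 0
    · obtain ⟨β, hβ, hne, h0⟩ := h
      obtain ⟨γ, hγ, h⟩ := ih _ (hn ▸ Rooting.ht_lt_of_le hβ hne) h0
        (fun δ hδ => hle δ (Rooting.le_trans hδ hβ)) rfl
      exact ⟨γ, Rooting.le_trans hγ hβ, h⟩
    · push Not at h
      exact ⟨α, Rooting.le_refl α, hα, fun β hβ hne =>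
        lt_of_le_of_ne (hle β hβ) (Ne.symm (h β hβ hne))⟩

/-- The new lowest vertex is the first zero below the old one. Coordinates on the way back up and on
`p.domain` are nonnegative, so the domain only grows; positive steps never cross the boundary of a
fiber of `p`, so each such fiber is a union of new ones. -/
theorem exists_le_mem_cell {u : W → ℝ} (hu : u ∈ p.closedCell R) : ∃ q ≤ p, u ∈ q.cell R := by
  obtain ⟨γ, hγ, h0, hlt⟩ := exists_first_zero (apply_bot hu) fun β => nonneg_of_le_bot hu
  obtain ⟨q, hq, -, hd, hf⟩ := exists_mem_cell h0 hlt
  refine ⟨q, fun B hB => ?_, hq⟩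
  have hγp : Relation.ReflTransGen (fun a b => R.par a b ∧ 0 ≤ u b) γ (p.bot R) := by
    have : ∀ i, R.le γ i → R.le i (p.bot R) →
        Relation.ReflTransGen (fun a b => R.par a b ∧ 0 ≤ u b) γ i := by
      intro i hi
      induction hi with
      | refl => exact fun _ => .refl
      | tail _ hjk ih =>
        exact fun hk => (ih (Rooting.le_trans (Rooting.par_le hjk) hk)).tail
          ⟨hjk, nonneg_of_le_bot hu hk⟩
    exact this _ hγ (Rooting.le_refl _)
  have hsub : p.domain ⊆ q.domain := by
    intro i hi
    induction hn : R.ht i using Nat.strong_induction_on generalizing i with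
    | _ n ih =>
      by_cases he : i = p.bot R
      · exact (hd i).2 (he ▸ hγp)
      · obtain ⟨π, hπ, hp⟩ := (p.isBot_bot R).par_mem i hi he
        exact (hd i).2 (((hd π).1 (ih _ (hn ▸ R.ht_lt hp) hπ rfl)).tail
          ⟨hp, nonneg_of_mem_domain hu hi⟩)
  refine ⟨{C | C ∈ q.fibers ∧ C ⊆ B}, fun C hC => hC.1, ?_⟩
  apply Set.Subset.antisymm
  · rintro i ⟨C, hC, hi⟩
    exact hC.2 hi
  · intro i hi
    obtain ⟨C, hC, hiC⟩ := hsub (mem_domain hB hi)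
    refine ⟨C, ⟨hC, ?_⟩, hiC⟩
    obtain ⟨m, rfl⟩ := hf C hC
    have key : ∀ {j}, Relation.ReflTransGen (fun a b => R.par a b ∧ 0 < u b) m j →
        (m ∈ B ↔ j ∈ B) := by
      intro j hj
      induction hj with
      | refl => exact Iff.rfl
      | tail _ hjk ih => exact ih.trans (mem_fiber_iff_of_par hu hB hjk.1 hjk.2)
    exact fun j hj => (key hj).1 ((key hiC).2 hi)

/-! ### The identity correspondence -/

theorem IsIdentity.eq {q : TreeCorrespondence G} (hp : p.IsIdentity) (hq : q.IsIdentity) : p = q :=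
  TreeCorrespondence.ext (Eq.trans hp (Eq.symm hq))

theorem IsIdentity.le {q : TreeCorrespondence G} (hp : p.IsIdentity) : p ≤ q := fun B _ =>
  ⟨(fun i => {i}) '' B, by
    rw [show p.fibers = _ from hp]
    exact Set.image_subset_range _ _, by simp⟩

theorem IsIdentity.not_pos (hp : p.IsIdentity) (i : W) : ¬ p.Pos R i := by
  have hi : ∀ j, {j} ∈ p.fibers := fun j => by
    rw [show p.fibers = _ from hp]
    exact ⟨j, rfl⟩
  intro h
  obtain ⟨B, hB, hiB, π, hπ, hpar⟩ := h.exists_fiber (mem_domain (hi i) rfl)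
  rw [fiber_eq hB (hi i) hiB rfl] at hπ
  exact Rooting.par_ne hpar hπ

theorem IsIdentity.mem_domain (hp : p.IsIdentity) (i : W) : i ∈ p.domain := by
  refine ⟨{i}, ?_, rfl⟩
  rw [show p.fibers = _ from hp]
  exact ⟨i, rfl⟩

theorem IsIdentity.eq_zero {u : W → ℝ} (hp : p.IsIdentity) (hu : u ∈ p.closedCell R) : u = 0 :=
  funext fun i => (hu i).2.2 (hp.mem_domain i) (hp.not_pos i)

theorem IsIdentity.zero_mem_cell (hp : p.IsIdentity) : (0 : W → ℝ) ∈ p.cell R := fun i =>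
  ⟨fun h => absurd h (hp.not_pos i), fun h => absurd (hp.mem_domain i) h.1, fun _ _ => rfl⟩

/-- With no positive coordinate the lowest vertex is the root and all fibers are singletons; with no
negative one the domain is closed under children. Uniqueness of the root then makes the domain
everything. -/
theorem isIdentity_of_cellCenter_eq_zero (hroot : R.UniqueRoot) (hp : p.cellCenter R = 0) : p.IsIdentity := by
  have hpos : ∀ i, ¬ p.Pos R i := fun i h => by
    have := congrFun hp i
    simp [cellCenter, h] at this
  have hneg : ∀ i, ¬ p.Neg R i := fun i h => by
    have := congrFun hp i
    simp [cellCenter, h, hpos] at this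
  have hbot : ∀ k, ¬ R.par k (p.bot R) := fun k hk =>
    hpos k (pos_of_le_bot (Rooting.par_le hk) (Rooting.par_ne hk))
  have hd : ∀ i, i ∈ p.domain := by
    intro i
    induction hn : R.ht i using Nat.strong_induction_on generalizing i with
    | _ n ih =>
      by_cases h : ∃ k, R.par k i
      · obtain ⟨k, hk⟩ := h
        by_contra hi
        exact hneg i ⟨hi, k, ih _ (hn ▸ R.ht_lt hk) k rfl, hk⟩
      · push Not at h
        rw [hroot i _ h hbot]
        exact (p.isBot_bot R).mem
  have hB : ∀ B ∈ p.fibers, ∀ i ∈ B, B = {i} := by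
    intro B hB
    obtain ⟨m, hm⟩ := Rooting.exists_isBot (R := R) (p.fibers_connected B hB)
    have : ∀ i ∈ B, i = m := fun i hi => by
      by_contra hne
      obtain ⟨π, hπ, hpar⟩ := hm.par_mem i hi hne
      exact hpos i (Or.inl ⟨B, hB, hi, π, hπ, hpar⟩)
    intro i hi
    ext j
    exact ⟨fun hj => (this j hj).trans (this i hi).symm, fun hj => (show j = i from hj) ▸ hi⟩
  ext B
  constructor
  · intro h
    obtain ⟨i, hi⟩ := p.fibers_nonempty h
    exact ⟨i, (hB B h i hi).symm⟩
  · rintro ⟨i, rfl⟩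
    obtain ⟨B, h, hi⟩ := hd i
    change {i} ∈ _
    rwa [← hB B h i hi]

end TreeCorrespondence

/-! ## The polyhedral realization of an arboreal singularity -/

instance {W : Type*} [Finite W] (G : SimpleGraph W) : Finite (TreeCorrespondence G) :=
  Finite.of_injective TreeCorrespondence.fibers fun _ _ h => TreeCorrespondence.ext h

noncomputable instance {W : Type*} [Finite W] (G : SimpleGraph W) :
    Fintype (TreeCorrespondence G) := Fintype.ofFinite _

namespace ArborealSingularity

set_option linter.unusedSectionVars false

variable {W : Type*} [Finite W] {G : SimpleGraph W} (R : Rooting G)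

open TreeCorrespondence

/-- The combination of the centers of the cells with given weights. -/
noncomputable def combination (w : TreeCorrespondence G → ℝ) : W → ℝ := ∑ p, w p • p.cellCenter R

/-- The piecewise linear realization of an arboreal singularity. -/
noncomputable def realize (w : ArborealSingularity G) : W → ℝ := combination R w.1

theorem continuous_realize : Continuous (realize R) := by
  unfold realize combination
  refine continuous_finsetSum _ fun p _ => Continuous.fun_smul ?_ continuous_const
  exact (continuous_apply p).comp continuous_subtype_val

theorem isClosedEmbedding_val :
    Topology.IsClosedEmbedding (fun w : ArborealSingularity G => w.1) := by
  refine Topology.IsClosedEmbedding.subtypeVal ?_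
  refine IsClosed.inter ?_ (IsClosed.inter ?_ ?_)
  · change IsClosed {w : TreeCorrespondence G → ℝ | ∀ p, 0 ≤ w p}
    simp only [Set.ofPred_forall]
    exact isClosed_iInter fun p => isClosed_le continuous_const (continuous_apply p)
  · change IsClosed {w : TreeCorrespondence G → ℝ | ∀ p, p.IsIdentity → w p = 0}
    simp only [Set.ofPred_forall]
    exact isClosed_iInter fun p => isClosed_iInter fun _ =>
      isClosed_eq (continuous_apply p) continuous_const
  -- Having a chain as support is a closed condition: of any two incomparable correspondences, at
  -- least one has weight zero.
  · have : {w : TreeCorrespondence G → ℝ | IsChain (· ≤ ·) {p | w p ≠ 0}} =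
        ⋂ (p : TreeCorrespondence G) (q : TreeCorrespondence G) (_ : ¬ (p ≤ q ∨ q ≤ p)),
          {w | w p = 0} ∪ {w | w q = 0} := by
      ext w
      simp only [Set.mem_iInter, Set.mem_union, Set.mem_ofPred_eq]
      constructor
      · intro h p q hpq
        by_contra hne
        push Not at hne
        exact hpq (h.total hne.1 hne.2)
      · intro h p hp q hq _
        by_contra hpq
        exact (h p q hpq).elim hp hq
    change IsClosed {w : TreeCorrespondence G → ℝ | IsChain (· ≤ ·) {p | w p ≠ 0}}
    rw [this]
    exact isClosed_iInter fun p => isClosed_iInter fun q => isClosed_iInter fun _ =>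
      (isClosed_eq (continuous_apply p) continuous_const).union
        (isClosed_eq (continuous_apply q) continuous_const)

variable {R}

/-! ### Images of the open cells -/

theorem combination_mem_closedCell {w : TreeCorrespondence G → ℝ} (h0 : ∀ q, 0 ≤ w q)
    {p : TreeCorrespondence G} (hp : ∀ q, w q ≠ 0 → q ≤ p) : combination R w ∈ p.closedCell R := by
  unfold combination
  refine Finset.sum_induction _ (· ∈ p.closedCell R) (fun _ _ => add_mem_closedCell)
    zero_mem_closedCell fun q _ => ?_
  by_cases hq : w q = 0
  · rw [hq, zero_smul]
    exact zero_mem_closedCell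
  · exact smul_mem_closedCell
      (closedCell_subset (hp q hq) (cell_subset_closedCell cellCenter_mem_cell)) (h0 q)

open Classical in
theorem combination_update (w : TreeCorrespondence G → ℝ) (p : TreeCorrespondence G) (t : ℝ) :
    combination R (Function.update w p t) = combination R w + (t - w p) • p.cellCenter R := by
  unfold combination
  rw [← Finset.add_sum_erase _ _ (Finset.mem_univ p),
    ← Finset.add_sum_erase _ (fun q => w q • q.cellCenter R) (Finset.mem_univ p),
    Finset.sum_congr rfl fun q hq => by
      rw [Function.update_of_ne (Finset.ne_of_mem_erase hq)]]
  simp only [Function.update_self, sub_smul]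
  abel

open Classical in
/-- Changing the weight of a correspondence that dominates the support. -/
noncomputable def changeTop (w : ArborealSingularity G) (p : TreeCorrespondence G)
    (hp : ∀ q, w.1 q ≠ 0 → q ≤ p) (t : ℝ) (ht : 0 ≤ t) (hid : ¬ p.IsIdentity) :
    ArborealSingularity G :=
  ⟨Function.update w.1 p t, by
    refine ⟨fun q => ?_, fun q hq => ?_, ?_⟩
    · by_cases h : q = p
      · subst h
        simpa using ht
      · rw [Function.update_of_ne h]
        exact w.2.1 q
    · have : q ≠ p := fun h => hid (h ▸ hq)
      rw [Function.update_of_ne this]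
      exact w.2.2.1 q hq
    · have hsub : {q | Function.update w.1 p t q ≠ 0} ⊆ insert p {q | w.1 q ≠ 0} := by
        intro q hq
        by_cases h : q = p
        · exact Or.inl h
        · refine Or.inr ?_
          rw [Set.mem_ofPred_eq, Function.update_of_ne h] at hq
          exact hq
      exact (w.2.2.2.insert fun q hq _ => Or.inr (hp q hq)).mono hsub⟩

theorem realize_changeTop (w : ArborealSingularity G) (p : TreeCorrespondence G)
    (hp : ∀ q, w.1 q ≠ 0 → q ≤ p) (t : ℝ) (ht : 0 ≤ t) (hid : ¬ p.IsIdentity) :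
    realize R (changeTop w p hp t ht hid) = realize R w + (t - w.1 p) • p.cellCenter R :=
  combination_update _ _ _

theorem changeTop_self (w : ArborealSingularity G) (p : TreeCorrespondence G)
    (hp : ∀ q, w.1 q ≠ 0 → q ≤ p) (t : ℝ) (ht : 0 ≤ t) (hid : ¬ p.IsIdentity) :
    (changeTop w p hp t ht hid).1 p = t := by
  simp [changeTop]

theorem changeTop_of_ne (w : ArborealSingularity G) (p : TreeCorrespondence G)
    (hp : ∀ q, w.1 q ≠ 0 → q ≤ p) (t : ℝ) (ht : 0 ≤ t) (hid : ¬ p.IsIdentity)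
    {q : TreeCorrespondence G} (hq : q ≠ p) : (changeTop w p hp t ht hid).1 q = w.1 q := by
  simp [changeTop, hq]

theorem changeTop_le (w : ArborealSingularity G) (p : TreeCorrespondence G)
    (hp : ∀ q, w.1 q ≠ 0 → q ≤ p) (t : ℝ) (ht : 0 ≤ t) (hid : ¬ p.IsIdentity)
    (q : TreeCorrespondence G) (hq : (changeTop w p hp t ht hid).1 q ≠ 0) : q ≤ p := by
  by_cases h : q = p
  · exact h.le
  · rw [changeTop_of_ne _ _ _ _ _ _ h] at hq
    exact hp q hq

theorem le_of_mem_openCell {w : ArborealSingularity G} {p : TreeCorrespondence G}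
    (h : w ∈ openCell p) (q : TreeCorrespondence G) (hq : w.1 q ≠ 0) : q ≤ p :=
  h.elim (fun h => absurd (h.2 q) hq) fun h => h.2 q hq

/-- Split off the term of `p`: a positive multiple of its center is in the open cone, and the
remaining terms lie in the closed one by monotonicity. -/
theorem realize_mem_cell {w : ArborealSingularity G} {p : TreeCorrespondence G}
    (h : w ∈ openCell p) : realize R w ∈ p.cell R := by
  have hle := le_of_mem_openCell h
  rcases h with ⟨hid, h⟩ | ⟨hp, -⟩
  · have : realize R w = 0 := by
      unfold realize combination
      exact Finset.sum_eq_zero fun q _ => by rw [h q, zero_smul]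
    rw [this]
    exact hid.zero_mem_cell
  · have hid : ¬ p.IsIdentity := fun hid => hp.ne' (w.2.2.1 p hid)
    have := realize_changeTop (R := R) w p hle 0 le_rfl hid
    have hw : realize R w = w.1 p • p.cellCenter R + realize R (changeTop w p hle 0 le_rfl hid) := by
      rw [this, zero_sub, neg_smul]
      abel
    rw [hw]
    refine add_mem_cell (smul_mem_cell cellCenter_mem_cell hp)
      (combination_mem_closedCell (changeTop w p hle 0 le_rfl hid).2.1 ?_)
    exact changeTop_le w p hle 0 le_rfl hid

/-- The zero vector lies in some cell, and such a cell has no positive or negative coordinate. -/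
theorem exists_isIdentity [Nonempty W]
    (hroot : R.UniqueRoot) :
    ∃ p : TreeCorrespondence G, p.IsIdentity := by
  obtain ⟨α⟩ := ‹Nonempty W›
  obtain ⟨γ, -, h0, hlt⟩ := exists_first_zero (R := R) (u := 0) (α := α) rfl fun _ _ => le_rfl
  obtain ⟨q, hq, -⟩ := exists_mem_cell h0 hlt
  refine ⟨q, isIdentity_of_cellCenter_eq_zero hroot (funext fun i => ?_)⟩
  have h₁ : ¬ q.Pos R i := fun h => lt_irrefl _ ((hq i).1 h)
  have h₂ : ¬ q.Neg R i := fun h => lt_irrefl _ ((hq i).2.1 h)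
  simp [cellCenter, h₁, h₂]

theorem exists_mem_openCell [Nonempty W]
    (hroot : R.UniqueRoot)
    (w : ArborealSingularity G) : ∃ p, w ∈ openCell p := by
  by_cases h : ∀ q, w.1 q = 0
  · obtain ⟨p, hp⟩ := exists_isIdentity hroot
    exact ⟨p, Or.inl ⟨hp, h⟩⟩
  · push Not at h
    obtain ⟨p, hp⟩ := (Set.toFinite {q | w.1 q ≠ 0}).exists_maximal h
    refine ⟨p, Or.inr ⟨lt_of_le_of_ne (w.2.1 p) (Ne.symm hp.1), fun q hq => ?_⟩⟩
    rcases w.2.2.2.total hq hp.1 with h | h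
    · exact h
    · exact hp.2 hq h

/-- The cone point. -/
def zero : ArborealSingularity G :=
  ⟨0, fun _ => le_rfl, fun _ _ => rfl, by
    have : {p : TreeCorrespondence G | (0 : TreeCorrespondence G → ℝ) p ≠ 0} = ∅ := by simp
    rw [this]
    exact Set.subsingleton_empty.isChain⟩

/-! ### Bijectivity onto the cones -/

theorem exists_exit {p : TreeCorrespondence G} (hp : p.cellCenter R ≠ 0) {u : W → ℝ}
    (hu : u ∈ p.cell R) :
    ∃ t : ℝ, 0 < t ∧ u - t • p.cellCenter R ∈ p.closedCell R ∧ u - t • p.cellCenter R ∉ p.cell R := by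
  have hne : ∃ i, p.cellCenter R i ≠ 0 := by
    by_contra h
    push Not at h
    exact hp (funext h)
  -- Moving against the center shrinks all constrained nonzero coordinates at unit speed, so the
  -- exit time is the smallest of their absolute values.
  obtain ⟨i₀, hi₀, hmin⟩ := (Set.toFinite {i | p.cellCenter R i ≠ 0}).exists_minimalFor
    (fun i => |u i|) _ hne
  have hpos : ∀ i, p.Pos R i → p.cellCenter R i = 1 := fun i h => by simp [cellCenter, h]
  have hneg : ∀ i, p.Neg R i → p.cellCenter R i = -1 := fun i h => by simp [cellCenter, h, h.not_pos]
  have hcases : ∀ i, p.cellCenter R i ≠ 0 → p.Pos R i ∨ p.Neg R i := fun i hi => by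
    unfold cellCenter at hi
    split_ifs at hi with h h'
    · exact Or.inl h
    · exact Or.inr h'
    · exact absurd rfl hi
  have hle : ∀ i, p.cellCenter R i ≠ 0 → |u i₀| ≤ |u i| := fun i hi => by
    rcases le_total |u i₀| |u i| with h | h
    · exact h
    · exact hmin hi h
  refine ⟨|u i₀|, ?_, fun i => ⟨fun h => ?_, fun h => ?_, fun h h' => ?_⟩, fun h => ?_⟩
  · rcases hcases i₀ hi₀ with h | h
    · exact abs_pos.2 ((hu _).1 h).ne'
    · exact abs_pos.2 ((hu _).2.1 h).ne
  · have := hle i (by rw [hpos i h]; norm_num)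
    rw [abs_of_pos ((hu i).1 h)] at this
    simpa [hpos i h] using this
  · have := hle i (by rw [hneg i h]; norm_num)
    rw [abs_of_neg ((hu i).2.1 h)] at this
    simp only [Pi.sub_apply, Pi.smul_apply, hneg i h, smul_eq_mul]
    linarith
  · have h'' : ¬ p.Neg R i := fun hn => hn.1 h
    simp [cellCenter, h', h'', (hu i).2.2 h h']
  · rcases hcases i₀ hi₀ with h' | h'
    · have := (h i₀).1 h'
      simp [hpos i₀ h', abs_of_pos ((hu i₀).1 h')] at this
    · have := (h i₀).2.1 h'
      simp [hneg i₀ h', abs_of_neg ((hu i₀).2.1 h')] at this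

/-- Follow the line through `u` against the center of the cone until it leaves the open cone. The
exit point lies in the cell of a smaller correspondence; realize it by induction and give `p` the
exit time as weight. -/
theorem exists_realize_eq_of_mem_cell
    (hroot : R.UniqueRoot)
    (p : TreeCorrespondence G) {u : W → ℝ} (hu : u ∈ p.cell R) :
    ∃ w ∈ openCell p, realize R w = u := by
  induction p using (wellFounded_lt (α := TreeCorrespondence G)).induction generalizing u with
  | _ p ih =>
    by_cases hid : p.IsIdentity
    · refine ⟨zero, Or.inl ⟨hid, fun _ => rfl⟩, ?_⟩
      rw [hid.eq_zero (cell_subset_closedCell hu)]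
      unfold realize combination
      exact Finset.sum_eq_zero fun q _ => by simp [zero]
    · obtain ⟨t, ht, hc, hn⟩ :=
        exists_exit (fun h => hid (isIdentity_of_cellCenter_eq_zero hroot h)) hu
      obtain ⟨q, hqp, hq⟩ := exists_le_mem_cell hc
      have hlt : q < p := lt_of_le_of_ne hqp fun h => hn (h ▸ hq)
      obtain ⟨w, hw, hwu⟩ := ih q hlt hq
      have hle : ∀ r, w.1 r ≠ 0 → r ≤ p := fun r hr => (le_of_mem_openCell hw r hr).trans hqp
      have h0 : w.1 p = 0 := by
        by_contra h
        exact not_le_of_gt hlt (le_of_mem_openCell hw p h)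
      refine ⟨changeTop w p hle t ht.le hid, Or.inr ⟨?_, changeTop_le w p hle t ht.le hid⟩, ?_⟩
      · rwa [changeTop_self]
      · rw [realize_changeTop, hwu, h0, sub_zero]
        abel

theorem eq_of_realize_eq [Nonempty W]
    (hroot : R.UniqueRoot)
    (p : TreeCorrespondence G) {w w' : ArborealSingularity G} (h : ∀ q, w.1 q ≠ 0 → q ≤ p)
    (h' : ∀ q, w'.1 q ≠ 0 → q ≤ p) (he : realize R w = realize R w') : w = w' := by
  induction p using (wellFounded_lt (α := TreeCorrespondence G)).induction
    generalizing w w' with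
  | _ p ih =>
    by_cases hid : p.IsIdentity
    · have key : ∀ {w : ArborealSingularity G}, (∀ q, w.1 q ≠ 0 → q ≤ p) → ∀ q, w.1 q = 0 := by
        intro w h q
        by_contra hq
        exact hq (w.2.2.1 q (le_antisymm (h q hq) hid.le ▸ hid))
      exact Subtype.ext (funext fun q => (key h q).trans (key h' q).symm)
    have top_le : ∀ {w : ArborealSingularity G} {q}, (∀ q, w.1 q ≠ 0 → q ≤ p) → w ∈ openCell q →
        q ≤ p := by
      rintro w q hw (⟨hq, -⟩ | ⟨hq, -⟩)
      · exact hq.le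
      · exact hw q hq.ne'
    -- If `p` has weight zero in `w`, the top cells of both points contain the common image, hence
    -- coincide, and lie strictly below `p`.
    have lower : ∀ {w w' : ArborealSingularity G}, (∀ q, w.1 q ≠ 0 → q ≤ p) →
        (∀ q, w'.1 q ≠ 0 → q ≤ p) → realize R w = realize R w' → w.1 p = 0 → w = w' := by
      intro w w' h h' he h0
      obtain ⟨q, hq⟩ := exists_mem_openCell hroot w
      obtain ⟨q', hq'⟩ := exists_mem_openCell hroot w'
      have hqq : q = q' := eq_of_mem_cell_of_le (realize_mem_cell hq)
        (he ▸ realize_mem_cell hq') (top_le h hq) (top_le h' hq')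
      subst hqq
      refine ih q (lt_of_le_of_ne (top_le h hq) ?_) (le_of_mem_openCell hq)
        (le_of_mem_openCell hq') he
      rintro rfl
      rcases hq with hq | hq
      · exact hid hq.1
      · exact hq.1.ne' h0
    -- Subtracting the smaller of the two weights of `p` from both points reduces to the previous
    -- case.
    have main : ∀ {w w' : ArborealSingularity G}, (∀ q, w.1 q ≠ 0 → q ≤ p) →
        (∀ q, w'.1 q ≠ 0 → q ≤ p) → realize R w = realize R w' → w.1 p ≤ w'.1 p → w = w' := by
      intro w w' h h' he hle
      have := lower (changeTop_le w p h 0 le_rfl hid)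
        (changeTop_le w' p h' (w'.1 p - w.1 p) (sub_nonneg.2 hle) hid)
        (by
          rw [realize_changeTop, realize_changeTop, he]
          congr 2
          ring) (changeTop_self _ _ _ _ _ _)
      refine Subtype.ext (funext fun q => ?_)
      have hq := congrFun (congrArg Subtype.val this) q
      by_cases hqp : q = p
      · subst hqp
        rw [changeTop_self, changeTop_self] at hq
        linarith
      · rwa [changeTop_of_ne _ _ _ _ _ _ hqp, changeTop_of_ne _ _ _ _ _ _ hqp] at hq
    rcases le_total (w.1 p) (w'.1 p) with hle | hle
    · exact main h h' he hle
    · exact (main h' h he.symm hle).symm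

theorem eq_of_realize_eq_of_bot_eq [Nonempty W]
    (hroot : R.UniqueRoot)
    {p p' : TreeCorrespondence G} {w w' : ArborealSingularity G} (h : w ∈ openCell p)
    (h' : w' ∈ openCell p') (he : realize R w = realize R w') (hb : p.bot R = p'.bot R) :
    w = w' := by
  obtain rfl := eq_of_mem_cell (realize_mem_cell h) (he ▸ realize_mem_cell h') hb
  exact eq_of_realize_eq hroot p (le_of_mem_openCell h) (le_of_mem_openCell h') he

theorem exists_realize_eq
    (hroot : R.UniqueRoot) {u : W → ℝ} {γ : W}
    (h0 : u γ = 0) (hlt : ∀ β, R.le β γ → β ≠ γ → 0 < u β) :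
    ∃ (p : TreeCorrespondence G) (w : ArborealSingularity G),
      w ∈ openCell p ∧ realize R w = u ∧ p.bot R = γ := by
  obtain ⟨p, hp, hb, -⟩ := exists_mem_cell h0 hlt
  obtain ⟨w, hw, hwu⟩ := exists_realize_eq_of_mem_cell hroot p hp
  exact ⟨p, w, hw, hwu, hb⟩

/-- The support is a chain, so at a coordinate where the center of `q` is `±1` every term of the sum
has the same weak sign. Each weight is thus bounded by the image, which gives properness of the
embedding. -/
theorem exists_le_abs_realize
    (hroot : R.UniqueRoot)
    (w : ArborealSingularity G) {q : TreeCorrespondence G} (hq : w.1 q ≠ 0) :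
    ∃ i, |w.1 q| ≤ |realize R w i| := by
  have hid : ¬ q.IsIdentity := fun h => hq (w.2.2.1 q h)
  have hne : ∃ i, q.cellCenter R i ≠ 0 := by
    by_contra h
    push Not at h
    exact hid (isIdentity_of_cellCenter_eq_zero hroot (funext h))
  obtain ⟨i, hi⟩ := hne
  have hsq : q.cellCenter R i * q.cellCenter R i = 1 ∧ |q.cellCenter R i| = 1 := by
    unfold cellCenter at hi ⊢
    split_ifs at hi ⊢ <;> simp_all
  refine ⟨i, ?_⟩
  have hsum : realize R w i * q.cellCenter R i =
      ∑ p, w.1 p * (p.cellCenter R i * q.cellCenter R i) := by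
    unfold realize combination
    rw [Finset.sum_apply, Finset.sum_mul]
    exact Finset.sum_congr rfl fun p _ => by simp [mul_assoc]
  have hterm : ∀ p, 0 ≤ w.1 p * (p.cellCenter R i * q.cellCenter R i) := by
    intro p
    by_cases hp : w.1 p = 0
    · simp [hp]
    · refine mul_nonneg (w.2.1 p) ?_
      rcases w.2.2.2.total hp hq with h | h
      · rw [mul_comm]
        exact cellCenter_mul_nonneg (closedCell_subset h (cell_subset_closedCell cellCenter_mem_cell)) i
      · exact cellCenter_mul_nonneg (closedCell_subset h (cell_subset_closedCell cellCenter_mem_cell)) i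
  have hle : w.1 q ≤ realize R w i * q.cellCenter R i := by
    rw [hsum]
    have := Finset.single_le_sum (fun p _ => hterm p) (Finset.mem_univ q)
    rwa [hsq.1, mul_one] at this
  rw [abs_of_nonneg (w.2.1 q)]
  calc w.1 q ≤ realize R w i * q.cellCenter R i := hle
    _ ≤ |realize R w i * q.cellCenter R i| := le_abs_self _
    _ = |realize R w i| := by rw [abs_mul, hsq.2, mul_one]

end ArborealSingularity

/-! ## Signs and derivatives of a smoothing pair -/

theorem pos_of_isPreconnected {X : Type*} [TopologicalSpace X] {s : Set X} (hs : IsPreconnected s)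
    {g : X → ℝ} (hg : Continuous g) (hne : ∀ x ∈ s, g x ≠ 0) {a : X} (ha : a ∈ s) (h0 : 0 < g a)
    {x : X} (hx : x ∈ s) : 0 < g x := by
  by_contra h
  obtain ⟨y, hy, hy0⟩ := hs.intermediate_value hx ha hg.continuousOn ⟨not_lt.1 h, h0.le⟩
  exact hne y hy hy0

theorem nonneg_of_hasDerivAt_of_nonpos_left {k : ℝ → ℝ} {c a : ℝ} (h : HasDerivAt k c a)
    (h0 : k a = 0) (hk : ∀ s < a, k s ≤ 0) : 0 ≤ c := by
  have ht := (hasDerivAt_iff_tendsto_slope_left_right.1 h).1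
  refine ge_of_tendsto ht ?_
  filter_upwards [self_mem_nhdsWithin] with s hs
  rw [slope_def_field, h0, sub_zero]
  exact div_nonneg_of_nonpos (hk s hs) (sub_nonpos.2 (le_of_lt hs))

theorem clm_prod_apply (L : ℝ × ℝ →L[ℝ] ℝ) (s t : ℝ) :
    L (s, t) = s * L (1, 0) + t * L (0, 1) := by
  have : ((s, t) : ℝ × ℝ) = s • ((1, 0) : ℝ × ℝ) + t • ((0, 1) : ℝ × ℝ) := by simp
  rw [this, map_add, map_smul, map_smul, smul_eq_mul, smul_eq_mul]

namespace IsSmoothingPair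

variable {δ : ℝ} {b : ℝ → ℝ} {f : ℝ × ℝ → ℝ} (hbf : IsSmoothingPair δ b f)

include hbf

theorem b_of_nonpos {t : ℝ} (ht : t ≤ 0) : b t = 0 :=
  hbf.b_eq_zero t fun h => not_lt.2 ht h.1

theorem delta_pos : 0 < δ := by
  have := hbf.b_abs_lt 0
  have := abs_nonneg (b 0)
  linarith

/-- The shear straightens the zero set of `f` to the boundary of the closed quadrant. -/
theorem f_eq_zero_iff (s t : ℝ) :
    f (s, t + b s) = 0 ↔ (s = 0 ∧ 0 ≤ t) ∨ (0 < s ∧ t = 0) := by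
  rw [hbf.f_zero]
  refine or_congr (and_congr_right ?_) (and_congr_right fun _ => by simp)
  rintro rfl
  rw [hbf.b_of_nonpos le_rfl, add_zero]

theorem f_graph {t : ℝ} (ht : 0 ≤ t) : f (t, b t) = 0 := by
  have := (hbf.f_eq_zero_iff t 0).2
  rw [zero_add] at this
  exact this (ht.eq_or_lt.imp (fun h => ⟨h.symm, le_rfl⟩) fun h => ⟨h, rfl⟩)

theorem continuous_shear : Continuous fun x : ℝ × ℝ => f (x.1, x.2 + b x.1) :=
  hbf.f_contDiff.continuous.comp (continuous_fst.prodMk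
    (continuous_snd.add (hbf.b_continuous.comp continuous_fst)))

/-- At `3 * δ` the function `b` vanishes and `f` is the second coordinate; this supplies sample
points for the sign of `f` on each side. -/
theorem f_far {t : ℝ} (ht : |t| < δ) : f (3 * δ, t + b (3 * δ)) = t := by
  have hδ := hbf.delta_pos
  rw [hbf.b_eq_zero (3 * δ) fun h => by linarith [h.2], add_zero]
  exact hbf.f_eq_snd _ _ (by linarith) ht

theorem f_pos {s t : ℝ} (hs : 0 < s) (ht : 0 < t) : 0 < f (s, t + b s) := by
  have hδ := hbf.delta_pos
  have hc : IsPreconnected (Ioi (0 : ℝ) ×ˢ Ioi (0 : ℝ)) :=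
    isPreconnected_Ioi.prod isPreconnected_Ioi
  refine pos_of_isPreconnected hc hbf.continuous_shear ?_ (a := (3 * δ, δ / 2)) ?_ ?_
    (x := (s, t)) ⟨hs, ht⟩
  · rintro ⟨s, t⟩ ⟨hs, ht⟩ h
    have hs : 0 < s := hs
    have ht : 0 < t := ht
    rcases (hbf.f_eq_zero_iff s t).1 h with h | h <;> linarith [h.1, h.2]
  · exact ⟨show 0 < 3 * δ by linarith, show 0 < δ / 2 by linarith⟩
  · change 0 < f (3 * δ, δ / 2 + b (3 * δ))
    rw [hbf.f_far (by rw [abs_of_pos] <;> linarith)]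
    linarith

theorem f_neg {s t : ℝ} (h : s < 0 ∨ t < 0) : f (s, t + b s) < 0 := by
  have hδ := hbf.delta_pos
  -- The complement of the closed quadrant is a union of two half-planes that share the point `(-1,
  -- -1)`.
  have hc : IsPreconnected (Iio (0 : ℝ) ×ˢ (univ : Set ℝ) ∪ (univ : Set ℝ) ×ˢ Iio (0 : ℝ)) := by
    refine IsPreconnected.union (-1, -1) ?_ ?_ (isPreconnected_Iio.prod isPreconnected_univ)
      (isPreconnected_univ.prod isPreconnected_Iio)
    · exact ⟨show (-1 : ℝ) < 0 by norm_num, trivial⟩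
    · exact ⟨trivial, show (-1 : ℝ) < 0 by norm_num⟩
  have := pos_of_isPreconnected hc hbf.continuous_shear.neg ?_ (a := (3 * δ, -(δ / 2))) ?_ ?_
    (x := (s, t)) (h.imp (fun h => ⟨h, trivial⟩) fun h => ⟨trivial, h⟩)
  · simpa using this
  · rintro ⟨s, t⟩ hst h
    have hst : s < 0 ∨ t < 0 := hst.imp (fun h => h.1) fun h => h.2
    rcases (hbf.f_eq_zero_iff s t).1 (neg_eq_zero.1 h) with h | h <;>
      rcases hst with hst | hst <;> linarith [h.1, h.2]
  · exact Or.inr ⟨trivial, show -(δ / 2) < 0 by linarith⟩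
  · change 0 < - f (3 * δ, -(δ / 2) + b (3 * δ))
    rw [hbf.f_far (by rw [abs_neg, abs_of_pos] <;> linarith)]
    linarith

theorem f_pos_iff {s t : ℝ} : 0 < f (s, t + b s) ↔ 0 < s ∧ 0 < t := by
  refine ⟨fun h => ?_, fun h => hbf.f_pos h.1 h.2⟩
  by_contra hn
  rw [not_and_or, not_lt, not_lt] at hn
  by_cases hst : s < 0 ∨ t < 0
  · exact lt_asymm h (hbf.f_neg hst)
  · push Not at hst
    refine h.ne' ((hbf.f_eq_zero_iff s t).2 ?_)
    rcases hst.1.eq_or_lt with h0 | h0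
    · exact Or.inl ⟨h0.symm, hst.2⟩
    · exact Or.inr ⟨h0, le_antisymm (hn.resolve_left (not_le.2 h0)) hst.2⟩

theorem f_nonneg_iff {s t : ℝ} : 0 ≤ f (s, t + b s) ↔ 0 ≤ s ∧ 0 ≤ t := by
  constructor
  · intro h
    by_contra hn
    rw [not_and_or, not_le, not_le] at hn
    exact not_lt.2 h (hbf.f_neg hn)
  · rintro ⟨hs, ht⟩
    rcases hs.eq_or_lt with h0 | h0
    · exact ((hbf.f_eq_zero_iff s t).2 (Or.inl ⟨h0.symm, ht⟩)).ge
    · rcases ht.eq_or_lt with h1 | h1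
      · exact ((hbf.f_eq_zero_iff s t).2 (Or.inr ⟨h0, h1.symm⟩)).ge
      · exact (hbf.f_pos h0 h1).le

theorem hasFDerivAt (x : ℝ × ℝ) : HasFDerivAt f (fderiv ℝ f x) x :=
  (hbf.f_contDiff.differentiable one_ne_zero x).hasFDerivAt

theorem hasDerivAt_snd (s t : ℝ) :
    HasDerivAt (fun r => f (s, r)) (fderiv ℝ f (s, t) (0, 1)) t :=
  (hbf.hasFDerivAt (s, t)).comp_hasDerivAt t ((hasDerivAt_const t s).prodMk (hasDerivAt_id t))

theorem hasDerivAt_fst (s t : ℝ) :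
    HasDerivAt (fun r => f (r, t)) (fderiv ℝ f (s, t) (1, 0)) s :=
  (hbf.hasFDerivAt (s, t)).comp_hasDerivAt s ((hasDerivAt_id s).prodMk (hasDerivAt_const s t))

theorem fderiv_apply_ne_zero (x : ℝ × ℝ) (h : fderiv ℝ f x (0, 1) = 0) :
    fderiv ℝ f x (1, 0) ≠ 0 := fun h' => hbf.f_submersion x (by
  ext
  · simpa using h'
  · simpa using h)

theorem fderiv_zero_snd {t : ℝ} (ht : 0 ≤ t) : fderiv ℝ f (0, t) (0, 1) = 0 := by
  -- Derivatives within `Ici t` suffice, so the endpoint `t = 0`, where `f` is controlled only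
  -- above, is included.
  have h₁ := (hbf.hasDerivAt_snd 0 t).hasDerivWithinAt (s := Ici t)
  have h₂ : HasDerivWithinAt (fun r => f (0, r)) 0 (Ici t) t := by
    refine (hasDerivWithinAt_const t (Ici t) (0 : ℝ)).congr (fun r hr => ?_) ?_
    · exact (hbf.f_zero 0 r).2 (Or.inl ⟨rfl, ht.trans hr⟩)
    · exact (hbf.f_zero 0 t).2 (Or.inl ⟨rfl, ht⟩)
  exact (uniqueDiffOn_Ici t t self_mem_Ici).eq_deriv _ h₁ h₂

theorem fderiv_zero_fst {t : ℝ} (ht : 0 ≤ t) : 0 < fderiv ℝ f (0, t) (1, 0) := by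
  refine lt_of_le_of_ne ?_ (hbf.fderiv_apply_ne_zero _ (hbf.fderiv_zero_snd ht)).symm
  refine nonneg_of_hasDerivAt_of_nonpos_left (hbf.hasDerivAt_fst 0 t)
    ((hbf.f_zero 0 t).2 (Or.inl ⟨rfl, ht⟩)) fun s hs => ?_
  have := hbf.f_neg (t := t) (Or.inl hs)
  rw [hbf.b_of_nonpos hs.le, add_zero] at this
  exact this.le

theorem fderiv_graph_snd {t : ℝ} (ht : 0 < t) : 0 < fderiv ℝ f (t, b t) (0, 1) := by
  refine lt_of_le_of_ne ?_ fun h => ?_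
  · refine nonneg_of_hasDerivAt_of_nonpos_left (hbf.hasDerivAt_snd t (b t)) (hbf.f_graph ht.le)
      fun s hs => ?_
    have := hbf.f_neg (s := t) (t := s - b t) (Or.inr (sub_neg.2 hs))
    rw [sub_add_cancel] at this
    exact this.le
  -- If the second partial vanished, differentiating `f (t, b t) = 0` would make the first vanish
  -- too, against submersivity.
  · refine hbf.fderiv_apply_ne_zero _ h.symm ?_
    have hb : HasDerivAt b (deriv b t) t :=
      ((hbf.b_smooth.contDiffAt (isOpen_compl_singleton.mem_nhds ht.ne')).differentiableAt
        (by simp)).hasDerivAt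
    have h₁ := (hbf.hasFDerivAt (t, b t)).comp_hasDerivAt t ((hasDerivAt_id t).prodMk hb)
    have h₂ : HasDerivAt (f ∘ fun r => (id r, b r)) 0 t := by
      refine (hasDerivAt_const t (0 : ℝ)).congr_of_eventuallyEq ?_
      filter_upwards [Ioi_mem_nhds ht] with r hr
      exact hbf.f_graph (le_of_lt hr)
    have := h₁.unique h₂
    rw [clm_prod_apply, ← h] at this
    simpa using this

end IsSmoothingPair

/-! ## The functions `h` -/

namespace RootedForest

variable {W : Type*} (F : RootedForest W)

theorem h_of_mem_roots (f : ℝ × ℝ → ℝ) {α : W} (hα : α ∈ F.roots) (x : EuclideanSpace ℝ W) :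
    F.h f α x = x α := by
  rw [h, dif_pos hα]

theorem h_of_isParent (f : ℝ × ℝ → ℝ) {β α : W} (hβ : F.IsParent β α) (x : EuclideanSpace ℝ W) :
    F.h f α x = f (F.h f β x, x α) := by
  rw [h, dif_neg hβ.notMem_roots, hβ.eq_parent]

/-- Induction along the order of a rooted forest. -/
theorem parent_induction {P : W → Prop} (hroot : ∀ α ∈ F.roots, P α)
    (hstep : ∀ β α, F.IsParent β α → P β → P α) (α : W) : P α := by
  induction hn : F.height α using Nat.strong_induction_on generalizing α with
  | _ n ih =>
    by_cases hα : α ∈ F.roots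
    · exact hroot α hα
    · have hp := F.parent_spec α hα
      exact hstep _ α hp (ih _ (by have := hp.2; omega) _ rfl)

theorem le_root {α β : W} (hα : α ∈ F.roots) (h : F.rooting.le β α) : β = α := by
  by_contra hne
  obtain ⟨c, -, hc⟩ := Rooting.exists_par_of_le h hne
  exact IsParent.notMem_roots hc hα

theorem le_iff_of_isParent {α β γ : W} (h : F.IsParent β α) :
    F.rooting.le γ α ↔ F.rooting.le γ β ∨ γ = α := by
  constructor
  · intro hγ
    by_cases hne : γ = α
    · exact Or.inr hne
    · exact Or.inl (Rooting.le_par_of_le hγ hne h)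
  · rintro (hγ | rfl)
    · exact Rooting.le_trans hγ (Rooting.par_le (R := F.rooting) h)
    · exact Rooting.le_refl _

theorem not_le_of_isParent {α β : W} (h : F.IsParent β α) : ¬ F.rooting.le α β := fun h' => by
  have := Rooting.le_ht h'
  have := F.rooting.ht_lt h
  omega

/-! ### Sheared coordinates -/

open Classical in
/-- The coordinates in which the closed pieces are polyhedral. -/
noncomputable def shear (b : ℝ → ℝ) (f : ℝ × ℝ → ℝ) (x : EuclideanSpace ℝ W) (α : W) : ℝ :=
  if hα : α ∈ F.roots then x α else x α - b (F.h f (F.parent α hα) x)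

open Classical in
/-- The function `h` in terms of the sheared coordinates. -/
noncomputable def shearedH (b : ℝ → ℝ) (f : ℝ × ℝ → ℝ) (u : W → ℝ) (α : W) : ℝ :=
  if hα : α ∈ F.roots then u α else
    f (shearedH b f u (F.parent α hα), u α + b (shearedH b f u (F.parent α hα)))
termination_by F.height α
decreasing_by
  all_goals
    have := (F.parent_spec α hα).2
    omega

open Classical in
/-- The inverse of the sheared coordinates. -/
noncomputable def unshear (b : ℝ → ℝ) (f : ℝ × ℝ → ℝ) (u : W → ℝ) : EuclideanSpace ℝ W :=
  WithLp.toLp 2 fun α => if hα : α ∈ F.roots then u α else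
    u α + b (F.shearedH b f u (F.parent α hα))

variable (b : ℝ → ℝ) (f : ℝ × ℝ → ℝ)

theorem shear_of_mem_roots {α : W} (hα : α ∈ F.roots) (x : EuclideanSpace ℝ W) :
    F.shear b f x α = x α := dif_pos hα

theorem shear_of_isParent {β α : W} (hβ : F.IsParent β α) (x : EuclideanSpace ℝ W) :
    F.shear b f x α = x α - b (F.h f β x) := by
  rw [shear, dif_neg hβ.notMem_roots, hβ.eq_parent]

theorem shearedH_of_mem_roots {α : W} (hα : α ∈ F.roots) (u : W → ℝ) :
    F.shearedH b f u α = u α := by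
  rw [shearedH, dif_pos hα]

theorem shearedH_of_isParent {β α : W} (hβ : F.IsParent β α) (u : W → ℝ) :
    F.shearedH b f u α = f (F.shearedH b f u β, u α + b (F.shearedH b f u β)) := by
  rw [shearedH, dif_neg hβ.notMem_roots, hβ.eq_parent]

theorem unshear_of_mem_roots {α : W} (hα : α ∈ F.roots) (u : W → ℝ) :
    F.unshear b f u α = u α := by
  simp [unshear, hα]

theorem unshear_of_isParent {β α : W} (hβ : F.IsParent β α) (u : W → ℝ) :
    F.unshear b f u α = u α + b (F.shearedH b f u β) := by
  simp [unshear, hβ.notMem_roots, hβ.eq_parent]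

theorem h_unshear (u : W → ℝ) (α : W) : F.h f α (F.unshear b f u) = F.shearedH b f u α := by
  refine F.parent_induction (P := fun α => F.h f α (F.unshear b f u) = F.shearedH b f u α)
    (fun α hα => ?_) (fun β α hβ ih => ?_) α
  · rw [F.h_of_mem_roots f hα, F.shearedH_of_mem_roots b f hα, F.unshear_of_mem_roots b f hα]
  · rw [F.h_of_isParent f hβ, F.shearedH_of_isParent b f hβ, F.unshear_of_isParent b f hβ, ih]

theorem shear_unshear (u : W → ℝ) : F.shear b f (F.unshear b f u) = u := by
  ext α
  by_cases hα : α ∈ F.roots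
  · rw [F.shear_of_mem_roots b f hα, F.unshear_of_mem_roots b f hα]
  · have hβ := F.parent_spec α hα
    rw [F.shear_of_isParent b f hβ, F.unshear_of_isParent b f hβ, h_unshear, add_sub_cancel_right]

theorem shearedH_shear (x : EuclideanSpace ℝ W) (α : W) :
    F.shearedH b f (F.shear b f x) α = F.h f α x := by
  refine F.parent_induction (P := fun α => F.shearedH b f (F.shear b f x) α = F.h f α x)
    (fun α hα => ?_) (fun β α hβ ih => ?_) α
  · rw [F.h_of_mem_roots f hα, F.shearedH_of_mem_roots b f hα, F.shear_of_mem_roots b f hα]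
  · rw [F.h_of_isParent f hβ, F.shearedH_of_isParent b f hβ, F.shear_of_isParent b f hβ, ih,
      sub_add_cancel]

theorem unshear_shear (x : EuclideanSpace ℝ W) : F.unshear b f (F.shear b f x) = x := by
  ext α
  by_cases hα : α ∈ F.roots
  · rw [F.unshear_of_mem_roots b f hα, F.shear_of_mem_roots b f hα]
  · have hβ := F.parent_spec α hα
    rw [F.unshear_of_isParent b f hβ, F.shear_of_isParent b f hβ, shearedH_shear, sub_add_cancel]

variable {F f} in
theorem fderiv_h_of_mem_roots [Fintype W] {α : W} (hα : α ∈ F.roots) (x v : EuclideanSpace ℝ W) :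
    fderiv ℝ (F.h f α) x v = v α := by
  rw [show F.h f α = EuclideanSpace.proj (𝕜 := ℝ) α from
    funext fun x => F.h_of_mem_roots f hα x, ContinuousLinearMap.fderiv]
  rfl

section SmoothingPair

variable {F b f} {δ : ℝ} (hbf : IsSmoothingPair δ b f)

include hbf

/-! ### Signs -/

theorem h_nonneg_iff (x : EuclideanSpace ℝ W) (α : W) :
    0 ≤ F.h f α x ↔ ∀ β, F.rooting.le β α → 0 ≤ F.shear b f x β := by
  refine F.parent_induction
    (P := fun α => 0 ≤ F.h f α x ↔ ∀ β, F.rooting.le β α → 0 ≤ F.shear b f x β)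
    (fun α hα => ?_) (fun β α hβ ih => ?_) α
  · rw [F.h_of_mem_roots f hα, ← F.shear_of_mem_roots b f hα]
    exact ⟨fun h β hβ => (F.le_root hα hβ) ▸ h, fun h => h α (Rooting.le_refl α)⟩
  · rw [F.h_of_isParent f hβ, ← sub_add_cancel (x α) (b (F.h f β x)), hbf.f_nonneg_iff, ih,
      ← F.shear_of_isParent b f hβ]
    simp only [F.le_iff_of_isParent hβ, or_imp, forall_and, forall_eq]

theorem h_pos_iff (x : EuclideanSpace ℝ W) (α : W) :
    0 < F.h f α x ↔ ∀ β, F.rooting.le β α → 0 < F.shear b f x β := by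
  refine F.parent_induction
    (P := fun α => 0 < F.h f α x ↔ ∀ β, F.rooting.le β α → 0 < F.shear b f x β)
    (fun α hα => ?_) (fun β α hβ ih => ?_) α
  · rw [F.h_of_mem_roots f hα, ← F.shear_of_mem_roots b f hα]
    exact ⟨fun h β hβ => (F.le_root hα hβ) ▸ h, fun h => h α (Rooting.le_refl α)⟩
  · rw [F.h_of_isParent f hβ, ← sub_add_cancel (x α) (b (F.h f β x)), hbf.f_pos_iff, ih,
      ← F.shear_of_isParent b f hβ]
    simp only [F.le_iff_of_isParent hβ, or_imp, forall_and, forall_eq]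

theorem h_eq_zero_iff (x : EuclideanSpace ℝ W) (α : W) :
    F.h f α x = 0 ↔ (∀ β, F.rooting.le β α → 0 ≤ F.shear b f x β) ∧
      ∃ β, F.rooting.le β α ∧ F.shear b f x β = 0 := by
  rw [le_antisymm_iff, and_comm, ← not_lt (a := (0 : ℝ)), h_nonneg_iff hbf, h_pos_iff hbf]
  refine and_congr_right fun h => ?_
  push Not
  exact exists_congr fun β => and_congr_right fun hβ =>
    ⟨fun h' => le_antisymm h' (h β hβ), fun h' => h'.le⟩

theorem mem_smoothedPiece_iff (x : EuclideanSpace ℝ W) (α : W) :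
    x ∈ F.smoothedPiece b f α ↔
      F.shear b f x α = 0 ∧ ∀ β, F.rooting.le β α → 0 ≤ F.shear b f x β := by
  by_cases hα : α ∈ F.roots
  · rw [F.shear_of_mem_roots b f hα]
    constructor
    · rintro ⟨h, -⟩
      rw [F.h_of_mem_roots f hα] at h
      refine ⟨h, fun β hβ => ?_⟩
      rw [F.le_root hα hβ, F.shear_of_mem_roots b f hα, h]
    · rintro ⟨h, -⟩
      exact ⟨by rw [F.h_of_mem_roots f hα, h], fun h' => absurd hα h'⟩
  · have hβ := F.parent_spec α hα
    constructor
    · rintro ⟨-, h⟩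
      obtain ⟨h₁, h₂⟩ := h hα
      have h0 : F.shear b f x α = 0 := by rw [F.shear_of_isParent b f hβ, h₂, sub_self]
      refine ⟨h0, fun γ hγ => ?_⟩
      rcases (F.le_iff_of_isParent hβ).1 hγ with hγ | rfl
      · exact (h_nonneg_iff hbf x _).1 h₁ γ hγ
      · exact h0.ge
    · rintro ⟨h, h'⟩
      have h₁ : 0 ≤ F.h f (F.parent α hα) x := (h_nonneg_iff hbf x _).2 fun γ hγ =>
        h' γ ((F.le_iff_of_isParent hβ).2 (Or.inl hγ))
      rw [F.shear_of_isParent b f hβ] at h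
      have h₂ := sub_eq_zero.1 h
      refine ⟨?_, fun _ => ⟨h₁, h₂⟩⟩
      rw [F.h_of_isParent f hβ, h₂]
      exact hbf.f_graph h₁

variable (F b f) in
/-- `γ` is the first vertex, on the way up from the root, whose sheared coordinate vanishes. -/
def IsFirstZero (x : EuclideanSpace ℝ W) (γ : W) : Prop :=
  F.shear b f x γ = 0 ∧ ∀ β, F.rooting.le β γ → β ≠ γ → 0 < F.shear b f x β

theorem IsFirstZero.h_eq_zero {x : EuclideanSpace ℝ W} {γ : W} (h : F.IsFirstZero b f x γ) :
    F.h f γ x = 0 :=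
  (h_eq_zero_iff hbf x γ).2 ⟨fun β hβ => by
    by_cases hne : β = γ
    · exact hne ▸ h.1.ge
    · exact (h.2 β hβ hne).le, γ, Rooting.le_refl γ, h.1⟩

/-! ### Continuity -/

theorem continuous_shearedH (α : W) : Continuous fun u => F.shearedH b f u α := by
  refine F.parent_induction (P := fun α => Continuous fun u => F.shearedH b f u α)
    (fun α hα => ?_) (fun β α hβ ih => ?_) α
  · simp only [F.shearedH_of_mem_roots b f hα]
    exact continuous_apply α
  · simp only [F.shearedH_of_isParent b f hβ]
    exact hbf.f_contDiff.continuous.comp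
      (ih.prodMk ((continuous_apply α).add (hbf.b_continuous.comp ih)))

theorem continuous_unshear : Continuous (F.unshear b f) := by
  refine (PiLp.continuous_toLp 2 _).comp (continuous_pi fun α => ?_)
  by_cases hα : α ∈ F.roots
  · simp only [dif_pos hα]
    exact continuous_apply α
  · simp only [dif_neg hα]
    exact (continuous_apply α).add (hbf.b_continuous.comp (continuous_shearedH hbf _))

variable [Fintype W]

theorem contDiff_h (α : W) : ContDiff ℝ 1 (F.h f α) := by
  refine F.parent_induction (P := fun α => ContDiff ℝ 1 (F.h f α))
    (fun α hα => ?_) (fun β α hβ ih => ?_) α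
  · rw [show F.h f α = fun x => x α from funext fun x => F.h_of_mem_roots f hα x]
    exact (EuclideanSpace.proj (𝕜 := ℝ) α).contDiff
  · rw [show F.h f α = fun x => f (F.h f β x, x α) from funext fun x => F.h_of_isParent f hβ x]
    exact hbf.f_contDiff.comp (ih.prodMk (EuclideanSpace.proj (𝕜 := ℝ) α).contDiff)

theorem continuous_shear : Continuous (F.shear b f) := by
  refine continuous_pi fun α => ?_
  have hα' : Continuous fun x : EuclideanSpace ℝ W => x α :=
    (EuclideanSpace.proj (𝕜 := ℝ) α).continuous
  by_cases hα : α ∈ F.roots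
  · simp only [F.shear_of_mem_roots b f hα]
    exact hα'
  · simp only [F.shear_of_isParent b f (F.parent_spec α hα)]
    exact hα'.sub (hbf.b_continuous.comp (contDiff_h hbf _).continuous)

/-! ### Differentials -/

theorem fderiv_h_of_isParent {β α : W} (hβ : F.IsParent β α) (x v : EuclideanSpace ℝ W) :
    fderiv ℝ (F.h f α) x v =
      fderiv ℝ (F.h f β) x v * fderiv ℝ f (F.h f β x, x α) (1, 0) +
        v α * fderiv ℝ f (F.h f β x, x α) (0, 1) := by
  have h₁ : HasFDerivAt (F.h f β) (fderiv ℝ (F.h f β) x) x :=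
    ((contDiff_h hbf β).differentiable one_ne_zero x).hasFDerivAt
  have h₂ := (hbf.hasFDerivAt (F.h f β x, x α)).comp x
    (h₁.prodMk (EuclideanSpace.proj (𝕜 := ℝ) α).hasFDerivAt)
  have h₃ : F.h f α = f ∘ fun x => (F.h f β x, EuclideanSpace.proj (𝕜 := ℝ) α x) :=
    funext fun x => F.h_of_isParent f hβ x
  rw [h₃, h₂.fderiv, ← clm_prod_apply]
  rfl

theorem fderiv_h_apply_eq_zero (x : EuclideanSpace ℝ W) {v : EuclideanSpace ℝ W} (α : W)
    (hv : ∀ β, F.rooting.le β α → v β = 0) : fderiv ℝ (F.h f α) x v = 0 := by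
  revert hv
  refine F.parent_induction (P := fun α => (∀ β, F.rooting.le β α → v β = 0) →
    fderiv ℝ (F.h f α) x v = 0) (fun α hα hv => ?_) (fun β α hβ ih hv => ?_) α
  · rw [fderiv_h_of_mem_roots hα, hv α (Rooting.le_refl α)]
  · rw [fderiv_h_of_isParent hbf hβ, hv α (Rooting.le_refl α),
      ih fun γ hγ => hv γ ((F.le_iff_of_isParent hβ).2 (Or.inl hγ)), zero_mul, zero_mul, add_zero]

open Classical in
theorem fderiv_h_single_eq_zero (x : EuclideanSpace ℝ W) {γ α : W} (h : ¬ F.rooting.le γ α) :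
    fderiv ℝ (F.h f α) x (EuclideanSpace.single γ 1) = 0 := by
  refine fderiv_h_apply_eq_zero hbf x α fun β hβ => ?_
  have : β ≠ γ := fun e => h (e ▸ hβ)
  simp [this]

open Classical in
-- Testing on the basis vector of `α` isolates the second partial of `f`. If that is zero the first
-- is not, and vanishing would pass down to the parent and eventually to a root.
theorem fderiv_h_ne_zero (α : W) (x : EuclideanSpace ℝ W) : fderiv ℝ (F.h f α) x ≠ 0 := by
  refine F.parent_induction (P := fun α => fderiv ℝ (F.h f α) x ≠ 0)
    (fun α hα h => ?_) (fun β α hβ ih h => ih ?_) α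
  · have := fderiv_h_of_mem_roots (f := f) hα x (EuclideanSpace.single α 1)
    rw [h] at this
    simp at this
  · have h₁ := fderiv_h_of_isParent hbf hβ x (EuclideanSpace.single α 1)
    rw [h, fderiv_h_single_eq_zero hbf x (F.not_le_of_isParent hβ)] at h₁
    have h₂ : fderiv ℝ f (F.h f β x, x α) (0, 1) = 0 := by simpa using h₁.symm
    ext v
    have h₃ := fderiv_h_of_isParent hbf hβ x v
    rw [h, h₂, mul_zero, add_zero] at h₃
    simpa using (mul_eq_zero.1 h₃.symm).resolve_right (hbf.fderiv_apply_ne_zero _ h₂)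

/-- Here `f` is evaluated on the half-line `{0} × [0, ∞)`, where its differential is a positive
multiple of that of the first coordinate. -/
theorem exists_fderiv_h_eq_smul {β α : W} (hβ : F.IsParent β α) {x : EuclideanSpace ℝ W}
    (h0 : F.h f β x = 0) (h0' : F.h f α x = 0) :
    ∃ c : ℝ, 0 < c ∧ fderiv ℝ (F.h f α) x = c • fderiv ℝ (F.h f β) x := by
  have hx : 0 ≤ x α := by
    rw [F.h_of_isParent f hβ, h0, hbf.f_zero] at h0'
    rcases h0' with h | h
    · exact h.2
    · exact absurd h.1 (lt_irrefl 0)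
  refine ⟨_, hbf.fderiv_zero_fst hx, ContinuousLinearMap.ext fun v => ?_⟩
  rw [fderiv_h_of_isParent hbf hβ, h0, hbf.fderiv_zero_snd hx, mul_zero, add_zero, mul_comm]
  rfl

open Classical in
theorem fderiv_h_single_pos {x : EuclideanSpace ℝ W} {α : W} (h0 : F.shear b f x α = 0)
    (hlt : ∀ β, F.rooting.le β α → β ≠ α → 0 < F.shear b f x β) :
    0 < fderiv ℝ (F.h f α) x (EuclideanSpace.single α 1) := by
  by_cases hα : α ∈ F.roots
  · rw [fderiv_h_of_mem_roots hα]
    simp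
  · have hβ := F.parent_spec α hα
    have hpos : 0 < F.h f (F.parent α hα) x := (h_pos_iff hbf x _).2 fun γ hγ =>
      hlt γ ((F.le_iff_of_isParent hβ).2 (Or.inl hγ)) fun e => F.not_le_of_isParent hβ (e ▸ hγ)
    rw [fderiv_h_of_isParent hbf hβ, fderiv_h_single_eq_zero hbf x (F.not_le_of_isParent hβ)]
    rw [F.shear_of_isParent b f hβ, sub_eq_zero] at h0
    rw [h0]
    simpa using hbf.fderiv_graph_snd hpos

/-! ### Unit conormals -/

variable (F) in
/-- The unit covector in the direction of the differential of `h`. -/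
noncomputable def conormal (α : W) (x : EuclideanSpace ℝ W) :
    Metric.sphere (0 : EuclideanSpace ℝ W →L[ℝ] ℝ) 1 :=
  ⟨‖fderiv ℝ (F.h f α) x‖⁻¹ • fderiv ℝ (F.h f α) x, by
    rw [mem_sphere_zero_iff_norm, norm_smul, norm_inv, norm_norm]
    exact inv_mul_cancel₀ (norm_ne_zero_iff.2 (fderiv_h_ne_zero hbf α x))⟩

theorem conormal_pos (α : W) (x : EuclideanSpace ℝ W) : 0 < ‖fderiv ℝ (F.h f α) x‖⁻¹ :=
  inv_pos.2 (norm_pos_iff.2 (fderiv_h_ne_zero hbf α x))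

theorem conormal_apply (α : W) (x v : EuclideanSpace ℝ W) :
    (F.conormal hbf α x : EuclideanSpace ℝ W →L[ℝ] ℝ) v =
      ‖fderiv ℝ (F.h f α) x‖⁻¹ * fderiv ℝ (F.h f α) x v := rfl

theorem continuous_conormal (α : W) : Continuous (F.conormal hbf α) := by
  have : Continuous (fderiv ℝ (F.h f α)) := (contDiff_h hbf α).continuous_fderiv one_ne_zero
  exact ((this.norm.inv₀ fun x => norm_ne_zero_iff.2 (fderiv_h_ne_zero hbf α x)).smul
    this).subtype_mk _

theorem eq_conormal_of_eq_smul {α : W} {x : EuclideanSpace ℝ W}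
    {ξ : Metric.sphere (0 : EuclideanSpace ℝ W →L[ℝ] ℝ) 1} {c : ℝ} (hc : 0 < c)
    (h : (ξ : EuclideanSpace ℝ W →L[ℝ] ℝ) = c • fderiv ℝ (F.h f α) x) :
    ξ = F.conormal hbf α x := by
  have hξ : ‖(ξ : EuclideanSpace ℝ W →L[ℝ] ℝ)‖ = 1 := mem_sphere_zero_iff_norm.1 ξ.2
  rw [h, norm_smul, Real.norm_of_nonneg hc.le] at hξ
  refine Subtype.ext ?_
  rw [h, eq_inv_of_mul_eq_one_left hξ]
  rfl

theorem eq_conormal_or_eq_neg {α : W} {x : EuclideanSpace ℝ W}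
    {ξ : Metric.sphere (0 : EuclideanSpace ℝ W →L[ℝ] ℝ) 1} {c : ℝ}
    (h : (ξ : EuclideanSpace ℝ W →L[ℝ] ℝ) = c • fderiv ℝ (F.h f α) x) :
    ξ = F.conormal hbf α x ∨ ξ = -F.conormal hbf α x := by
  rcases lt_trichotomy c 0 with hc | hc | hc
  · right
    rw [← eq_conormal_of_eq_smul hbf (ξ := -ξ) (neg_pos.2 hc), neg_neg]
    rw [neg_smul, ← h]
    rfl
  · have hξ : ‖(ξ : EuclideanSpace ℝ W →L[ℝ] ℝ)‖ = 1 := mem_sphere_zero_iff_norm.1 ξ.2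
    rw [h, hc, zero_smul, norm_zero] at hξ
    exact absurd hξ zero_ne_one
  · exact Or.inl (eq_conormal_of_eq_smul hbf hc h)

theorem conormal_eq_of_le {γ α : W} (hle : F.rooting.le γ α) {x : EuclideanSpace ℝ W}
    (h0 : F.h f γ x = 0) (h0' : F.h f α x = 0) : F.conormal hbf γ x = F.conormal hbf α x := by
  have h0γ := (h_eq_zero_iff hbf x γ).1 h0
  induction hle with
  | refl => rfl
  | @tail β α hγβ hβ ih =>
    -- All intermediate functions vanish: the sheared coordinates below `β` are nonnegative because
    -- `h_α = 0`, and one of them is zero because `h_γ = 0`.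
    have hβ0 : F.h f β x = 0 := by
      refine (h_eq_zero_iff hbf x β).2 ⟨fun ε hε => ?_, ?_⟩
      · exact ((h_eq_zero_iff hbf x α).1 h0').1 ε
          (Rooting.le_trans hε (Rooting.par_le (R := F.rooting) hβ))
      · obtain ⟨ε, hε, hε0⟩ := h0γ.2
        exact ⟨ε, Rooting.le_trans hε hγβ, hε0⟩
    rw [ih hβ0]
    obtain ⟨c, hc, h⟩ := exists_fderiv_h_eq_smul hbf hβ hβ0 h0'
    refine eq_conormal_of_eq_smul hbf
      (mul_pos (conormal_pos (F := F) hbf β x) (inv_pos.2 hc)) ?_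
    rw [h, mul_smul, smul_smul c⁻¹, inv_mul_cancel₀ hc.ne', one_smul]
    rfl

theorem exists_isFirstZero {x : EuclideanSpace ℝ W} {α : W} (h : F.h f α x = 0) :
    ∃ γ, F.rooting.le γ α ∧ F.IsFirstZero b f x γ ∧ F.conormal hbf γ x = F.conormal hbf α x := by
  obtain ⟨h₁, β, hβ, h₂⟩ := (h_eq_zero_iff hbf x α).1 h
  obtain ⟨γ, hγ, h₃⟩ := TreeCorrespondence.exists_first_zero h₂
    fun ε hε => h₁ ε (Rooting.le_trans hε hβ)
  have hγα := Rooting.le_trans hγ hβ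
  exact ⟨γ, hγα, h₃, conormal_eq_of_le hbf hγα (IsFirstZero.h_eq_zero hbf h₃) h⟩

open Classical in
-- The differential at the first zero `γ` is positive on the basis vector of `γ`, while that of
-- `h_γ'` kills it unless `γ ≤ γ'`. Proportionality therefore forces both inequalities.
theorem IsFirstZero.eq_of_conormal {x : EuclideanSpace ℝ W} {γ γ' : W}
    (h : F.IsFirstZero b f x γ) (h' : F.IsFirstZero b f x γ')
    (he : F.conormal hbf γ x = F.conormal hbf γ' x ∨
      F.conormal hbf γ x = -F.conormal hbf γ' x) : γ = γ' := by
  have key : ∀ {γ γ' : W}, F.IsFirstZero b f x γ →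
      (F.conormal hbf γ x = F.conormal hbf γ' x ∨
        F.conormal hbf γ x = -F.conormal hbf γ' x) → F.rooting.le γ γ' := by
    intro γ γ' h he
    by_contra hle
    have h₁ : (F.conormal hbf γ x : EuclideanSpace ℝ W →L[ℝ] ℝ) (EuclideanSpace.single γ 1) ≠ 0 :=
      (mul_pos (conormal_pos hbf γ x) (fderiv_h_single_pos hbf h.1 h.2)).ne'
    have h₂ : (F.conormal hbf γ' x : EuclideanSpace ℝ W →L[ℝ] ℝ) (EuclideanSpace.single γ 1) = 0 := by
      rw [conormal_apply, fderiv_h_single_eq_zero hbf x hle, mul_zero]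
    rcases he with he | he
    · rw [he] at h₁
      exact h₁ h₂
    · rw [he] at h₁
      refine h₁ ?_
      change -((F.conormal hbf γ' x : EuclideanSpace ℝ W →L[ℝ] ℝ) (EuclideanSpace.single γ 1)) = 0
      rw [h₂, neg_zero]
  refine Rooting.le_antisymm (key h he) (key h' (he.imp Eq.symm fun e => ?_))
  rw [e, neg_neg]

theorem conormal_ne_neg_of_h_eq_zero {α β : W} {x : EuclideanSpace ℝ W} (hα : F.h f α x = 0)
    (hβ : F.h f β x = 0) : F.conormal hbf α x ≠ -F.conormal hbf β x := by
  intro h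
  obtain ⟨γ, -, hγ, hγα⟩ := exists_isFirstZero hbf hα
  obtain ⟨γ', -, hγ', hγβ⟩ := exists_isFirstZero hbf hβ
  rw [← hγα, ← hγβ] at h
  obtain rfl := hγ.eq_of_conormal hbf hγ' (Or.inr h)
  exact ne_neg_of_mem_unit_sphere ℝ _ h

end SmoothingPair

end RootedForest

/-! ## Lines and rays -/

section Coline

variable {E : Type*} [NormedAddCommGroup E] [NormedSpace ℝ E]

theorem toColine_eq_iff {u v : CosphereBundle E} :
    toColine u = toColine v ↔ u.1 = v.1 ∧ (u.2 = v.2 ∨ u.2 = -v.2) := Quotient.eq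

theorem continuous_toColine : Continuous (toColine (E := E)) := continuous_quotient_mk'

theorem isClosedMap_toColine : IsClosedMap (toColine (E := E)) := by
  intro C hC
  refine isQuotientMap_quotient_mk'.isClosed_preimage.1 ?_
  have hn : Continuous fun u : CosphereBundle E => ((u.1, -u.2) : CosphereBundle E) :=
    continuous_fst.prodMk (Continuous.fun_neg continuous_snd)
  convert hC.union (hC.preimage hn) using 1
  ext u
  constructor
  · rintro ⟨v, hv, hvu⟩
    obtain ⟨h₁, h₂ | h₂⟩ := toColine_eq_iff.1 hvu
    · exact Or.inl ((Prod.ext h₁ h₂ : v = u) ▸ hv)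
    -- The preimage of the image of `C` is the union of `C` and its antipode, both closed.
    · have : v = (u.1, -u.2) := Prod.ext h₁ h₂
      exact Or.inr (by rwa [this] at hv)
  · rintro (hu | hu)
    · exact ⟨u, hu, rfl⟩
    · exact ⟨_, hu, toColine_eq_iff.2 ⟨rfl, Or.inr rfl⟩⟩

theorem colineBundle_eq_image (H : Set E) : colineBundle H = toColine '' corayBundle H :=
  isClosedMap_toColine.closure_image_eq_of_continuous continuous_toColine _

/-- Two functions with the same zeros near a point have proportional differentials there. -/
theorem fderiv_mul_fderiv_comm_of_zeros [CompleteSpace E] {g k : E → ℝ} {g' k' : E →L[ℝ] ℝ} {x : E}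
    (hg : HasStrictFDerivAt g g' x) (hk : HasStrictFDerivAt k k' x)
    (hx : g x = 0) (h : ∀ᶠ y in 𝓝 x, g y = 0 → k y = 0) (v w : E) :
    g' v * k' w = g' w * k' v := by
  -- Near `x` the function `k` is zero on the level set of `g`, so `x` is trivially a constrained
  -- minimum and Lagrange multipliers give a linear relation between the differentials.
  have hext : IsLocalExtrOn k {y | g y = g x} x := by
    refine Or.inl ?_
    change ∀ᶠ y in 𝓝[{y | g y = g x}] x, k x ≤ k y
    filter_upwards [self_mem_nhdsWithin, nhdsWithin_le_nhds h] with y hy hy'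
    rw [h.self_of_nhds hx, hy' (hy.trans hx)]
  obtain ⟨a, c, hne, hac⟩ := hext.exists_multipliers_of_hasStrictFDerivAt_1d hg hk
  have h' : ∀ v, a * g' v + c * k' v = 0 := fun v => by
    have := congrArg (fun L : E →L[ℝ] ℝ => L v) hac
    simpa using this
  have hv := h' v
  have hw := h' w
  by_cases hc : c = 0
  · have ha : a ≠ 0 := fun ha => hne (by rw [ha, hc]; rfl)
    refine mul_left_cancel₀ ha ?_
    linear_combination k' w * hv - k' v * hw
  · refine mul_left_cancel₀ hc ?_
    linear_combination g' v * hw - g' w * hv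

theorem exists_eq_smul_of_mul_comm {L M : E →L[ℝ] ℝ} (hM : M ≠ 0)
    (h : ∀ v w, L v * M w = L w * M v) : ∃ c : ℝ, L = c • M := by
  obtain ⟨w, hw⟩ : ∃ w, M w ≠ 0 := by
    by_contra hn
    push Not at hn
    exact hM (ContinuousLinearMap.ext hn)
  refine ⟨L w / M w, ContinuousLinearMap.ext fun v => ?_⟩
  change L v = L w / M w * M v
  field_simp
  exact h v w

end Coline

namespace RootedForest

set_option linter.unusedSectionVars false

variable {W : Type*} [Fintype W] {F : RootedForest W} {δ : ℝ} {b : ℝ → ℝ} {f : ℝ × ℝ → ℝ}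

/-! ## The coray bundle of a union of closed pieces -/

variable (F b f) in
/-- The union of the closed pieces of a set of vertices. -/
def pieces (K : Set W) : Set (EuclideanSpace ℝ W) := ⋃ α ∈ K, F.smoothedPiece b f α

variable (hbf : IsSmoothingPair δ b f)

variable (F) in
/-- The rays of the differentials of the functions `h` along closed pieces. -/
def positiveRays (K : Set W) : Set (CosphereBundle (EuclideanSpace ℝ W)) :=
  {u | ∃ α ∈ K, u.1 ∈ F.smoothedPiece b f α ∧ u.2 = F.conormal hbf α u.1}

variable (F b f) in
/-- A region in which only one of the closed pieces is visible. -/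
def pieceRegion (α : W) : Set (EuclideanSpace ℝ W) :=
  {x | ∀ β, β ≠ α → F.shear b f x β ≠ 0 ∧ (F.rooting.le β α → 0 < F.shear b f x β)}

include hbf

theorem isClosed_smoothedPiece (α : W) : IsClosed (F.smoothedPiece b f α) := by
  have hc : ∀ β, Continuous fun x => F.shear b f x β := fun β =>
    (continuous_apply β).comp (continuous_shear hbf)
  have : F.smoothedPiece b f α = {x | F.shear b f x α = 0} ∩
      ⋂ (β : W) (_ : F.rooting.le β α), {x | 0 ≤ F.shear b f x β} := by
    ext x
    rw [mem_smoothedPiece_iff hbf]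
    simp
  rw [this]
  exact (isClosed_eq (hc α) continuous_const).inter
    (isClosed_iInter fun β => isClosed_iInter fun _ => isClosed_le continuous_const (hc β))

theorem isClosed_pieces (K : Set W) : IsClosed (F.pieces b f K) :=
  K.toFinite.isClosed_biUnion fun α _ => isClosed_smoothedPiece hbf α

theorem isClosed_positiveRays (K : Set W) : IsClosed (F.positiveRays hbf K) := by
  have : F.positiveRays hbf K = ⋃ α ∈ K, (Prod.fst ⁻¹' F.smoothedPiece b f α) ∩
      {u | u.2 = F.conormal hbf α u.1} := by
    ext u
    simp only [positiveRays, Set.mem_iUnion, Set.mem_inter_iff, exists_prop]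
    exact Iff.rfl
  rw [this]
  exact K.toFinite.isClosed_biUnion fun α _ =>
    ((isClosed_smoothedPiece hbf α).preimage continuous_fst).inter
      (isClosed_eq continuous_snd ((continuous_conormal hbf α).comp continuous_fst))

theorem isOpen_pieceRegion (α : W) : IsOpen (F.pieceRegion b f α) := by
  have hc : ∀ β, Continuous fun x => F.shear b f x β := fun β =>
    (continuous_apply β).comp (continuous_shear hbf)
  have : F.pieceRegion b f α = ⋂ (β : W) (_ : β ≠ α), ({x | F.shear b f x β ≠ 0} ∩
      ⋂ (_ : F.rooting.le β α), {x | 0 < F.shear b f x β}) := by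
    ext x
    simp [pieceRegion]
  rw [this]
  refine isOpen_iInter_of_finite fun β => isOpen_iInter_of_finite fun _ => ?_
  exact (isOpen_ne_fun (hc β) continuous_const).inter
    (isOpen_iInter_of_finite fun _ => isOpen_lt continuous_const (hc β))

theorem mem_pieces_iff_of_mem_pieceRegion {K : Set W} {α : W} (hα : α ∈ K)
    {x : EuclideanSpace ℝ W} (hx : x ∈ F.pieceRegion b f α) :
    x ∈ F.pieces b f K ↔ F.h f α x = 0 := by
  constructor
  · intro h
    obtain ⟨β, -, hβ⟩ := Set.mem_iUnion₂.1 h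
    by_cases hne : β = α
    · exact hne ▸ hβ.1
    · exact absurd ((mem_smoothedPiece_iff hbf x β).1 hβ).1 (hx β hne).1
  · intro h
    obtain ⟨h₁, β, hβ, h₂⟩ := (h_eq_zero_iff hbf x α).1 h
    by_cases hne : β = α
    · exact Set.mem_iUnion₂.2 ⟨α, hα, (mem_smoothedPiece_iff hbf x α).2 ⟨hne ▸ h₂, h₁⟩⟩
    · exact absurd h₂ (hx β hne).1

open Classical in
-- Adding a small `t > 0` to every sheared coordinate except that of `α` makes nonnegative
-- coordinates positive and keeps negative ones nonzero.
theorem smoothedPiece_subset_closure (α : W) :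
    F.smoothedPiece b f α ⊆ closure (F.smoothedPiece b f α ∩ F.pieceRegion b f α) := by
  intro x hx
  obtain ⟨h₁, h₂⟩ := (mem_smoothedPiece_iff hbf x α).1 hx
  set u := F.shear b f x with hu
  let p : ℝ → EuclideanSpace ℝ W := fun t =>
    F.unshear b f fun β => if β = α then u β else u β + t
  have hp : Continuous p := by
    refine (continuous_unshear hbf).comp (continuous_pi fun β => ?_)
    by_cases hβ : β = α
    · simp only [if_pos hβ]
      exact continuous_const
    · simp only [if_neg hβ]
      fun_prop
  have hp0 : p 0 = x := by
    have : (fun β => if β = α then u β else u β + 0) = u := by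
      ext β
      simp
    change F.unshear b f (fun β => if β = α then u β else u β + 0) = x
    rw [this, hu, F.unshear_shear]
  have ht : Tendsto p (𝓝[>] 0) (𝓝 x) := by
    have := hp.tendsto 0
    rw [hp0] at this
    exact this.mono_left nhdsWithin_le_nhds
  refine mem_closure_of_tendsto ht ?_
  have hne : ∀ β, ∀ᶠ t in 𝓝[>] (0 : ℝ), u β + t ≠ 0 := by
    intro β
    rcases le_or_gt 0 (u β) with h | h
    · filter_upwards [self_mem_nhdsWithin] with t ht
      exact (add_pos_of_nonneg_of_pos h ht).ne'
    · have : Iio (-u β) ∈ 𝓝 (0 : ℝ) := Iio_mem_nhds (by linarith)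
      filter_upwards [nhdsWithin_le_nhds this] with t ht
      have : t < -u β := ht
      linarith
  filter_upwards [self_mem_nhdsWithin, eventually_all.2 hne] with t ht hne
  have ht : 0 < t := ht
  refine ⟨(mem_smoothedPiece_iff hbf _ α).2 ?_, ?_⟩
  · simp only [p, F.shear_unshear]
    refine ⟨by simpa using h₁, fun β hβ => ?_⟩
    have := h₂ β hβ
    split_ifs <;> linarith
  · intro β hβ
    simp only [p, F.shear_unshear, if_neg hβ]
    exact ⟨hne β, fun hle => by linarith [h₂ β hle]⟩

theorem isConormalAt_of_mem {K : Set W} {α : W} (hα : α ∈ K) {x : EuclideanSpace ℝ W}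
    (hx : x ∈ F.smoothedPiece b f α ∩ F.pieceRegion b f α)
    {ξ : Metric.sphere (0 : EuclideanSpace ℝ W →L[ℝ] ℝ) 1}
    (hξ : ∃ c : ℝ, (ξ : EuclideanSpace ℝ W →L[ℝ] ℝ) = c • fderiv ℝ (F.h f α) x) :
    IsConormalAt (F.pieces b f K) x ξ :=
  ⟨Set.mem_iUnion₂.2 ⟨α, hα, hx.1⟩, F.pieceRegion b f α, F.h f α, isOpen_pieceRegion hbf α, hx.2,
    (contDiff_h hbf α).contDiffOn, fun y _ => fderiv_h_ne_zero hbf α y,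
    fun _ hy => mem_pieces_iff_of_mem_pieceRegion hbf hα hy, hξ⟩

/-- A smooth point may lie on several pieces, and any piece through it determines the conormal line:
the given submersion and `h_α` have proportional differentials at the generic points of that piece,
which accumulate at `x`, and proportionality passes to the limit. -/
theorem exists_of_isConormalAt {K : Set W} {x : EuclideanSpace ℝ W}
    {ξ : Metric.sphere (0 : EuclideanSpace ℝ W →L[ℝ] ℝ) 1}
    (h : IsConormalAt (F.pieces b f K) x ξ) :
    ∃ α ∈ K, x ∈ F.smoothedPiece b f α ∧
      (ξ = F.conormal hbf α x ∨ ξ = -F.conormal hbf α x) := by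
  obtain ⟨hx, U, g, hU, hxU, hg, -, hgU, c, hc⟩ := h
  obtain ⟨α, hα, hxα⟩ := Set.mem_iUnion₂.1 hx
  refine ⟨α, hα, hxα, ?_⟩
  have hcont : ContinuousOn (fderiv ℝ g) U := hg.continuousOn_fderiv_of_isOpen hU le_rfl
  have hcont' : Continuous (fderiv ℝ (F.h f α)) :=
    (contDiff_h hbf α).continuous_fderiv one_ne_zero
  have hprop : ∀ v w, fderiv ℝ g x v * fderiv ℝ (F.h f α) x w =
      fderiv ℝ g x w * fderiv ℝ (F.h f α) x v := by
    intro v w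
    have hmem : x ∈ closure ((F.smoothedPiece b f α ∩ F.pieceRegion b f α) ∩ U) := by
      have := smoothedPiece_subset_closure hbf α hxα
      rw [mem_closure_iff_nhds] at this ⊢
      intro N hN
      obtain ⟨y, hy, hy'⟩ := this (N ∩ U) (Filter.inter_mem hN (hU.mem_nhds hxU))
      exact ⟨y, hy.1, hy', hy.2⟩
    have hgen : ∀ y ∈ (F.smoothedPiece b f α ∩ F.pieceRegion b f α) ∩ U,
        fderiv ℝ g y v * fderiv ℝ (F.h f α) y w = fderiv ℝ g y w * fderiv ℝ (F.h f α) y v := by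
      rintro y ⟨⟨hy, hyR⟩, hyU⟩
      have hyH : y ∈ F.pieces b f K := Set.mem_iUnion₂.2 ⟨α, hα, hy⟩
      refine fderiv_mul_fderiv_comm_of_zeros
        ((hg.contDiffAt (hU.mem_nhds hyU)).hasStrictFDerivAt one_ne_zero)
        ((contDiff_h hbf α).contDiffAt.hasStrictFDerivAt one_ne_zero) ((hgU y hyU).1 hyH) ?_ v w
      filter_upwards [hU.mem_nhds hyU, (isOpen_pieceRegion hbf α).mem_nhds hyR] with z hz hz' h0
      exact (mem_pieces_iff_of_mem_pieceRegion hbf hα hz').1 ((hgU z hz).2 h0)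
    have hap : ∀ v, ContinuousAt (fun y => fderiv ℝ g y v) x := fun v =>
      ((hcont.continuousAt (hU.mem_nhds hxU)).clm_apply continuousAt_const)
    have hap' : ∀ v, ContinuousAt (fun y => fderiv ℝ (F.h f α) y v) x := fun v =>
      (hcont'.continuousAt.clm_apply continuousAt_const)
    have hne := mem_closure_iff_nhdsWithin_neBot.1 hmem
    refine tendsto_nhds_unique (l := 𝓝[(F.smoothedPiece b f α ∩ F.pieceRegion b f α) ∩ U] x)
      (((hap v).mul (hap' w)).tendsto.mono_left nhdsWithin_le_nhds) ?_
    refine (((hap w).mul (hap' v)).tendsto.mono_left nhdsWithin_le_nhds).congr' ?_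
    filter_upwards [self_mem_nhdsWithin] with y hy
    exact (hgen y hy).symm
  obtain ⟨c', hc'⟩ := exists_eq_smul_of_mul_comm (fderiv_h_ne_zero hbf α x) hprop
  refine eq_conormal_or_eq_neg hbf (c := c * c') ?_
  rw [hc, hc', mul_smul]

theorem mem_corayBundle_iff (K : Set W) (u : CosphereBundle (EuclideanSpace ℝ W)) :
    u ∈ corayBundle (F.pieces b f K) ↔
      u ∈ F.positiveRays hbf K ∨ ((u.1, -u.2) : CosphereBundle _) ∈ F.positiveRays hbf K := by
  constructor
  · intro hu
    have hn : Continuous fun u : CosphereBundle (EuclideanSpace ℝ W) =>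
        ((u.1, -u.2) : CosphereBundle _) := continuous_fst.prodMk (Continuous.fun_neg continuous_snd)
    have hcl := (isClosed_positiveRays (F := F) hbf K).union
      ((isClosed_positiveRays (F := F) hbf K).preimage hn)
    refine closure_minimal (fun u hu => ?_) hcl hu
    obtain ⟨α, hα, hx, h | h⟩ := exists_of_isConormalAt hbf hu
    · exact Or.inl ⟨α, hα, hx, h⟩
    · exact Or.inr ⟨α, hα, hx, neg_eq_iff_eq_neg.2 h⟩
  · have key : ∀ α ∈ K, ∀ x ∈ F.smoothedPiece b f α,
        ((x, F.conormal hbf α x) : CosphereBundle _) ∈ corayBundle (F.pieces b f K) ∧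
        ((x, -F.conormal hbf α x) : CosphereBundle _) ∈ corayBundle (F.pieces b f K) := by
      intro α hα x hx
      have hx' := smoothedPiece_subset_closure hbf α hx
      constructor
      · exact map_mem_closure (f := fun x => ((x, F.conormal hbf α x) : CosphereBundle _))
          (continuous_id.prodMk (continuous_conormal hbf α)) hx'
          fun y hy => isConormalAt_of_mem hbf hα hy ⟨_, rfl⟩
      · refine map_mem_closure (f := fun x => ((x, -F.conormal hbf α x) : CosphereBundle _))
          (continuous_id.prodMk (continuous_conormal hbf α).neg) hx'
          fun y hy => isConormalAt_of_mem hbf hα hy ⟨-‖fderiv ℝ (F.h f α) y‖⁻¹, ?_⟩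
        rw [neg_smul]
        rfl
    rintro (⟨α, hα, hx, h⟩ | ⟨α, hα, hx, h⟩)
    · have := (key α hα u.1 hx).1
      rwa [← h] at this
    · have := (key α hα u.1 hx).2
      rw [← show -u.2 = F.conormal hbf α u.1 from h, neg_neg] at this
      exact this

theorem positiveRays_subset_corayBundle (K : Set W) :
    F.positiveRays hbf K ⊆ corayBundle (F.pieces b f K) := fun u hu =>
  (mem_corayBundle_iff hbf K u).2 (Or.inl hu)

theorem colineBundle_pieces (K : Set W) :
    colineBundle (F.pieces b f K) = toColine '' F.positiveRays hbf K := by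
  rw [colineBundle_eq_image]
  apply Set.Subset.antisymm
  · rintro _ ⟨u, hu, rfl⟩
    rcases (mem_corayBundle_iff hbf K u).1 hu with hu | hu
    · exact ⟨u, hu, rfl⟩
    · exact ⟨_, hu, toColine_eq_iff.2 ⟨rfl, Or.inr rfl⟩⟩
  · exact Set.image_mono (positiveRays_subset_corayBundle hbf K)

theorem injOn_toColine_positiveRays (K : Set W) : Set.InjOn toColine (F.positiveRays hbf K) := by
  rintro ⟨x, ξ⟩ ⟨α, -, hx, hξ⟩ ⟨y, η⟩ ⟨β, -, hy, hη⟩ he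
  change ξ = F.conormal hbf α x at hξ
  change η = F.conormal hbf β y at hη
  subst hξ hη
  obtain ⟨h₁, h₂⟩ := toColine_eq_iff.1 he
  change x = y at h₁
  subst h₁
  rcases h₂ with h₂ | h₂
  · exact Prod.ext rfl h₂
  · exact absurd h₂ (conormal_ne_neg_of_h_eq_zero hbf hx.1 hy.1)

/-! ### Good position and the natural coorientation -/

theorem inGoodPosition_pieces (K : Set W) : InGoodPosition (F.pieces b f K) := by
  refine ⟨isClosed_pieces hbf K, ?_, fun x => ?_⟩
  · intro x hx
    obtain ⟨α, hα, hxα⟩ := Set.mem_iUnion₂.1 hx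
    refine closure_mono (fun y hy => ?_) (smoothedPiece_subset_closure hbf α hxα)
    exact ⟨F.conormal hbf α y, isConormalAt_of_mem hbf hα hy ⟨_, rfl⟩⟩
  · refine (Set.finite_range fun α => toColine (x, F.conormal hbf α x)).subset ?_
    rintro l ⟨hl, hlx⟩
    rw [colineBundle_pieces hbf] at hl
    obtain ⟨⟨y, ξ⟩, ⟨α, -, -, hξ⟩, rfl⟩ := hl
    change ξ = F.conormal hbf α y at hξ
    subst hξ
    change y = x at hlx
    subst hlx
    exact ⟨α, rfl⟩

theorem IsNaturalCoorientation.mem_positiveRays {K : Set W}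
    {σ : colineBundle (F.pieces b f K) → corayBundle (F.pieces b f K)}
    (hσ : F.IsNaturalCoorientation f (F.pieces b f K) σ) (l : colineBundle (F.pieces b f K)) :
    (σ l : CosphereBundle _) ∈ F.positiveRays hbf K := by
  obtain ⟨⟨x, ξ⟩, hu, hl⟩ := (colineBundle_pieces hbf K).subset l.2
  have hu' := hu
  obtain ⟨α, -, hx, hξ⟩ := hu'
  rwa [hσ.2 α x ξ l hx.1 ⟨_, conormal_pos hbf α x, by rw [show ξ = _ from hξ]; rfl⟩ hl.symm]

theorem IsNaturalCoorientation.unique {K : Set W}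
    {σ τ : colineBundle (F.pieces b f K) → corayBundle (F.pieces b f K)}
    (hσ : F.IsNaturalCoorientation f (F.pieces b f K) σ)
    (hτ : F.IsNaturalCoorientation f (F.pieces b f K) τ) : σ = τ :=
  funext fun l => Subtype.ext (injOn_toColine_positiveRays hbf K (hσ.mem_positiveRays hbf l)
    (hτ.mem_positiveRays hbf l) ((hσ.1.2 l).trans (hτ.1.2 l).symm))

theorem IsNaturalCoorientation.positiveCorayBundle_eq {K : Set W}
    {σ : colineBundle (F.pieces b f K) → corayBundle (F.pieces b f K)}
    (hσ : F.IsNaturalCoorientation f (F.pieces b f K) σ) :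
    positiveCorayBundle σ = F.positiveRays hbf K := by
  apply Set.Subset.antisymm
  · rintro _ ⟨l, rfl⟩
    exact hσ.mem_positiveRays hbf l
  · intro u hu
    have hl : toColine u ∈ colineBundle (F.pieces b f K) :=
      (colineBundle_pieces hbf K).superset ⟨u, hu, rfl⟩
    exact ⟨⟨_, hl⟩, injOn_toColine_positiveRays hbf K (hσ.mem_positiveRays hbf _) hu (hσ.1.2 _)⟩

/-- The positive rays are closed and meet each line at most once, so the projection to lines
restricts to a closed embedding of them with image the coline bundle; its inverse is the
coorientation. -/
theorem exists_isNaturalCoorientation (K : Set W) :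
    ∃ σ, F.IsNaturalCoorientation f (F.pieces b f K) σ := by
  let π : F.positiveRays hbf K → ProjCotangentBundle (EuclideanSpace ℝ W) := fun u => toColine u
  have hπ : Topology.IsClosedEmbedding π := by
    refine .of_continuous_injective_isClosedMap (continuous_toColine.comp continuous_subtype_val)
      (fun u v h => Subtype.ext (injOn_toColine_positiveRays hbf K u.2 v.2 h)) ?_
    exact isClosedMap_toColine.comp (isClosed_positiveRays hbf K).isClosedMap_subtype_val
  have hr : colineBundle (F.pieces b f K) = Set.range π := by
    rw [colineBundle_pieces hbf, Set.image_eq_range]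
  let e := (Homeomorph.setCongr hr).trans hπ.isEmbedding.toHomeomorph.symm
  have he : ∀ l, toColine (e l : CosphereBundle (EuclideanSpace ℝ W)) = l := fun l =>
    congrArg Subtype.val (hπ.isEmbedding.toHomeomorph.apply_symm_apply (Homeomorph.setCongr hr l))
  refine ⟨fun l => ⟨e l, positiveRays_subset_corayBundle hbf K (e l).2⟩,
    ⟨(continuous_subtype_val.comp e.continuous).subtype_mk _, he⟩, ?_⟩
  rintro α x ξ l hx ⟨c, hc, hξ⟩ hl
  obtain ⟨β, -, hβ, hβ'⟩ := (e l).2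
  obtain ⟨h₁, h₂⟩ := toColine_eq_iff.1 ((he l).trans hl)
  have hξ' := eq_conormal_of_eq_smul hbf hc hξ
  -- The other sign is impossible: `h_α` and `h_β` both vanish at `x`, so their rays are not
  -- opposite.
  refine Prod.ext h₁ (h₂.resolve_right fun h₂ => ?_)
  change (e l).1.1 = x at h₁
  rw [hβ', hξ', h₁] at h₂
  exact conormal_ne_neg_of_h_eq_zero hbf (h₁ ▸ hβ.1) hx h₂

end RootedForest

/-! ## The embedding of the arboreal space -/

theorem ArborealSingularity.openCell_unique {W : Type*} {G : SimpleGraph W}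
    {w : ArborealSingularity G} {p q : TreeCorrespondence G} (hp : w ∈ openCell p)
    (hq : w ∈ openCell q) : p = q := by
  rcases hp with ⟨hp, hp'⟩ | ⟨hp, hp'⟩ <;> rcases hq with ⟨hq, hq'⟩ | ⟨hq, hq'⟩
  · exact hp.eq hq
  · exact absurd (hp' q) hq.ne'
  · exact absurd (hq' p) hp.ne'
  · exact le_antisymm (hq' p hp.ne') (hp' q hq.ne')

namespace RootedForest

variable {W : Type*} (F : RootedForest W)

/-- The rooting of a component of a rooted forest. -/
noncomputable def componentRooting (c : F.graph.ConnectedComponent) :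
    Rooting c.toSimpleGraph where
  par u v := F.IsParent u v
  ht u := F.height u
  ht_lt h := F.rooting.ht_lt h
  par_unique h h' := Subtype.ext (F.isParent_unique h h')
  adj_iff := F.rooting.adj_iff

variable {F}

theorem IsParent.mem_supp {c : F.graph.ConnectedComponent} {u v : W} (h : F.IsParent u v)
    (hv : v ∈ c.supp) : u ∈ c.supp := c.mem_supp_of_adj_mem_supp hv h.1.symm

theorem le_of_component_le {c : F.graph.ConnectedComponent} {u v : c}
    (h : (F.componentRooting c).le u v) : F.rooting.le u v := by
  induction h with
  | refl => exact Rooting.le_refl _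
  | tail _ hp ih => exact ih.tail hp

theorem exists_component_le {c : F.graph.ConnectedComponent} {u : W} {v : c}
    (h : F.rooting.le u v) : ∃ hu : u ∈ c, (F.componentRooting c).le ⟨u, hu⟩ v := by
  obtain ⟨v, hv⟩ := v
  change Relation.ReflTransGen F.rooting.par u v at h
  induction h with
  | refl => exact ⟨hv, Rooting.le_refl _⟩
  | @tail a b _ hp ih =>
    have ha : a ∈ c := IsParent.mem_supp hp hv
    obtain ⟨hu, hle⟩ := ih ha
    exact ⟨hu, Relation.ReflTransGen.tail hle
      (show (F.componentRooting c).par ⟨a, ha⟩ ⟨b, hv⟩ from hp)⟩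

theorem uniqueRoot_componentRooting (c : F.graph.ConnectedComponent) :
    (F.componentRooting c).UniqueRoot := by
  have key : ∀ i : c, (∀ k, ¬ (F.componentRooting c).par k i) → (i : W) ∈ F.roots := by
    intro i hi
    by_contra h
    have hp := F.parent_spec i h
    exact hi ⟨_, hp.mem_supp i.2⟩ hp
  intro i j hi hj
  refine Subtype.ext ?_
  rw [F.eq_rootOf (key i hi) (c.reachable_of_mem_supp i.2 j.2)]
  exact (F.eq_rootOf (key j hj) (SimpleGraph.Reachable.refl _)).symm

theorem nonempty_component (c : F.graph.ConnectedComponent) : Nonempty c :=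
  c.nonempty_supp.to_subtype

variable [Fintype W]

open Classical in
/-- The sheared coordinates of the point with given coordinates in a component and outside. -/
noncomputable def glueCoords (c : F.graph.ConnectedComponent)
    (y : ArborealSingularity c.toSimpleGraph × ({v // v ∉ c.supp} → ℝ)) (v : W) : ℝ :=
  if h : v ∈ c.supp then y.1.realize (F.componentRooting c) ⟨v, h⟩ else y.2 ⟨v, h⟩

theorem glueCoords_of_mem {c : F.graph.ConnectedComponent}
    (y : ArborealSingularity c.toSimpleGraph × ({v // v ∉ c.supp} → ℝ)) (v : c) :
    glueCoords c y v = y.1.realize (F.componentRooting c) v := dif_pos v.2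

theorem glueCoords_of_notMem {c : F.graph.ConnectedComponent}
    (y : ArborealSingularity c.toSimpleGraph × ({v // v ∉ c.supp} → ℝ)) (v : {v // v ∉ c.supp}) :
    glueCoords c y v = y.2 v := dif_neg v.2

theorem continuous_glueCoords (c : F.graph.ConnectedComponent) :
    Continuous (glueCoords (F := F) c) := by
  refine continuous_pi fun v => ?_
  by_cases h : v ∈ c.supp
  · simp only [glueCoords, dif_pos h]
    exact (continuous_apply _).comp
      ((ArborealSingularity.continuous_realize _).comp continuous_fst)
  · simp only [glueCoords, dif_neg h]
    exact (continuous_apply _).comp continuous_snd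

/-- The coordinates bound every weight by `exists_le_abs_realize`, and weight space is closed in a
finite-dimensional space. -/
theorem isCompact_preimage_glueCoords (c : F.graph.ConnectedComponent) {K : Set (W → ℝ)}
    (hK : IsCompact K) : IsCompact (glueCoords (F := F) c ⁻¹' K) := by
  have := Fintype.ofFinite {v // v ∉ c.supp}
  obtain ⟨C, hC⟩ := hK.isBounded.exists_norm_le
  have hcl : IsClosed (glueCoords (F := F) c ⁻¹' K) :=
    hK.isClosed.preimage (continuous_glueCoords c)
  have he := (ArborealSingularity.isClosedEmbedding_val (G := c.toSimpleGraph)).prodMap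
    (Topology.IsClosedEmbedding.id (X := {v // v ∉ c.supp} → ℝ))
  have hcomp := he.isCompact_preimage (K := Metric.closedBall 0 |C| ×ˢ Metric.closedBall 0 |C|)
    ((isCompact_closedBall _ _).prod (isCompact_closedBall _ _))
  refine hcomp.of_isClosed_subset hcl fun y hy => ?_
  have hb : ∀ v, |glueCoords c y v| ≤ |C| := fun v =>
    (norm_le_pi_norm (glueCoords c y) v).trans ((hC _ hy).trans (le_abs_self C))
  refine ⟨?_, ?_⟩
  · refine mem_closedBall_zero_iff.2 ((pi_norm_le_iff_of_nonneg (abs_nonneg C)).2 fun q => ?_)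
    by_cases hq : y.1.1 q = 0
    · simp [hq]
    · obtain ⟨i, hi⟩ := ArborealSingularity.exists_le_abs_realize
        (uniqueRoot_componentRooting c) y.1 hq
      rw [← glueCoords_of_mem] at hi
      exact hi.trans (hb i)
  · refine mem_closedBall_zero_iff.2 ((pi_norm_le_iff_of_nonneg (abs_nonneg C)).2 fun v => ?_)
    have := hb v
    rwa [glueCoords_of_notMem] at this

/-- The top correspondence of a point of an arboreal singularity. -/
noncomputable def topCorrespondence {c : F.graph.ConnectedComponent}
    (w : ArborealSingularity c.toSimpleGraph) : TreeCorrespondence c.toSimpleGraph :=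
  haveI := nonempty_component c
  (ArborealSingularity.exists_mem_openCell (uniqueRoot_componentRooting c) w).choose

theorem mem_openCell_topCorrespondence {c : F.graph.ConnectedComponent}
    (w : ArborealSingularity c.toSimpleGraph) :
    w ∈ ArborealSingularity.openCell (topCorrespondence w) :=
  haveI := nonempty_component c
  (ArborealSingularity.exists_mem_openCell (uniqueRoot_componentRooting c) w).choose_spec

variable (F) in
/-- The lowest vertex of the domain of the top correspondence of a point. -/
noncomputable def sheet (z : ArborealSpace F.graph) : W :=
  ((topCorrespondence z.2.1).bot (F.componentRooting z.1) : z.1)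

theorem sheet_eq {z : ArborealSpace F.graph} {p : TreeCorrespondence z.1.toSimpleGraph}
    (hp : z.2.1 ∈ ArborealSingularity.openCell p) :
    F.sheet z = (p.bot (F.componentRooting z.1) : z.1) := by
  rw [sheet, ArborealSingularity.openCell_unique (mem_openCell_topCorrespondence z.2.1) hp]

theorem sheet_mem (z : ArborealSpace F.graph) : F.sheet z ∈ z.1 := Subtype.coe_prop _

variable {δ : ℝ} {b : ℝ → ℝ} {f : ℝ × ℝ → ℝ}

variable (F b f) in
/-- The point of the Euclidean space below a point of the arboreal space. -/
noncomputable def arborealPoint (z : ArborealSpace F.graph) : EuclideanSpace ℝ W :=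
  F.unshear b f (glueCoords z.1 z.2)

theorem shear_arborealPoint (z : ArborealSpace F.graph) :
    F.shear b f (F.arborealPoint b f z) = glueCoords z.1 z.2 := F.shear_unshear b f _

theorem isFirstZero_sheet (z : ArborealSpace F.graph) :
    F.IsFirstZero b f (F.arborealPoint b f z) (F.sheet z) := by
  have hc := ArborealSingularity.realize_mem_cell (R := F.componentRooting z.1)
    (mem_openCell_topCorrespondence z.2.1)
  refine ⟨?_, fun β hβ hne => ?_⟩
  · rw [shear_arborealPoint]
    exact (glueCoords_of_mem z.2 _).trans
      (TreeCorrespondence.apply_bot (TreeCorrespondence.cell_subset_closedCell hc))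
  · obtain ⟨hβc, hle⟩ := exists_component_le hβ
    rw [shear_arborealPoint, glueCoords_of_mem z.2 ⟨β, hβc⟩]
    exact TreeCorrespondence.pos_apply_of_le_bot hc hle fun e => hne (congrArg Subtype.val e)

variable (hbf : IsSmoothingPair δ b f)

variable (F) in
/-- The embedding of the arboreal space into the cosphere bundle. -/
noncomputable def arborealEmbedding (z : ArborealSpace F.graph) :
    CosphereBundle (EuclideanSpace ℝ W) :=
  (F.arborealPoint b f z, F.conormal hbf (F.sheet z) (F.arborealPoint b f z))

include hbf

theorem continuous_arborealPoint : Continuous (F.arborealPoint b f) :=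
  continuous_sigma fun c => (continuous_unshear hbf).comp (continuous_glueCoords c)

/-- The sheet is only piecewise constant. On the closed set of points supported below a fixed `p`,
the ray is that of the lowest vertex of `p`, because `h` vanishes both there and at the sheet;
finitely many such sets cover each component. -/
theorem continuous_arborealEmbedding : Continuous (F.arborealEmbedding hbf) := by
  have hpt := continuous_arborealPoint (F := F) hbf
  refine continuous_sigma fun c => ?_
  let K : TreeCorrespondence c.toSimpleGraph →
      Set (ArborealSingularity c.toSimpleGraph × ({v // v ∉ c.supp} → ℝ)) :=
    fun p => {y | ∀ q, ¬ q ≤ p → y.1.1 q = 0}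
  have hK : ∀ p, IsClosed (K p) := fun p => by
    simp only [K, Set.ofPred_forall]
    refine isClosed_iInter fun q => isClosed_iInter fun _ => isClosed_eq ?_ continuous_const
    exact (continuous_apply q).comp (continuous_subtype_val.comp continuous_fst)
  refine (locallyFinite_of_finite K).continuous ?_ hK fun p => ?_
  · refine Set.eq_univ_of_forall fun y => Set.mem_iUnion.2 ⟨topCorrespondence y.1, fun q hq => ?_⟩
    by_contra h
    exact hq (ArborealSingularity.le_of_mem_openCell (mem_openCell_topCorrespondence y.1) q h)
  · have hpt' : Continuous fun y => F.arborealPoint b f ⟨c, y⟩ := hpt.comp continuous_sigmaMk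
    refine (hpt'.prodMk ((continuous_conormal (F := F) hbf
      (p.bot (F.componentRooting c) : c)).comp hpt')).continuousOn.congr fun y hy => ?_
    refine Prod.ext rfl ?_
    have hle : ∀ q, y.1.1 q ≠ 0 → q ≤ p := fun q hq => by
      by_contra h
      exact hq (hy q h)
    have htop : topCorrespondence y.1 ≤ p := by
      rcases mem_openCell_topCorrespondence y.1 with h | h
      · exact h.1.le
      · exact hle _ h.1.ne'
    have hcl := ArborealSingularity.combination_mem_closedCell (R := F.componentRooting c)
      y.1.2.1 hle
    refine conormal_eq_of_le hbf (le_of_component_le (TreeCorrespondence.bot_le_bot htop))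
      (IsFirstZero.h_eq_zero hbf (isFirstZero_sheet _)) ?_
    refine (h_eq_zero_iff hbf _ _).2 ⟨fun β hβ => ?_, _, Rooting.le_refl _, ?_⟩
    · obtain ⟨hβc, hβ'⟩ := exists_component_le hβ
      rw [shear_arborealPoint, glueCoords_of_mem y ⟨β, hβc⟩]
      exact TreeCorrespondence.nonneg_of_le_bot hcl hβ'
    · rw [shear_arborealPoint]
      exact (glueCoords_of_mem y _).trans (TreeCorrespondence.apply_bot hcl)

theorem isProperMap_arborealPoint : IsProperMap (F.arborealPoint b f) := by
  refine isProperMap_iff_isCompact_preimage.2 ⟨continuous_arborealPoint hbf, fun K hK => ?_⟩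
  have hK' := hK.image (continuous_shear (F := F) hbf)
  have : F.arborealPoint b f ⁻¹' K = ⋃ c : F.graph.ConnectedComponent,
      Sigma.mk c '' (glueCoords (F := F) c ⁻¹' (F.shear b f '' K)) := by
    ext ⟨c, y⟩
    simp only [Set.mem_iUnion]
    constructor
    · intro h
      exact ⟨c, y, ⟨_, h, shear_arborealPoint _⟩, rfl⟩
    · rintro ⟨c', y', ⟨x, hx, hxy⟩, he⟩
      rw [← he]
      change F.unshear b f (glueCoords c' y') ∈ K
      rwa [← hxy, unshear_shear]
  rw [this]
  exact isCompact_iUnion fun c =>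
    (isCompact_preimage_glueCoords c hK').image continuous_sigmaMk

/-- The ray recovers the first zero, which determines the component of the graph; the base point
recovers all coordinates. Vector and lowest vertex together determine the point of the arboreal
singularity. -/
theorem injective_arborealEmbedding : Function.Injective (F.arborealEmbedding hbf) := by
  intro z z' h
  have h₁ : F.arborealPoint b f z = F.arborealPoint b f z' := congrArg Prod.fst h
  have h₂ : F.conormal hbf (F.sheet z) (F.arborealPoint b f z) =
      F.conormal hbf (F.sheet z') (F.arborealPoint b f z') := congrArg Prod.snd h
  have hs : F.sheet z = F.sheet z' := by
    have hz := isFirstZero_sheet (b := b) (f := f) z'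
    rw [← h₁] at hz h₂
    exact (isFirstZero_sheet z).eq_of_conormal hbf hz (Or.inl h₂)
  have hc : glueCoords z.1 z.2 = glueCoords z'.1 z'.2 := by
    rw [← shear_arborealPoint (b := b) (f := f), h₁, shear_arborealPoint]
  obtain ⟨c, w, y⟩ := z
  obtain ⟨c', w', y'⟩ := z'
  have hcc : c = c' := by
    have h := sheet_mem (F := F) ⟨c, w, y⟩
    have h' := sheet_mem (F := F) ⟨c', w', y'⟩
    rw [hs] at h
    exact ((SimpleGraph.ConnectedComponent.mem_supp_iff _ _).1 h).symm.trans
      ((SimpleGraph.ConnectedComponent.mem_supp_iff _ _).1 h')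
  subst hcc
  have := nonempty_component c
  have hy : y = y' := funext fun v => by
    have := congrFun hc v
    rwa [glueCoords_of_notMem, glueCoords_of_notMem] at this
  have hw : w = w' := by
    refine ArborealSingularity.eq_of_realize_eq_of_bot_eq (uniqueRoot_componentRooting c)
      (mem_openCell_topCorrespondence w) (mem_openCell_topCorrespondence w') (funext fun v => ?_)
      (Subtype.ext hs)
    have := congrFun hc v
    rwa [glueCoords_of_mem, glueCoords_of_mem] at this
  rw [hy, hw]

theorem isClosedEmbedding_arborealEmbedding :
    Topology.IsClosedEmbedding (F.arborealEmbedding hbf) :=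
  .of_continuous_injective_isClosedMap (continuous_arborealEmbedding hbf)
    (injective_arborealEmbedding hbf)
    (isProperMap_of_comp_of_t2 (continuous_arborealEmbedding hbf) continuous_fst
      (isProperMap_arborealPoint hbf)).isClosedMap

/-- The component of `γ` carries the cell read off from the signs of `x`; the other sheared
coordinates fill the Euclidean factor. -/
theorem exists_arborealEmbedding_eq {x : EuclideanSpace ℝ W} {γ : W}
    (h : F.IsFirstZero b f x γ) :
    ∃ z, F.arborealEmbedding hbf z = (x, F.conormal hbf γ x) ∧ F.sheet z = γ := by
  let c := F.graph.connectedComponentMk γ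
  have hγ : γ ∈ c := rfl
  obtain ⟨p, w, hw, hwu, hb⟩ := ArborealSingularity.exists_realize_eq
    (uniqueRoot_componentRooting c) (u := fun v : c => F.shear b f x v) (γ := ⟨γ, hγ⟩) h.1
    fun β hβ hne => h.2 β (le_of_component_le hβ) fun e => hne (Subtype.ext e)
  let z : ArborealSpace F.graph := ⟨c, w, fun v => F.shear b f x v⟩
  have hs : F.sheet z = γ := by
    rw [sheet_eq (z := z) hw, hb]
  have hz : F.arborealPoint b f z = x := by
    have : glueCoords z.1 z.2 = F.shear b f x := by
      ext v
      by_cases hv : v ∈ c.supp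
      · exact (glueCoords_of_mem z.2 ⟨v, hv⟩).trans (congrFun hwu ⟨v, hv⟩)
      · exact glueCoords_of_notMem z.2 ⟨v, hv⟩
    rw [arborealPoint, this, unshear_shear]
  refine ⟨z, ?_, hs⟩
  rw [arborealEmbedding, hs, hz]

end RootedForest

/-! ## Marked leaves -/

namespace TreeCorrespondence

variable {W : Type*} {G : SimpleGraph W} {p : TreeCorrespondence G}

theorem domain_eq_of_fibers_eq_singleton {S : Set W} (h : p.fibers = {S}) : p.domain = S := by
  rw [domain, h, Set.sUnion_singleton]

theorem fibers_eq_singleton {B : Set W} (hB : B ∈ p.fibers) (h : p.domain ⊆ B) :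
    p.fibers = {B} := by
  ext C
  constructor
  · intro hC
    obtain ⟨i, hi⟩ := p.fibers_nonempty hC
    exact fiber_eq hC hB hi (h (mem_domain hC hi))
  · rintro rfl
    exact hB

end TreeCorrespondence

namespace LeafyRootedForest

variable {V : Type*} (F : LeafyRootedForest V)

theorem plus_eq_inl_of_adj_inr {a : {v // v ∈ F.marked}} {w : F.PlusVertex}
    (h : F.plus.graph.Adj (Sum.inr a) w) : w = Sum.inl (a : V) := by
  rcases w with w | c
  · exact congrArg Sum.inl (show w = a from h)
  · exact False.elim h

theorem plus_isParent_inr (a : {v // v ∈ F.marked}) :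
    F.plus.IsParent (Sum.inl (a : V)) (Sum.inr a) := by
  have hr : (Sum.inr a : F.PlusVertex) ∉ F.plus.roots := by
    rintro ⟨v, -, hv⟩
    cases hv
  have hp := F.plus.parent_spec _ hr
  rwa [← F.plus_eq_inl_of_adj_inr hp.1.symm]

/-- Otherwise `u` would have `v` as parent in the enlarged forest besides its old parent, which by
induction is still one. -/
theorem plus_isParent_inl {u v : V} (h : F.IsParent u v) :
    F.plus.IsParent (Sum.inl u) (Sum.inl v) := by
  induction hn : F.height u using Nat.strong_induction_on generalizing u v with
  | _ n ih =>
    have hadj : F.plus.graph.Adj (Sum.inl u) (Sum.inl v) := h.1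
    refine (F.plus.isParent_or_isParent_of_adj hadj).resolve_right fun h' => ?_
    have hu : u ∉ F.roots := fun hu => h'.notMem_roots ⟨u, hu, rfl⟩
    have hw := F.parent_spec u hu
    have := F.plus.isParent_unique h' (ih _ (by have := hw.2; omega) hw rfl)
    rw [← Sum.inl_injective this] at hw
    have h₁ := hw.2
    have h₂ := h.2
    omega

theorem plus_eq_inr_of_isParent {a : {v // v ∈ F.marked}} {w : F.PlusVertex}
    (h : F.plus.IsParent (Sum.inl (a : V)) w) : w = Sum.inr a := by
  rcases w with w | c
  · exfalso
    have hadj : F.graph.Adj a w := h.1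
    rcases F.isParent_or_isParent_of_adj hadj with h' | h'
    · refine hadj.ne (F.marked_isLeaf a a.2 w ⟨hadj.reachable, ?_⟩).symm
      rw [SimpleGraph.dist_eq_one_iff_adj.2 hadj]
      exact h'.2.symm
    · have h₁ := (F.plus_isParent_inl h').2
      have h₂ := h.2
      omega
  · exact congrArg Sum.inr (Subtype.ext (show (a : V) = c from h.1)).symm

theorem plus_eq_of_le_inl {a : {v // v ∈ F.marked}} {w : F.PlusVertex}
    (h : F.plus.rooting.le (Sum.inl (a : V)) w) : w = Sum.inl (a : V) ∨ w = Sum.inr a := by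
  induction h with
  | refl => exact Or.inl rfl
  | @tail c d _ hp ih =>
    have hp : F.plus.IsParent c d := hp
    rcases ih with rfl | rfl
    · exact Or.inr (F.plus_eq_inr_of_isParent hp)
    · rw [F.plus_eq_inl_of_adj_inr hp.1] at hp
      have h₁ := hp.2
      have h₂ := (F.plus_isParent_inr a).2
      omega

variable [Fintype V]

open RootedForest

/-- In both deleted cells the lowest vertex is `a`. The coordinate at `a⁺` is negative if `a⁺` is
outside the domain and positive if it shares the fiber of `a`. -/
theorem sheet_eq_of_mem_openCell (a : {v // v ∈ F.marked}) {z : ArborealSpace F.plus.graph}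
    (h : z ∈ ArborealSpace.openCell (F.leafCorrespondence a) ∪
      ArborealSpace.openCell (F.edgeCorrespondence a)) :
    F.plus.sheet z = Sum.inl (a : V) ∧ glueCoords z.1 z.2 (Sum.inr a) ≠ 0 := by
  obtain ⟨D, hinl, hsub, q, hq, hzq⟩ : ∃ D : Set F.PlusVertex, Sum.inl (a : V) ∈ D ∧
      (∀ v ∈ D, v = Sum.inl (a : V) ∨ v = Sum.inr a) ∧
      ∃ q : TreeCorrespondence z.1.toSimpleGraph,
        (fun B => Subtype.val '' B) '' q.fibers = {D} ∧
          z.2.1 ∈ ArborealSingularity.openCell q := by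
    rcases h with ⟨q, hq, hzq⟩ | ⟨q, hq, hzq⟩
    · exact ⟨{Sum.inl (a : V)}, rfl, fun v hv => Or.inl hv, q, hq, hzq⟩
    · exact ⟨{Sum.inr a, Sum.inl (a : V)}, Or.inr rfl, fun v hv => hv.symm, q, hq, hzq⟩
  obtain ⟨S, hS, hSD⟩ : ∃ S ∈ q.fibers, Subtype.val '' S = D :=
    (Set.ext_iff.1 hq D).2 rfl
  have hfib : q.fibers = {S} := by
    ext B
    constructor
    · intro hB
      have : Subtype.val '' B = D := (Set.ext_iff.1 hq _).1 ⟨B, hB, rfl⟩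
      exact Set.image_injective.2 Subtype.val_injective (this.trans hSD.symm)
    · rintro rfl
      exact hS
  have hdom := TreeCorrespondence.domain_eq_of_fibers_eq_singleton hfib
  obtain ⟨⟨_, hc⟩, hmem, rfl⟩ := hSD.symm.subset hinl
  have hinr : Sum.inr a ∈ z.1 :=
    z.1.mem_supp_of_adj_mem_supp hc (F.plus_isParent_inr a).1
  have hpar : (F.plus.componentRooting z.1).par ⟨Sum.inl (a : V), hc⟩ ⟨Sum.inr a, hinr⟩ :=
    F.plus_isParent_inr a
  have hb := q.isBot_bot (F.plus.componentRooting z.1)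
  have hcell := ArborealSingularity.realize_mem_cell (R := F.plus.componentRooting z.1) hzq
  constructor
  · rw [sheet_eq hzq]
    have h₁ : (q.bot (F.plus.componentRooting z.1)).1 ∈ D := by
      rw [← hSD, ← hdom]
      exact ⟨_, hb.mem, rfl⟩
    refine (hsub _ h₁).resolve_right fun h₂ => ?_
    refine hb.par_notMem ⟨Sum.inl (a : V), hc⟩ ?_ (hdom.symm ▸ hmem)
    rwa [show q.bot (F.plus.componentRooting z.1) = ⟨Sum.inr a, hinr⟩ from Subtype.ext h₂]
  · rw [glueCoords_of_mem z.2 ⟨Sum.inr a, hinr⟩]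
    by_cases hS' : (⟨Sum.inr a, hinr⟩ : z.1) ∈ S
    · exact ((hcell _).1 (Or.inl ⟨S, hS, hS', _, hmem, hpar⟩)).ne'
    · exact ((hcell _).2.1 ⟨hdom.symm ▸ hS', _, hdom.symm ▸ hmem, hpar⟩).ne

/-- Above a marked leaf there is only `a⁺`, so the domain is `{a}` or `{a, a⁺}`; a nonzero
coordinate at `a⁺` excludes splitting the latter into two fibers. -/
theorem mem_openCell_of_sheet_eq (a : {v // v ∈ F.marked}) {z : ArborealSpace F.plus.graph}
    (h : F.plus.sheet z = Sum.inl (a : V)) (h0 : glueCoords z.1 z.2 (Sum.inr a) ≠ 0) :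
    z ∈ ArborealSpace.openCell (F.leafCorrespondence a) ∪
      ArborealSpace.openCell (F.edgeCorrespondence a) := by
  set q := topCorrespondence z.2.1 with hq
  have hzq : z.2.1 ∈ ArborealSingularity.openCell q := mem_openCell_topCorrespondence z.2.1
  have hc : Sum.inl (a : V) ∈ z.1 := h ▸ sheet_mem z
  have hinr : Sum.inr a ∈ z.1 :=
    z.1.mem_supp_of_adj_mem_supp hc (F.plus_isParent_inr a).1
  have hb := q.isBot_bot (F.plus.componentRooting z.1)
  have hbot : q.bot (F.plus.componentRooting z.1) = ⟨Sum.inl (a : V), hc⟩ := Subtype.ext h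
  have hcell := ArborealSingularity.realize_mem_cell (R := F.plus.componentRooting z.1) hzq
  have hdom : ∀ i ∈ q.domain, i.1 = Sum.inl (a : V) ∨ i.1 = Sum.inr a := fun i hi => by
    have := le_of_component_le (hb.le hi)
    rw [hbot] at this
    exact F.plus_eq_of_le_inl this
  rw [glueCoords_of_mem z.2 ⟨Sum.inr a, hinr⟩] at h0
  have hmem := hb.mem
  rw [hbot] at hmem
  by_cases hS : (⟨Sum.inr a, hinr⟩ : z.1) ∈ q.domain
  · have hpos : q.Pos (F.plus.componentRooting z.1) ⟨Sum.inr a, hinr⟩ := by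
      by_contra hpos
      exact h0 ((hcell _).2.2 hS hpos)
    obtain ⟨B, hB, hiB, π, hπ, hpar⟩ := hpos.exists_fiber hS
    obtain rfl : π = ⟨Sum.inl (a : V), hc⟩ :=
      Subtype.ext (F.plus.isParent_unique hpar (F.plus_isParent_inr a))
    have hsub : q.domain ⊆ B := fun i hi => by
      rcases hdom i hi with h | h
      · rwa [show i = ⟨Sum.inl (a : V), hc⟩ from Subtype.ext h]
      · rwa [show i = ⟨Sum.inr a, hinr⟩ from Subtype.ext h]
    refine Or.inr ⟨q, ?_, hzq⟩
    rw [TreeCorrespondence.fibers_eq_singleton hB hsub, Set.image_singleton]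
    refine congrArg _ (Set.Subset.antisymm ?_ ?_)
    · rintro _ ⟨i, hi, rfl⟩
      exact (hdom i (TreeCorrespondence.mem_domain hB hi)).symm
    · rintro _ (rfl | rfl)
      · exact ⟨_, hiB, rfl⟩
      · exact ⟨_, hπ, rfl⟩
  · have hdom' : ∀ i ∈ q.domain, i.1 = Sum.inl (a : V) := fun i hi =>
      (hdom i hi).resolve_right fun h => hS (by
        rwa [show i = ⟨Sum.inr a, hinr⟩ from Subtype.ext h] at hi)
    obtain ⟨B, hB, hiB⟩ := hmem
    have hsub : q.domain ⊆ B := fun i hi => by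
      rwa [show i = ⟨Sum.inl (a : V), hc⟩ from Subtype.ext (hdom' i hi)]
    refine Or.inl ⟨q, ?_, hzq⟩
    rw [TreeCorrespondence.fibers_eq_singleton hB hsub, Set.image_singleton]
    refine congrArg _ (Set.Subset.antisymm ?_ ?_)
    · rintro _ ⟨i, hi, rfl⟩
      exact hdom' i (TreeCorrespondence.mem_domain hB hi)
    · rintro _ rfl
      exact ⟨_, hiB, rfl⟩

theorem mem_deletedArborealSpace_iff (z : ArborealSpace F.plus.graph) :
    z ∈ F.deletedArborealSpace ↔
      ∀ a : {v // v ∈ F.marked}, F.plus.sheet z = Sum.inl (a : V) → glueCoords z.1 z.2 (Sum.inr a) = 0 := by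
  rw [deletedArborealSpace, Set.mem_compl_iff, Set.mem_iUnion, not_exists]
  refine forall_congr' fun a => ⟨fun h hs => ?_, fun h hz => ?_⟩
  · by_contra h0
    exact h (F.mem_openCell_of_sheet_eq a hs h0)
  · obtain ⟨hs, h0⟩ := F.sheet_eq_of_mem_openCell a hz
    exact h0 (h hs)

variable {F} {δ : ℝ} {b : ℝ → ℝ} {f : ℝ × ℝ → ℝ} (hbf : IsSmoothingPair δ b f)

include hbf

theorem image_deletedArborealSpace :
    F.plus.arborealEmbedding hbf '' F.deletedArborealSpace =
      F.plus.positiveRays hbf {α : F.PlusVertex | ∀ v ∈ F.marked, α ≠ Sum.inl v} := by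
  apply Set.Subset.antisymm
  · rintro _ ⟨z, hz, rfl⟩
    have hz0 := (F.mem_deletedArborealSpace_iff z).1 hz
    have hfz := isFirstZero_sheet (b := b) (f := f) z
    by_cases hK : ∀ v ∈ F.marked, F.plus.sheet z ≠ Sum.inl v
    · refine ⟨F.plus.sheet z, hK, (mem_smoothedPiece_iff hbf _ _).2 ⟨hfz.1, ?_⟩, rfl⟩
      exact ((h_eq_zero_iff hbf _ _).1 (IsFirstZero.h_eq_zero hbf hfz)).1
    -- When the first zero is a marked leaf, the coordinate at the new vertex above it is zero, so
    -- the point lies on the piece of that new vertex, whose ray is the same.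
    · push Not at hK
      obtain ⟨v, hv, hs⟩ := hK
      have hp := F.plus_isParent_inr ⟨v, hv⟩
      have h0 : F.plus.shear b f (F.plus.arborealPoint b f z) (Sum.inr ⟨v, hv⟩) = 0 := by
        rw [shear_arborealPoint]
        exact hz0 ⟨v, hv⟩ hs
      have hh := IsFirstZero.h_eq_zero hbf hfz
      have hmem : F.plus.arborealPoint b f z ∈
          F.plus.smoothedPiece b f (Sum.inr ⟨v, hv⟩) := by
        refine (mem_smoothedPiece_iff hbf _ _).2 ⟨h0, fun β hβ => ?_⟩
        rcases (F.plus.le_iff_of_isParent hp).1 hβ with hβ | rfl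
        · exact ((h_eq_zero_iff hbf _ _).1 hh).1 β (hs ▸ hβ)
        · exact h0.ge
      refine ⟨Sum.inr ⟨v, hv⟩, fun _ _ h => (Sum.inr_ne_inl h).elim, hmem, ?_⟩
      exact conormal_eq_of_le hbf (hs ▸ Rooting.par_le (R := F.plus.rooting) hp) hh hmem.1
  · rintro ⟨x, ξ⟩ ⟨α, hα, hx, hξ⟩
    change ξ = F.plus.conormal hbf α x at hξ
    obtain ⟨γ, hγα, hγ, hν⟩ := exists_isFirstZero hbf hx.1
    obtain ⟨z, hz, hs⟩ := exists_arborealEmbedding_eq hbf hγ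
    refine ⟨z, (F.mem_deletedArborealSpace_iff z).2 fun a ha => ?_, ?_⟩
    · have hxz : F.plus.arborealPoint b f z = x := congrArg Prod.fst hz
      rw [← shear_arborealPoint (b := b) (f := f), hxz]
      -- A piece present in the hypersurface whose first zero is the leaf `a` must be that of `a⁺`,
      -- so the coordinate there is zero.
      rw [← hs, ha] at hγα
      rcases F.plus_eq_of_le_inl hγα with h | h
      · exact absurd h (hα a a.2)
      · rw [← h]
        exact ((mem_smoothedPiece_iff hbf x α).1 hx).1
    · rw [hz, hξ, hν]

end LeafyRootedForest

/-! ### The proposition -/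

theorem proposition4 {V : Type*} [Fintype V] [Nonempty V] (F : LeafyRootedForest V)
    (δ : ℝ) (hδ : 0 < δ) (b : ℝ → ℝ) (f : ℝ × ℝ → ℝ) (hbf : IsSmoothingPair δ b f) :
    InGoodPosition (F.smoothedHypersurface b f) ∧
    (∃! σ : colineBundle (F.smoothedHypersurface b f) → corayBundle (F.smoothedHypersurface b f),
      F.plus.IsNaturalCoorientation f (F.smoothedHypersurface b f) σ) ∧
    IsClosed F.deletedArborealSpace ∧
    ∀ σ : colineBundle (F.smoothedHypersurface b f) → corayBundle (F.smoothedHypersurface b f),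
      F.plus.IsNaturalCoorientation f (F.smoothedHypersurface b f) σ →
      Nonempty (positiveCorayBundle σ ≃ₜ F.deletedArborealSpace) := by
  have hH : F.smoothedHypersurface b f =
      F.plus.pieces b f {α : F.PlusVertex | ∀ v ∈ F.marked, α ≠ Sum.inl v} := rfl
  have he := RootedForest.isClosedEmbedding_arborealEmbedding (F := F.plus) hbf
  rw [hH]
  refine ⟨RootedForest.inGoodPosition_pieces hbf _, ?_, ?_, fun σ hσ => ?_⟩
  · obtain ⟨σ, hσ⟩ := RootedForest.exists_isNaturalCoorientation (F := F.plus) hbf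
      {α : F.PlusVertex | ∀ v ∈ F.marked, α ≠ Sum.inl v}
    exact ⟨σ, hσ, fun τ hτ => hτ.unique hbf hσ⟩
  -- Closedness is pulled back from the positive rays: by injectivity, the deleted space is exactly
  -- their preimage.
  · have := (RootedForest.isClosed_positiveRays (F := F.plus) hbf
      {α : F.PlusVertex | ∀ v ∈ F.marked, α ≠ Sum.inl v}).preimage he.continuous
    rwa [← LeafyRootedForest.image_deletedArborealSpace hbf,
      Set.preimage_image_eq _ he.injective] at this
  · have e := he.isEmbedding.homeomorphImage F.deletedArborealSpace
    rw [LeafyRootedForest.image_deletedArborealSpace hbf,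
      ← RootedForest.IsNaturalCoorientation.positiveCorayBundle_eq hbf hσ] at e
    exact ⟨e.symm⟩
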